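/- Let $M$ be a complete (connected, smooth) Riemannian manifold without boundary, with distance $d$, volume measure $\mathrm{vol}$ and Laplace--Beltrami operator $\Delta$; fix $p\in M$ and $R_0>0$, put $r(x)=d(x,p)$, and let $B_{R_0}(p)=\{x\in M: r(x)\le R_0\}$. Let $\Pi$ be an end of $M$ with respect to $B_{R_0}(p)$, that is, a non-compact connected component of $M\setminus B_{R_0}(p)$. Write $\Pi_s^t=\{x\in\Pi : s\le r(x)\le t\}$, and let $\mu_1(\Pi)$ be the bottom of the spectrum of $-\Delta$ on $L^2(\Pi)$ with Dirichlet boundary condition. Suppose that $\mu_1(\Pi)>\mu$ for some constant $\mu\in\mathbb R$, and set $a=\sqrt{\mu_1(\Pi)-\mu}>0$. Let $f\in C^2(\Pi)$ be a nonnegative function with $\Delta f\ge -\mu f$ on $\Pi$. If there is a sequence of real numbers $R_j\to\infty$ such that $$\int_{\Pi_{R_j}^{R_j+1}} e^{-2ar}f^2\,d\mathrm{vol}\;\longrightarrow\;0\qquad (j\to\infty),$$ then, for every $\rho>R_0+1$, $$\int_{\Pi_\rho^{\rho+1}} f^2\,d\mathrm{vol}\;\le\;\frac{2a+1}{a^2}\,e^{-2a\rho}\int_{\Pi_{R_0}^{R_0+1}}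 e^{2ar}f^2\,d\mathrm{vol},$$ where the right-hand side may be $+\infty$. -/

import Mathlib

open Set Filter MeasureTheory Bundle
open scoped Manifold ContDiff Topology ENNReal

noncomputable section

namespace LiWang

variable {n : ℕ} {M : Type*} [MetricSpace M] [ChartedSpace (EuclideanSpace ℝ (Fin n)) M]
  [IsManifold (𝓡 n) ∞ M] [RiemannianBundle (fun x : M => TangentSpace (𝓡 n) x)]

/-! ### The metric, the volume, the gradient and the Laplacian -/

/-- The coordinate vector field `∂ᵢ` of the chart around `x₀`, at the point of `M` whose coordinates
in this chart are `z`. -/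
def coordVec (x₀ : M) (i : Fin n) (z : EuclideanSpace ℝ (Fin n)) :
    TangentSpace (𝓡 n) ((extChartAt (𝓡 n) x₀).symm z) :=
  mfderiv 𝓘(ℝ, EuclideanSpace ℝ (Fin n)) (𝓡 n) (extChartAt (𝓡 n) x₀).symm z
    (EuclideanSpace.single i (1 : ℝ))

/-- The matrix `gᵢⱼ = ⟨∂ᵢ, ∂ⱼ⟩` of the Riemannian metric in the chart around `x₀`. -/
def gram (x₀ : M) (z : EuclideanSpace ℝ (Fin n)) : Matrix (Fin n) (Fin n) ℝ :=
  Matrix.of fun i j => inner ℝ (coordVec x₀ i z) (coordVec x₀ j z)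

/-- The volume density `√(det gᵢⱼ)` in the chart around `x₀`. -/
def density (x₀ : M) (z : EuclideanSpace ℝ (Fin n)) : ℝ :=
  Real.sqrt (gram x₀ z).det

/-- The part of the Riemannian volume carried by the domain of the chart around `x₀`:
the image of `√(det gᵢⱼ) dz`, extended by zero to `M`. -/
def chartVolume [MeasurableSpace M] (x₀ : M) : Measure M :=
  Measure.map (extChartAt (𝓡 n) x₀).symm
    ((volume.restrict (extChartAt (𝓡 n) x₀).target).withDensity
      fun z => ENNReal.ofReal (density x₀ z))

variable (n M) in
/-- The Riemannian volume measure: the least measure on `M` that dominates `√(det gᵢⱼ) dz` in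
every preferred chart. (The chart measures agree on overlaps, and countably many charts cover `M`,
so this is the measure that restricts to `√(det gᵢⱼ) dz` on every chart domain.) -/
def riemannianVolume [MeasurableSpace M] : Measure M :=
  ⨆ x₀ : M, chartVolume (n := n) x₀

/-- The Riemannian gradient of `u` at `x`: the vector `∇u(x)` with `⟨∇u(x), v⟩ = du(v)`. -/
def grad (u : M → ℝ) (x : M) : TangentSpace (𝓡 n) x :=
  haveI : FiniteDimensional ℝ (TangentSpace (𝓡 n) x) :=
    inferInstanceAs (FiniteDimensional ℝ (EuclideanSpace ℝ (Fin n)))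
  haveI : CompleteSpace (TangentSpace (𝓡 n) x) := FiniteDimensional.complete ℝ _
  (InnerProductSpace.toDual ℝ (TangentSpace (𝓡 n) x)).symm (mfderiv (𝓡 n) 𝓘(ℝ, ℝ) u x)

/-- The partial derivative `∂ᵢ F (z)` of a function on `ℝⁿ`. -/
def partialDeriv (i : Fin n) (F : EuclideanSpace ℝ (Fin n) → ℝ)
    (z : EuclideanSpace ℝ (Fin n)) : ℝ :=
  fderiv ℝ F z (EuclideanSpace.single i (1 : ℝ))

/-- The Laplace–Beltrami operator
`Δf = (det g)^(-1/2) ∑ᵢⱼ ∂ᵢ ((det g)^(1/2) gⁱʲ ∂ⱼ f)` at `x`, computed in the chart around `x₀`. -/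
def laplacianInChart (x₀ : M) (f : M → ℝ) (x : M) : ℝ :=
  (density x₀ (extChartAt (𝓡 n) x₀ x))⁻¹ *
    ∑ i : Fin n, partialDeriv i
      (fun z => ∑ j : Fin n, density x₀ z * (gram x₀ z)⁻¹ i j *
        partialDeriv j (f ∘ (extChartAt (𝓡 n) x₀).symm) z)
      (extChartAt (𝓡 n) x₀ x)

variable (n) in
/-- The Laplace–Beltrami operator, computed at each point in the preferred chart around it. -/
def laplacian (f : M → ℝ) (x : M) : ℝ :=
  laplacianInChart (n := n) x f x

/-! ### The Dirichlet Laplacian of an open set and its spectrum -/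

variable (n) in
/-- `φ` is a smooth function on `M` with compact support contained in `U`. -/
structure IsTestFunction (U : Set M) (φ : M → ℝ) : Prop where
  smooth : ContMDiff (𝓡 n) 𝓘(ℝ, ℝ) ∞ φ
  compact : HasCompactSupport φ
  support : tsupport φ ⊆ U

variable (n) in
/-- The Dirichlet form `∫_U ⟨∇φ, ∇ψ⟩`. -/
def dirichletForm [MeasurableSpace M] (U : Set M) (φ ψ : M → ℝ) : ℝ :=
  ∫ x in U, inner ℝ (grad (n := n) φ x) (grad (n := n) ψ x) ∂(riemannianVolume n M)

variable (n) in
/-- The graph of the (nonnegative, self-adjoint) operator `-Δ` on `L²(U)` with Dirichlet boundary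
condition: `u` lies in its domain and is mapped to `w` if `u` lies in `H¹₀(U)`, the closure of the
test functions in the `H¹` norm, and `∫_U ⟨∇u, ∇ψ⟩ = ∫_U w ψ` for all test functions `ψ`. -/
def IsDirichletLaplacian [MeasurableSpace M] (U : Set M)
    (u w : Lp ℝ 2 ((riemannianVolume n M).restrict U)) : Prop :=
  ∃ φ : ℕ → M → ℝ,
    (∀ k, IsTestFunction n U (φ k)) ∧
    Tendsto (fun k => eLpNorm (fun x => φ k x - u x) 2 ((riemannianVolume n M).restrict U))
      atTop (𝓝 0) ∧
    Tendsto (fun k : ℕ × ℕ => dirichletForm n U (φ k.1 - φ k.2) (φ k.1 - φ k.2))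
      atTop (𝓝 0) ∧
    ∀ ψ : M → ℝ, IsTestFunction n U ψ →
      Tendsto (fun k => dirichletForm n U (φ k) ψ) atTop
        (𝓝 (∫ x in U, w x * ψ x ∂(riemannianVolume n M)))

variable (n) in
/-- The spectrum of the Dirichlet Laplacian `-Δ` of `U`: the numbers `t` for which `-Δ - t` is not
a bijection from the domain onto `L²(U)`. (The operator is self-adjoint, so that its spectrum
is real, and closed, so that the inverse of such a bijection is bounded.) -/
def dirichletSpectrum [MeasurableSpace M] (U : Set M) : Set ℝ :=
  {t | ¬ ∀ v : Lp ℝ 2 ((riemannianVolume n M).restrict U),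
    ∃! u : Lp ℝ 2 ((riemannianVolume n M).restrict U), IsDirichletLaplacian n U u (t • u + v)}

/-! ### Ends and annuli -/

/-- `P` is an end with respect to `K`: a non-compact connected component of the complement
of `K`. -/
def IsEnd {X : Type*} [TopologicalSpace X] (K P : Set X) : Prop :=
  (∃ x ∈ Kᶜ, P = connectedComponentIn Kᶜ x) ∧ ¬ IsCompact P

/-- The points `x` of `P` with `s ≤ d(x, p) ≤ t`. -/
def annulus {X : Type*} [MetricSpace X] (P : Set X) (p : X) (s t : ℝ) : Set X :=
  P ∩ {x | s ≤ dist x p ∧ dist x p ≤ t}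

end LiWang

end

noncomputable section

set_option linter.unusedSectionVars false

namespace LiWang

variable {n : ℕ} {M : Type*} [MetricSpace M] [ChartedSpace (EuclideanSpace ℝ (Fin n)) M]
  [IsManifold (𝓡 n) ∞ M] [RiemannianBundle (fun x : M => TangentSpace (𝓡 n) x)]

/-! The bottom of the spectrum gives `μ₁ ∫ u² ≤ ∫ |∇u|²` for `C¹` functions `u` with compact support
in the end. Take `u = φ f`. Pointwise `|∇(φ f)|² = ⟨∇f, ∇(φ² f)⟩ + |∇φ|² f²`, and the subsolution
inequality tested against `φ² f ≥ 0` bounds the integral of the first term by `μ ∫ φ² f²`. What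
remains is `a² ∫ φ² f² ≤ ∫ |∇φ|² f²` (`mul_integral_sq_le_of_subsolution`). For `φ = η ∘ r`, with
`r` 1-Lipschitz, this is a Poincaré inequality `a² ∫ η² dν ≤ ∫ η'² dν` on the line, where `ν` is the
image of `f² dvol` under `r` (`mul_setIntegral_annulus_le`).

The rest is one-dimensional (`sq_mul_measureReal_le`, `measure_le_of_tendsto_zero`). Choose `η = ψ
e^{a h} (1 - τ)`, where, up to smoothing, `h` has slope `1` before `ρ`, vanishes on `[ρ, ρ + 1]` and
has slope `-1` afterwards, `ψ` rises from `0` to `1` on `[R₀, R₀ + 1]` and `τ` does so on `[T, T +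
1]`. Away from the two ramps `η'² ≤ a² η²`, so both sides cancel there up to a favourable sign; on
`[ρ, ρ + 1]` one has `η = 1`, `η' = 0`, which leaves `a² ν [ρ, ρ + 1]`. The inner ramp costs `(1 +
2a) e^{2a(s - ρ)}` in the limit of ramps of slope one, which is the stated constant. The outer ramp
costs a multiple of `e^{-2as}`, and this disappears along `T = R_j`.

Three facts support this. The Rayleigh bound has to be extracted from a spectrum defined by failure
of bijectivity: if the best constant `t` in `t ∫ φ² ≤ ∫ |∇φ|²` were below `μ₁`, it would lie outside
the spectrum, and surjectivity together with the uniform boundedness principle would improve it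
(`exists_pos_coercive_of_surjective`). The distance is only Lipschitz, so it is replaced by smooth
functions with gradient at most `1 + ε` (`exists_contMDiff_approx_of_lipschitz`). Completeness makes
closed balls compact, hence also the annuli of the end strictly outside radius `R₀`
(`IsEnd.isCompact_annulus`). -/

theorem isOpen_target (x₀ : M) : IsOpen (extChartAt (𝓡 n) x₀).target := isOpen_extChartAt_target x₀

/-! ### Metric coefficients and gradients in a chart -/

/-- The coordinate field is the image of a constant field under the tangent map of the inverse
chart, so it is as smooth as that map. -/
theorem contMDiffOn_coordVec (x₀ : M) (i : Fin n) :
    ContMDiffOn 𝓘(ℝ, EuclideanSpace ℝ (Fin n)) (𝓡 n).tangent ∞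
      (fun z => (⟨(extChartAt (𝓡 n) x₀).symm z, coordVec x₀ i z⟩ : TangentBundle (𝓡 n) M))
      (extChartAt (𝓡 n) x₀).target := by
  have hT := isOpen_target (n := n) x₀
  have h1 : ContMDiffOn 𝓘(ℝ, EuclideanSpace ℝ (Fin n)) (𝓡 n) ∞ (extChartAt (𝓡 n) x₀).symm
    (extChartAt (𝓡 n) x₀).target := contMDiffOn_extChartAt_symm x₀
  have h2 := h1.contMDiffOn_tangentMapWithin (m := ∞) (by simp) hT.uniqueMDiffOn
  have h3 : ContMDiff 𝓘(ℝ, EuclideanSpace ℝ (Fin n)) (𝓘(ℝ, EuclideanSpace ℝ (Fin n))).tangent ∞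
      (fun z => (⟨z, EuclideanSpace.single i (1 : ℝ)⟩ :
        TangentBundle 𝓘(ℝ, EuclideanSpace ℝ (Fin n)) (EuclideanSpace ℝ (Fin n)))) := by
    apply contMDiff_vectorSpace_iff_contDiff.2
    exact contDiff_const
  refine (h2.comp h3.contMDiffOn (fun z hz => hz)).congr ?_
  intro z hz
  simp only [Function.comp, tangentMapWithin, coordVec]
  rw [mfderivWithin_of_isOpen hT hz]

theorem contDiffOn_gram [IsContMDiffRiemannianBundle (𝓡 n) ∞ (EuclideanSpace ℝ (Fin n))
      (fun x : M => TangentSpace (𝓡 n) x)] (x₀ : M) (i j : Fin n) :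
    ContDiffOn ℝ ∞ (fun z => gram x₀ z i j) (extChartAt (𝓡 n) x₀).target := by
  rw [← contMDiffOn_iff_contDiffOn]
  exact ContMDiffOn.inner_bundle (contMDiffOn_coordVec x₀ i) (contMDiffOn_coordVec x₀ j)

theorem isInvertible_mfderiv_symm (x₀ : M) {z : EuclideanSpace ℝ (Fin n)}
    (hz : z ∈ (extChartAt (𝓡 n) x₀).target) :
    (mfderiv 𝓘(ℝ, EuclideanSpace ℝ (Fin n)) (𝓡 n) (extChartAt (𝓡 n) x₀).symm z).IsInvertible := by
  have := isInvertible_mfderivWithin_extChartAt_symm (I := 𝓡 n) hz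
  simpa [mfderivWithin_univ] using this

theorem linearIndependent_coordVec (x₀ : M) {z : EuclideanSpace ℝ (Fin n)}
    (hz : z ∈ (extChartAt (𝓡 n) x₀).target) :
    LinearIndependent ℝ (fun i : Fin n => coordVec x₀ i z) := by
  have h := (isInvertible_mfderiv_symm x₀ hz).injective
  have h2 := (EuclideanSpace.basisFun (Fin n) ℝ).toBasis.linearIndependent
  have h3 := h2.map' (mfderiv 𝓘(ℝ, EuclideanSpace ℝ (Fin n)) (𝓡 n)
    (extChartAt (𝓡 n) x₀).symm z).toLinearMap (LinearMap.ker_eq_bot.2 h)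
  convert! h3 using 1
  ext i : 1
  simp [coordVec]
  rfl

theorem posDef_gram (x₀ : M) {z : EuclideanSpace ℝ (Fin n)}
    (hz : z ∈ (extChartAt (𝓡 n) x₀).target) : (gram x₀ z).PosDef :=
  Matrix.posDef_gram_of_linearIndependent (𝕜 := ℝ) (linearIndependent_coordVec x₀ hz)

open scoped Matrix in
-- If `x` and `y` are the coefficient rows of `X` and `Y`, the products `⟨X, vᵢ⟩` form the row `x
-- G`, so the right-hand side is `x G G⁻¹ G yᵀ = x G yᵀ`. This turns `⟨∇u, ∇w⟩` into `gⁱʲ ∂ᵢu ∂ⱼw`.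
theorem inner_eq_sum_gram_inv {V : Type*} [NormedAddCommGroup V] [InnerProductSpace ℝ V]
    [FiniteDimensional ℝ V]
    {v : Fin n → V} (hv : LinearIndependent ℝ v) (hn : Module.finrank ℝ V = n) (X Y : V) :
    inner ℝ X Y = ∑ i, ∑ j, (Matrix.gram ℝ v)⁻¹ i j * inner ℝ X (v i) * inner ℝ Y (v j) := by
  have hspan : Submodule.span ℝ (Set.range v) = ⊤ :=
    hv.span_eq_top_of_card_eq_finrank' (by simp [hn])
  have hex : ∀ Z : V, ∃ c : Fin n → ℝ, ∑ i, c i • v i = Z := fun Z =>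
    (Submodule.mem_span_range_iff_exists_fun ℝ).1 (hspan ▸ Submodule.mem_top)
  obtain ⟨x, rfl⟩ := hex X
  obtain ⟨y, rfl⟩ := hex Y
  set G := Matrix.gram ℝ v with hG
  have hdet : IsUnit G.det := (isUnit_iff_ne_zero).2 (Matrix.posDef_gram_of_linearIndependent
    (𝕜 := ℝ) hv).det_pos.ne'
  have hcoef : ∀ c : Fin n → ℝ, ∀ i, inner ℝ (∑ k, c k • v k) (v i) = (c ᵥ* G) i := by
    intro c i
    simp [sum_inner, Matrix.vecMul, dotProduct, real_inner_smul_left, hG, Matrix.gram_apply]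
  have hsymm : Gᵀ = G := by
    ext i j
    simp [hG, Matrix.gram_apply, real_inner_comm]
  have h1 : ∑ i, ∑ j, G⁻¹ i j * inner ℝ (∑ k, x k • v k) (v i) * inner ℝ (∑ k, y k • v k) (v j)
      = (x ᵥ* G) ⬝ᵥ (G⁻¹ *ᵥ (y ᵥ* G)) := by
    simp only [hcoef, dotProduct, Matrix.mulVec, Finset.mul_sum]
    exact Finset.sum_congr rfl fun i _ => Finset.sum_congr rfl fun j _ => by ring
  rw [h1, ← Matrix.mulVec_transpose G y, hsymm, Matrix.mulVec_mulVec, Matrix.nonsing_inv_mul _ hdet,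
    Matrix.one_mulVec, inner_sum]
  simp only [real_inner_smul_right, hcoef, dotProduct, mul_comm]

theorem inner_grad (u : M → ℝ) (x : M) (v : TangentSpace (𝓡 n) x) :
    inner ℝ (grad (n := n) u x) v = mfderiv (𝓡 n) 𝓘(ℝ, ℝ) u x v := by
  have : FiniteDimensional ℝ (TangentSpace (𝓡 n) x) :=
    inferInstanceAs (FiniteDimensional ℝ (EuclideanSpace ℝ (Fin n)))
  have : CompleteSpace (TangentSpace (𝓡 n) x) := FiniteDimensional.complete ℝ _
  exact InnerProductSpace.toDual_symm_apply

theorem mfderiv_coordVec (x₀ : M) {z : EuclideanSpace ℝ (Fin n)}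
    (hz : z ∈ (extChartAt (𝓡 n) x₀).target) {u : M → ℝ}
    (hu : MDifferentiableAt (𝓡 n) 𝓘(ℝ, ℝ) u ((extChartAt (𝓡 n) x₀).symm z)) (i : Fin n) :
    mfderiv (𝓡 n) 𝓘(ℝ, ℝ) u ((extChartAt (𝓡 n) x₀).symm z) (coordVec x₀ i z) =
      partialDeriv i (u ∘ (extChartAt (𝓡 n) x₀).symm) z := by
  have h1 : MDifferentiableAt 𝓘(ℝ, EuclideanSpace ℝ (Fin n)) (𝓡 n) (extChartAt (𝓡 n) x₀).symm z := by
    have := mdifferentiableWithinAt_extChartAt_symm (I := 𝓡 n) hz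
    simpa [mdifferentiableWithinAt_univ] using this
  have h2 := mfderiv_comp z hu h1
  rw [partialDeriv, ← mfderiv_eq_fderiv, h2]
  rfl

theorem inner_grad_grad_eq (x₀ : M) {z : EuclideanSpace ℝ (Fin n)}
    (hz : z ∈ (extChartAt (𝓡 n) x₀).target) {u w : M → ℝ}
    (hu : MDifferentiableAt (𝓡 n) 𝓘(ℝ, ℝ) u ((extChartAt (𝓡 n) x₀).symm z))
    (hw : MDifferentiableAt (𝓡 n) 𝓘(ℝ, ℝ) w ((extChartAt (𝓡 n) x₀).symm z)) :
    inner ℝ (grad (n := n) u ((extChartAt (𝓡 n) x₀).symm z))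
        (grad (n := n) w ((extChartAt (𝓡 n) x₀).symm z)) =
      ∑ i, ∑ j, (gram x₀ z)⁻¹ i j * partialDeriv i (u ∘ (extChartAt (𝓡 n) x₀).symm) z *
        partialDeriv j (w ∘ (extChartAt (𝓡 n) x₀).symm) z := by
  have hfin : Module.finrank ℝ (TangentSpace (𝓡 n) ((extChartAt (𝓡 n) x₀).symm z)) = n :=
    finrank_euclideanSpace_fin
  have : FiniteDimensional ℝ (TangentSpace (𝓡 n) ((extChartAt (𝓡 n) x₀).symm z)) :=
    inferInstanceAs (FiniteDimensional ℝ (EuclideanSpace ℝ (Fin n)))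
  refine (inner_eq_sum_gram_inv (v := fun i => coordVec x₀ i z) (linearIndependent_coordVec x₀ hz)
    hfin _ _).trans (Finset.sum_congr rfl fun i _ => Finset.sum_congr rfl fun j _ => ?_)
  rw [inner_grad, inner_grad]
  exact congrArg₂ (fun a b => (gram x₀ z)⁻¹ i j * a * b) (mfderiv_coordVec x₀ hz hu i)
    (mfderiv_coordVec x₀ hz hw j)

theorem density_pos (x₀ : M) {z : EuclideanSpace ℝ (Fin n)}
    (hz : z ∈ (extChartAt (𝓡 n) x₀).target) : 0 < density x₀ z :=
  Real.sqrt_pos.2 (posDef_gram x₀ hz).det_pos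

section Smooth

variable [IsContMDiffRiemannianBundle (𝓡 n) ∞ (EuclideanSpace ℝ (Fin n))
      (fun x : M => TangentSpace (𝓡 n) x)]

theorem contDiffOn_det_gram (x₀ : M) :
    ContDiffOn ℝ ∞ (fun z => (gram x₀ z).det) (extChartAt (𝓡 n) x₀).target := by
  simp only [Matrix.det_apply]
  exact ContDiffOn.sum fun σ _ => (contDiffOn_prod fun i _ => contDiffOn_gram x₀ _ _).const_smul _

theorem contDiffOn_density (x₀ : M) :
    ContDiffOn ℝ ∞ (density x₀) (extChartAt (𝓡 n) x₀).target :=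
  (contDiffOn_det_gram x₀).sqrt fun _ hz => (posDef_gram x₀ hz).det_pos.ne'

theorem contDiffOn_gram_inv (x₀ : M) (i j : Fin n) :
    ContDiffOn ℝ ∞ (fun z => (gram x₀ z)⁻¹ i j) (extChartAt (𝓡 n) x₀).target := by
  have h : ContDiffOn ℝ ∞ (fun z => ((gram x₀ z).det)⁻¹ * (gram x₀ z).adjugate i j)
      (extChartAt (𝓡 n) x₀).target := by
    refine ((contDiffOn_det_gram x₀).inv fun z hz => (posDef_gram x₀ hz).det_pos.ne').mul ?_
    simp only [Matrix.adjugate_apply, Matrix.det_apply]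
    refine ContDiffOn.sum fun σ _ => (contDiffOn_prod fun k _ => ?_).const_smul _
    simp only [Matrix.updateRow_apply]
    split_ifs
    · exact contDiffOn_const
    · exact contDiffOn_gram x₀ _ _
  refine h.congr fun z hz => ?_
  rw [Matrix.inv_def, Matrix.smul_apply, Ring.inverse_eq_inv', smul_eq_mul]

theorem continuousOn_inner_grad {U : Set M} (hU : IsOpen U) {u w : M → ℝ}
    (hu : ContMDiffOn (𝓡 n) 𝓘(ℝ, ℝ) 1 u U) (hw : ContMDiffOn (𝓡 n) 𝓘(ℝ, ℝ) 1 w U) :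
    ContinuousOn (fun x => inner ℝ (grad (n := n) u x) (grad (n := n) w x)) U := by
  intro x₀ hx₀
  refine ContinuousAt.continuousWithinAt ?_
  set e := extChartAt (𝓡 n) x₀ with he
  set V := e.target ∩ e.symm ⁻¹' U with hV
  have hVo : IsOpen V := (continuousOn_extChartAt_symm x₀).isOpen_inter_preimage
    (isOpen_target x₀) hU
  have hpd : ∀ {u : M → ℝ}, ContMDiffOn (𝓡 n) 𝓘(ℝ, ℝ) 1 u U → ∀ i,
      ContinuousOn (partialDeriv i (u ∘ e.symm)) V := by
    intro u hu i
    have h1 : ContDiffOn ℝ 1 (u ∘ e.symm) V := by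
      rw [← contMDiffOn_iff_contDiffOn]
      exact hu.comp ((contMDiffOn_extChartAt_symm x₀).mono inter_subset_left) fun z hz => hz.2
    exact (h1.continuousOn_fderiv_of_isOpen hVo le_rfl).clm_apply continuousOn_const
  have hF : ContinuousOn (fun z => ∑ i, ∑ j, (gram x₀ z)⁻¹ i j * partialDeriv i (u ∘ e.symm) z *
        partialDeriv j (w ∘ e.symm) z) V :=
    continuousOn_finsetSum _ fun i _ => continuousOn_finsetSum _ fun j _ =>
      (((contDiffOn_gram_inv x₀ i j).continuousOn.mono inter_subset_left).mul (hpd hu i)).mul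
        (hpd hw j)
  have hxV : e x₀ ∈ V := ⟨mem_extChartAt_target x₀, by simpa [he] using hx₀⟩
  have hc : ContinuousAt ((fun z => ∑ i, ∑ j, (gram x₀ z)⁻¹ i j * partialDeriv i (u ∘ e.symm) z *
        partialDeriv j (w ∘ e.symm) z) ∘ e) x₀ :=
    (hF.continuousAt (hVo.mem_nhds hxV)).comp (continuousAt_extChartAt x₀)
  refine hc.congr ?_
  filter_upwards [extChartAt_source_mem_nhds (I := 𝓡 n) x₀, hU.mem_nhds hx₀] with y hy hyU
  have h1 : e.symm (e y) = y := e.left_inv hy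
  have hyV : e y ∈ V := ⟨e.map_source hy, by rw [mem_preimage, h1]; exact hyU⟩
  have hm : ∀ {u : M → ℝ}, ContMDiffOn (𝓡 n) 𝓘(ℝ, ℝ) 1 u U →
      MDifferentiableAt (𝓡 n) 𝓘(ℝ, ℝ) u (e.symm (e y)) := fun hu =>
    ((hu _ hyV.2).contMDiffAt (hU.mem_nhds hyV.2)).mdifferentiableAt one_ne_zero
  have := inner_grad_grad_eq x₀ hyV.1 (hm hu) (hm hw)
  simp only [Function.comp]
  rw [← he, h1] at this
  exact this.symm

end Smooth

/-- Tangent spaces at different points are the same vector space by definition but carry different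
inner products, so equality of the vectors is stated in the model space and the inner product is
transported along `x = y`. -/
theorem inner_tangent_congr {x y : M} (h : x = y) {v w : TangentSpace (𝓡 n) x}
    {v' w' : TangentSpace (𝓡 n) y} (hv : @Eq (EuclideanSpace ℝ (Fin n)) v v')
    (hw : @Eq (EuclideanSpace ℝ (Fin n)) w w') : (inner ℝ v w : ℝ) = inner ℝ v' w' := by
  subst h
  obtain rfl : v = v' := hv
  obtain rfl : w = w' := hw
  rfl

/-! ### Change of coordinates -/

variable (n) in
/-- The change of coordinates from the chart around `x₁` to the chart around `x₀`. -/
def transition (x₀ x₁ : M) : EuclideanSpace ℝ (Fin n) → EuclideanSpace ℝ (Fin n) :=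
  extChartAt (𝓡 n) x₀ ∘ (extChartAt (𝓡 n) x₁).symm

variable (n) in
/-- The part of the target of the chart around `x₁` where the chart around `x₀` is defined. -/
def overlap (x₀ x₁ : M) : Set (EuclideanSpace ℝ (Fin n)) :=
  (extChartAt (𝓡 n) x₁).target ∩ (extChartAt (𝓡 n) x₁).symm ⁻¹' (extChartAt (𝓡 n) x₀).source

theorem isOpen_overlap (x₀ x₁ : M) : IsOpen (overlap n x₀ x₁) :=
  (continuousOn_extChartAt_symm x₁).isOpen_inter_preimage (isOpen_target x₁)
    (isOpen_extChartAt_source x₀)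

theorem contDiffOn_transition (x₀ x₁ : M) :
    ContDiffOn ℝ ∞ (transition n x₀ x₁) (overlap n x₀ x₁) := by
  rw [← contMDiffOn_iff_contDiffOn]
  exact (contMDiffOn_extChartAt (x := x₀)).comp
    ((contMDiffOn_extChartAt_symm x₁).mono inter_subset_left)
    fun z hz => by simpa using hz.2

theorem hasFDerivAt_transition (x₀ x₁ : M) {z : EuclideanSpace ℝ (Fin n)}
    (hz : z ∈ overlap n x₀ x₁) :
    HasFDerivAt (transition n x₀ x₁) (fderiv ℝ (transition n x₀ x₁) z) z :=
  (((contDiffOn_transition x₀ x₁).contDiffAt ((isOpen_overlap x₀ x₁).mem_nhds hz)).differentiableAt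
    (by simp)).hasFDerivAt

theorem symm_transition (x₀ x₁ : M) {z : EuclideanSpace ℝ (Fin n)} (hz : z ∈ overlap n x₀ x₁) :
    (extChartAt (𝓡 n) x₀).symm (transition n x₀ x₁ z) = (extChartAt (𝓡 n) x₁).symm z :=
  (extChartAt (𝓡 n) x₀).left_inv hz.2

theorem transition_mem_target (x₀ x₁ : M) {z : EuclideanSpace ℝ (Fin n)}
    (hz : z ∈ overlap n x₀ x₁) : transition n x₀ x₁ z ∈ (extChartAt (𝓡 n) x₀).target :=
  (extChartAt (𝓡 n) x₀).map_source hz.2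

/-- Chain rule: near `z` the inverse chart at `x₁` is the inverse chart at `x₀` composed with the
transition map. -/
theorem coordVec_eq_sum (x₀ x₁ : M) {z : EuclideanSpace ℝ (Fin n)} (hz : z ∈ overlap n x₀ x₁)
    (i : Fin n) :
    @Eq (EuclideanSpace ℝ (Fin n)) (coordVec x₁ i z)
      (∑ k, fderiv ℝ (transition n x₀ x₁) z (EuclideanSpace.single i 1) k •
        coordVec x₀ k (transition n x₀ x₁ z)) := by
  set τ := transition n x₀ x₁ with hτ
  have h0 : HasMFDerivAt 𝓘(ℝ, EuclideanSpace ℝ (Fin n)) (𝓡 n) (extChartAt (𝓡 n) x₀).symm (τ z)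
      (mfderiv 𝓘(ℝ, EuclideanSpace ℝ (Fin n)) (𝓡 n) (extChartAt (𝓡 n) x₀).symm (τ z)) := by
    have := mdifferentiableWithinAt_extChartAt_symm (I := 𝓡 n) (transition_mem_target x₀ x₁ hz)
    exact MDifferentiableAt.hasMFDerivAt (by simpa [mdifferentiableWithinAt_univ] using this)
  have h1 := h0.comp z (hasFDerivAt_transition x₀ x₁ hz).hasMFDerivAt
  have h2 : (extChartAt (𝓡 n) x₁).symm =ᶠ[𝓝 z] (extChartAt (𝓡 n) x₀).symm ∘ τ := by
    filter_upwards [(isOpen_overlap x₀ x₁).mem_nhds hz] with y hy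
    exact (symm_transition x₀ x₁ hy).symm
  have h3 := (h1.congr_of_eventuallyEq h2).mfderiv
  have h4 : coordVec x₁ i z = mfderiv 𝓘(ℝ, EuclideanSpace ℝ (Fin n)) (𝓡 n)
      (extChartAt (𝓡 n) x₀).symm (τ z) (fderiv ℝ τ z (EuclideanSpace.single i 1)) := by
    rw [coordVec, h3]
    rfl
  have h5 : fderiv ℝ τ z (EuclideanSpace.single i 1) =
      ∑ k, fderiv ℝ τ z (EuclideanSpace.single i 1) k • EuclideanSpace.single k (1 : ℝ) := by
    conv_lhs => rw [← (EuclideanSpace.basisFun (Fin n) ℝ).sum_repr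
      (fderiv ℝ τ z (EuclideanSpace.single i 1))]
    simp
  exact (h4.trans (congrArg _ h5)).trans
    ((map_sum _ _ _).trans (Finset.sum_congr rfl fun k _ => map_smul _ _ _))

/-- The Gram matrix transforms as `Jᵀ G J` with `J` the Jacobian matrix, so its determinant picks up
`(det J)²`. -/
theorem density_eq_transition (x₀ x₁ : M) {z : EuclideanSpace ℝ (Fin n)}
    (hz : z ∈ overlap n x₀ x₁) :
    density x₁ z = |(fderiv ℝ (transition n x₀ x₁) z).det| *
      density x₀ (transition n x₀ x₁ z) := by
  set J := LinearMap.toMatrix (EuclideanSpace.basisFun (Fin n) ℝ).toBasis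
    (EuclideanSpace.basisFun (Fin n) ℝ).toBasis (fderiv ℝ (transition n x₀ x₁) z).toLinearMap
    with hJ
  have hJapp : ∀ k i, J k i = fderiv ℝ (transition n x₀ x₁) z (EuclideanSpace.single i 1) k := by
    intro k i
    simp [hJ, LinearMap.toMatrix_apply]
  have hG : gram x₁ z = J.transpose * gram x₀ (transition n x₀ x₁ z) * J := by
    ext i j
    have h1 : gram x₁ z i j = inner ℝ
        (∑ k, J k i • coordVec x₀ k (transition n x₀ x₁ z))
        (∑ k, J k j • coordVec x₀ k (transition n x₀ x₁ z)) := by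
      simp only [hJapp]
      exact inner_tangent_congr (symm_transition x₀ x₁ hz).symm (coordVec_eq_sum x₀ x₁ hz i)
        (coordVec_eq_sum x₀ x₁ hz j)
    rw [h1, sum_inner]
    simp only [inner_sum, real_inner_smul_left, real_inner_smul_right, Matrix.mul_apply,
      Matrix.transpose_apply, Finset.sum_mul]
    rw [Finset.sum_comm]
    refine Finset.sum_congr rfl fun k _ => Finset.sum_congr rfl fun l _ => ?_
    simp only [gram, Matrix.of_apply]
    ring
  have hdet : J.det = (fderiv ℝ (transition n x₀ x₁) z).det := by
    rw [hJ, LinearMap.det_toMatrix]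
  rw [density, density, hG, Matrix.det_mul, Matrix.det_mul, Matrix.det_transpose, hdet,
    mul_right_comm, Real.sqrt_mul (mul_self_nonneg _), Real.sqrt_mul_self_eq_abs]

/-! ### The Riemannian volume measure -/

section Volume

variable [IsContMDiffRiemannianBundle (𝓡 n) ∞ (EuclideanSpace ℝ (Fin n))
      (fun x : M => TangentSpace (𝓡 n) x)] [MeasurableSpace M] [BorelSpace M]

theorem aemeasurable_density (x₀ : M) : AEMeasurable (fun z => ENNReal.ofReal (density x₀ z))
    (volume.restrict (extChartAt (𝓡 n) x₀).target) :=
  ((contDiffOn_density x₀).continuousOn.aemeasurable (isOpen_target x₀).measurableSet).ennreal_ofReal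

theorem aemeasurable_extChartAt_symm (x₀ : M) : AEMeasurable (extChartAt (𝓡 n) x₀).symm
    (volume.restrict (extChartAt (𝓡 n) x₀).target) :=
  (continuousOn_extChartAt_symm x₀).aemeasurable (isOpen_target x₀).measurableSet

theorem lintegral_chartVolume (x₀ : M) {g : M → ℝ≥0∞} (hg : Measurable g) :
    ∫⁻ x, g x ∂(chartVolume (n := n) x₀) =
      ∫⁻ z in (extChartAt (𝓡 n) x₀).target,
        ENNReal.ofReal (density x₀ z) * g ((extChartAt (𝓡 n) x₀).symm z) := by
  have h1 := aemeasurable_extChartAt_symm (n := n) x₀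
  rw [chartVolume, lintegral_map' hg.aemeasurable
    (h1.mono_ac (withDensity_absolutelyContinuous _ _))]
  exact lintegral_withDensity_eq_lintegral_mul₀ (aemeasurable_density x₀) (hg.comp_aemeasurable h1)

theorem chartVolume_apply (x₀ : M) {A : Set M} (hA : MeasurableSet A) :
    chartVolume (n := n) x₀ A = ∫⁻ z in (extChartAt (𝓡 n) x₀).target,
      ((extChartAt (𝓡 n) x₀).symm ⁻¹' A).indicator (fun z => ENNReal.ofReal (density x₀ z)) z := by
  rw [← lintegral_indicator_one hA, lintegral_chartVolume x₀ (measurable_one.indicator hA)]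
  refine lintegral_congr fun z => ?_
  by_cases hz : (extChartAt (𝓡 n) x₀).symm z ∈ A
  · simp [hz, -extChartAt]
  · simp [hz, -extChartAt]

theorem measurableSet_target_inter_preimage (x₀ : M) {A : Set M} (hA : MeasurableSet A) :
    MeasurableSet ((extChartAt (𝓡 n) x₀).target ∩ (extChartAt (𝓡 n) x₀).symm ⁻¹' A) := by
  have hT := (isOpen_target (n := n) x₀).measurableSet
  have h := (continuousOn_extChartAt_symm (I := 𝓡 n) x₀).domRestrict.measurable hA
  have := (MeasurableEmbedding.subtype_coe hT).measurableSet_image' h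
  convert! this using 1
  ext z
  simp [-extChartAt, and_comm]

theorem chartVolume_apply' (x₀ : M) {A : Set M} (hA : MeasurableSet A) :
    chartVolume (n := n) x₀ A =
      ∫⁻ z in (extChartAt (𝓡 n) x₀).target ∩ (extChartAt (𝓡 n) x₀).symm ⁻¹' A,
        ENNReal.ofReal (density x₀ z) := by
  have hT := (isOpen_target (n := n) x₀).measurableSet
  rw [chartVolume_apply x₀ hA, ← lintegral_indicator hT, ← lintegral_indicator
    (measurableSet_target_inter_preimage x₀ hA)]
  refine lintegral_congr fun z => ?_
  exact congrFun (Set.indicator_indicator _ _ _) z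

theorem chartVolume_compl_source (x₀ : M) :
    chartVolume (n := n) x₀ (extChartAt (𝓡 n) x₀).sourceᶜ = 0 := by
  rw [chartVolume_apply' x₀ (isOpen_extChartAt_source x₀).measurableSet.compl]
  have : (extChartAt (𝓡 n) x₀).target ∩ (extChartAt (𝓡 n) x₀).symm ⁻¹'
      (extChartAt (𝓡 n) x₀).sourceᶜ = ∅ := by
    ext z
    simp only [mem_inter_iff, mem_preimage, mem_compl_iff, mem_empty_iff_false, iff_false, not_and,
      not_not]
    exact fun hz => (extChartAt (𝓡 n) x₀).map_target hz
  rw [this]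
  simp

/-- In the change of variables formula the factor `|det Dτ|` is exactly the ratio of the two
densities. -/
theorem chartVolume_eq_of_subset (x₀ x₁ : M) {A : Set M} (hA : MeasurableSet A)
    (h0 : A ⊆ (extChartAt (𝓡 n) x₀).source) (h1 : A ⊆ (extChartAt (𝓡 n) x₁).source) :
    chartVolume (n := n) x₁ A = chartVolume (n := n) x₀ A := by
  rw [chartVolume_apply' x₀ hA, chartVolume_apply' x₁ hA]
  set e₀ := extChartAt (𝓡 n) x₀ with he₀
  set e₁ := extChartAt (𝓡 n) x₁ with he₁
  have hB := measurableSet_target_inter_preimage (n := n) x₁ hA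
  have hsub : e₁.target ∩ e₁.symm ⁻¹' A ⊆ overlap n x₀ x₁ := fun z hz => ⟨hz.1, h0 hz.2⟩
  have himg : e₀.target ∩ e₀.symm ⁻¹' A = transition n x₀ x₁ '' (e₁.target ∩ e₁.symm ⁻¹' A) := by
    ext z
    constructor
    · rintro ⟨hz, hzA⟩
      refine ⟨e₁ (e₀.symm z), ⟨e₁.map_source (h1 hzA), ?_⟩, ?_⟩
      · rw [mem_preimage, e₁.left_inv (h1 hzA)]
        exact hzA
      · simp only [transition, Function.comp]
        rw [← he₀, ← he₁, e₁.left_inv (h1 hzA), e₀.right_inv hz]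
    · rintro ⟨w, hw, rfl⟩
      refine ⟨transition_mem_target x₀ x₁ (hsub hw), ?_⟩
      rw [mem_preimage, symm_transition x₀ x₁ (hsub hw)]
      exact hw.2
  have hinj : InjOn (transition n x₀ x₁) (e₁.target ∩ e₁.symm ⁻¹' A) := by
    intro z hz w hw h
    have h2 : e₁.symm z = e₁.symm w := by
      rw [← symm_transition x₀ x₁ (hsub hz), ← symm_transition x₀ x₁ (hsub hw), h]
    exact e₁.symm.injOn hz.1 hw.1 h2
  rw [himg, lintegral_image_eq_lintegral_abs_det_fderiv_mul _ hB
    (fun z hz => (hasFDerivAt_transition x₀ x₁ (hsub hz)).hasFDerivWithinAt) hinj]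
  refine setLIntegral_congr_fun hB fun z hz => ?_
  rw [density_eq_transition x₀ x₁ (hsub hz), ENNReal.ofReal_mul (abs_nonneg _)]

/-- This makes the supremum computable: integrals over a chart domain become integrals in
coordinates. -/
theorem riemannianVolume_restrict_source (x₀ : M) :
    (riemannianVolume n M).restrict (extChartAt (𝓡 n) x₀).source = chartVolume (n := n) x₀ := by
  have hS := (isOpen_extChartAt_source (I := 𝓡 n) x₀).measurableSet
  refine le_antisymm ?_ ?_
  -- Inside the chart domain every other chart measure agrees with this one on the overlap and
  -- vanishes off its own domain. Outside, the crude bound `⊤` is enough, because it is removed by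
  -- the restriction.
  · have hle : riemannianVolume n M ≤ chartVolume (n := n) x₀ +
        (⊤ : Measure M).restrict (extChartAt (𝓡 n) x₀).sourceᶜ := by
      refine iSup_le fun x₁ => Measure.le_iff.2 fun A hA => ?_
      rw [← measure_inter_add_sdiff A hS]
      refine add_le_add ?_ ?_
      · have h := measure_inter_add_sdiff (μ := chartVolume (n := n) x₁)
          (A ∩ (extChartAt (𝓡 n) x₀).source) (isOpen_extChartAt_source (I := 𝓡 n) x₁).measurableSet
        have h2 : chartVolume (n := n) x₁ ((A ∩ (extChartAt (𝓡 n) x₀).source) \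
            (extChartAt (𝓡 n) x₁).source) = 0 :=
          measure_mono_null (fun x hx => hx.2) (chartVolume_compl_source x₁)
        rw [← h, h2, add_zero, chartVolume_eq_of_subset x₀ x₁
          ((hA.inter hS).inter (isOpen_extChartAt_source x₁).measurableSet)
          (fun x hx => hx.1.2) (fun x hx => hx.2)]
        exact measure_mono fun x hx => hx.1.1
      · exact (Measure.le_iff'.1 (le_top : chartVolume (n := n) x₁ ≤ ⊤) _).trans
          (Measure.restrict_apply hA).ge
    refine (Measure.restrict_mono_measure hle _).trans ?_
    rw [Measure.restrict_add, Measure.restrict_restrict hS, inter_compl_self,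
      Measure.restrict_empty, add_zero]
    exact Measure.restrict_le_self
  · have h1 : chartVolume (n := n) x₀ = (chartVolume (n := n) x₀).restrict
        (extChartAt (𝓡 n) x₀).source := by
      refine (Measure.restrict_eq_self_of_ae_mem ?_).symm
      exact chartVolume_compl_source x₀
    rw [h1]
    exact Measure.restrict_mono_measure (le_iSup (fun x₀ : M => chartVolume (n := n) x₀) x₀) _

theorem integral_source (x₀ : M) {g : M → ℝ} (hg : Measurable g) :
    ∫ x in (extChartAt (𝓡 n) x₀).source, g x ∂(riemannianVolume n M) =
      ∫ z in (extChartAt (𝓡 n) x₀).target, density x₀ z * g ((extChartAt (𝓡 n) x₀).symm z) := by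
  have h1 := aemeasurable_extChartAt_symm (n := n) x₀
  rw [riemannianVolume_restrict_source, chartVolume, integral_map
    (h1.mono_ac (withDensity_absolutelyContinuous _ _)) hg.aestronglyMeasurable,
    integral_withDensity_eq_integral_toReal_smul₀ (aemeasurable_density x₀) (by simp)]
  refine setIntegral_congr_fun (isOpen_target x₀).measurableSet fun z hz => ?_
  simp only [smul_eq_mul]
  rw [ENNReal.toReal_ofReal (density_pos x₀ hz).le]

/-- The density is bounded on a small closed coordinate ball. Integrability of continuous functions
with compact support rests on this. -/
instance isLocallyFiniteMeasure_riemannianVolume :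
    IsLocallyFiniteMeasure (riemannianVolume n M) := by
  refine ⟨fun x₀ => ?_⟩
  set e := extChartAt (𝓡 n) x₀ with he
  have hT := isOpen_target (n := n) x₀
  obtain ⟨r, hr, hball⟩ := Metric.nhds_basis_closedBall.mem_iff.1
    (hT.mem_nhds (mem_extChartAt_target (I := 𝓡 n) x₀))
  have hK := isCompact_closedBall (extChartAt (𝓡 n) x₀ x₀) r
  obtain ⟨C, hC⟩ := hK.exists_bound_of_continuousOn
    ((contDiffOn_density (n := n) x₀).continuousOn.mono hball)
  refine ⟨e.source ∩ e ⁻¹' Metric.ball (e x₀) r, ?_, ?_⟩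
  · exact ((continuousOn_extChartAt x₀).isOpen_inter_preimage (isOpen_extChartAt_source x₀)
      Metric.isOpen_ball).mem_nhds ⟨mem_extChartAt_source x₀, Metric.mem_ball_self hr⟩
  · have hA : MeasurableSet (e.source ∩ e ⁻¹' Metric.ball (e x₀) r) :=
      ((continuousOn_extChartAt x₀).isOpen_inter_preimage (isOpen_extChartAt_source x₀)
        Metric.isOpen_ball).measurableSet
    have h1 : riemannianVolume n M (e.source ∩ e ⁻¹' Metric.ball (e x₀) r) =
        chartVolume (n := n) x₀ (e.source ∩ e ⁻¹' Metric.ball (e x₀) r) := by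
      rw [← riemannianVolume_restrict_source, Measure.restrict_apply hA, ← he,
        inter_eq_left.2 inter_subset_left]
    rw [h1, chartVolume_apply' x₀ hA]
    have hsub : e.target ∩ e.symm ⁻¹' (e.source ∩ e ⁻¹' Metric.ball (e x₀) r) ⊆
        Metric.closedBall (e x₀) r := by
      rintro z ⟨hz, -, hz2⟩
      rw [mem_preimage, e.right_inv hz] at hz2
      exact Metric.ball_subset_closedBall hz2
    calc _ ≤ ∫⁻ z in Metric.closedBall (e x₀) r, ENNReal.ofReal (density x₀ z) :=
          lintegral_mono_set hsub
      _ ≤ ∫⁻ z in Metric.closedBall (e x₀) r, ENNReal.ofReal C :=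
          setLIntegral_mono' hK.measurableSet fun z hz =>
            ENNReal.ofReal_le_ofReal ((le_abs_self _).trans (hC z hz))
      _ < ⊤ := by
          rw [setLIntegral_const]
          exact ENNReal.mul_lt_top ENNReal.ofReal_lt_top hK.measure_lt_top

/-- The density is strictly positive. This upgrades almost-everywhere equality of continuous
functions to equality everywhere. -/
instance isOpenPosMeasure_riemannianVolume :
    (riemannianVolume n M).IsOpenPosMeasure := by
  refine ⟨fun U hU hne h0 => ?_⟩
  obtain ⟨x₀, hx₀⟩ := hne
  have h1 : chartVolume (n := n) x₀ U = 0 := by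
    rw [← riemannianVolume_restrict_source]
    exact Measure.restrict_le_self.absolutelyContinuous h0
  rw [chartVolume_apply' x₀ hU.measurableSet] at h1
  have hV := (continuousOn_extChartAt_symm (I := 𝓡 n) x₀).isOpen_inter_preimage
    (isOpen_target x₀) hU
  have h2 := (lintegral_eq_zero_iff' ((aemeasurable_density x₀).mono_set inter_subset_left)).1 h1
  rw [Filter.EventuallyEq, ae_restrict_iff' hV.measurableSet] at h2
  have h3 : volume ((extChartAt (𝓡 n) x₀).target ∩ (extChartAt (𝓡 n) x₀).symm ⁻¹' U) = 0 := by
    refine measure_mono_null (fun z hz => ?_) h2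
    simp only [mem_compl_iff, mem_ofPred_eq, Classical.not_imp, Pi.zero_apply,
      ENNReal.ofReal_eq_zero, not_le]
    exact ⟨hz, density_pos x₀ hz.1⟩
  refine (hV.measure_pos volume ⟨extChartAt (𝓡 n) x₀ x₀, mem_extChartAt_target x₀, ?_⟩).ne' h3
  rw [mem_preimage, extChartAt_to_inv]
  exact hx₀

end Volume

/-! ### Completeness implies compact closed balls -/

section HopfRinow

/-- A complete locally compact metric space whose points have approximate points at all
intermediate distances is proper. -/
theorem properSpace_of_approximate_between {X : Type*} [MetricSpace X] [CompleteSpace X]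
    [LocallyCompactSpace X]
    (h : ∀ x y : X, ∀ s, 0 ≤ s → s ≤ dist x y → ∀ ε > 0, ∃ z, dist x z ≤ s ∧
      dist z y ≤ dist x y - s + ε) : ProperSpace X := by
  refine ⟨fun p R₁ => ?_⟩
  by_contra hR₁
  -- The supremum of the radii with compact ball is shown to be attained and then to be exceeded.
  set A : Set ℝ := {R | 0 ≤ R ∧ IsCompact (Metric.closedBall p R)} with hA
  have h0 : (0 : ℝ) ∈ A := ⟨le_rfl, by simp⟩
  have hbdd : BddAbove A := ⟨R₁, fun R hR => le_of_not_gt fun hlt =>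
    hR₁ (hR.2.of_isClosed_subset Metric.isClosed_closedBall
      (Metric.closedBall_subset_closedBall hlt.le))⟩
  have hnn : 0 ≤ sSup A := le_csSup hbdd h0
  -- Points of the ball of radius `sSup A` lie within `ε / 4`, up to another `ε / 4`, of a smaller
  -- compact ball, so a finite `ε / 4`-net of the smaller ball is an `ε`-net of the larger one.
  have hK : IsCompact (Metric.closedBall p (sSup A)) := by
    refine isCompact_iff_totallyBounded_isComplete.2
      ⟨?_, Metric.isClosed_closedBall.isComplete⟩
    refine Metric.totallyBounded_iff.2 fun ε hε => ?_
    obtain ⟨R, hRA, hR⟩ := exists_lt_of_lt_csSup ⟨0, h0⟩ (show sSup A - ε / 4 < sSup A by linarith)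
    obtain ⟨t, ht, hcov⟩ := Metric.totallyBounded_iff.1 hRA.2.totallyBounded (ε / 4) (by linarith)
    refine ⟨t, ht, fun y hy => ?_⟩
    rw [Metric.mem_closedBall, dist_comm] at hy
    obtain ⟨z, hz1, hz2⟩ := h p y (min R (dist p y)) (le_min hRA.1 dist_nonneg) (min_le_right _ _)
      (ε / 4) (by linarith)
    have hz : z ∈ Metric.closedBall p R := by
      rw [Metric.mem_closedBall, dist_comm]
      exact hz1.trans (min_le_left _ _)
    obtain ⟨w, hw, hzw⟩ := mem_iUnion₂.1 (hcov hz)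
    refine mem_iUnion₂.2 ⟨w, hw, ?_⟩
    rw [Metric.mem_ball] at hzw ⊢
    have h1 := dist_triangle y z w
    rw [dist_comm y z] at h1
    have h2 : dist p y - min R (dist p y) ≤ ε / 4 := by
      rcases min_choice R (dist p y) with hm | hm <;> rw [hm] <;> linarith
    linarith
  -- A compact set in a locally compact space has a thickening inside a compact set; approximate
  -- intermediate points put the ball of radius `sSup A + δ / 2` in that thickening.
  obtain ⟨K', hK', hKK'⟩ := exists_compact_superset hK
  obtain ⟨δ, hδ, hsub⟩ := hK.exists_cthickening_subset_open isOpen_interior hKK'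
  have hmem : sSup A + δ / 2 ∈ A := by
    refine ⟨by linarith, hK'.of_isClosed_subset Metric.isClosed_closedBall fun y hy => ?_⟩
    refine interior_subset (hsub ?_)
    rw [Metric.mem_closedBall, dist_comm] at hy
    obtain ⟨z, hz1, hz2⟩ := h p y (min (sSup A) (dist p y)) (le_min hnn dist_nonneg)
      (min_le_right _ _) (δ / 2) (by linarith)
    refine Metric.mem_cthickening_of_dist_le y z δ _ ?_ ?_
    · rw [Metric.mem_closedBall, dist_comm]
      exact hz1.trans (min_le_left _ _)
    · rw [dist_comm]
      have h2 : dist p y - min (sSup A) (dist p y) ≤ δ / 2 := by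
        rcases min_choice (sSup A) (dist p y) with hm | hm <;> rw [hm] <;> linarith
      linarith
  linarith [le_csSup hbdd hmem]

/-- On a curve of length less than `d(x, y) + ε`, the intermediate value theorem finds a point at
distance exactly `s` from `x`; the rest of the curve bounds its distance to `y`. -/
theorem exists_approximate_between [IsRiemannianManifold (𝓡 n) M] (x y : M) {s : ℝ} (hs0 : 0 ≤ s) (hs : s ≤ dist x y) {ε : ℝ}
    (hε : 0 < ε) : ∃ z, dist x z ≤ s ∧ dist z y ≤ dist x y - s + ε := by
  have h1 : Manifold.riemannianEDist (𝓡 n) x y < ENNReal.ofReal (dist x y + ε) := by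
    rw [← IsRiemannianManifold.out (I := 𝓡 n) x y, edist_dist]
    exact (ENNReal.ofReal_lt_ofReal_iff (by positivity)).2 (by linarith)
  obtain ⟨γ, h0, h1', hγ, hlen⟩ := Manifold.exists_lt_of_riemannianEDist_lt h1
  have hc : ContinuousOn (fun t => dist x (γ t)) (Icc 0 1) :=
    (continuous_const.dist continuous_id).comp_continuousOn hγ.continuousOn
  obtain ⟨t, ht, hst⟩ := intermediate_value_Icc zero_le_one hc
    (show s ∈ Icc (dist x (γ 0)) (dist x (γ 1)) by rw [h0, h1', dist_self]; exact ⟨hs0, hs⟩)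
  refine ⟨γ t, hst.le, ?_⟩
  have hL1 : edist x (γ t) ≤ Manifold.pathELength (𝓡 n) γ 0 t := by
    rw [IsRiemannianManifold.out (I := 𝓡 n) x (γ t)]
    exact Manifold.riemannianEDist_le_pathELength (hγ.mono (Icc_subset_Icc_right ht.2)) h0 rfl ht.1
  have hL2 : edist (γ t) y ≤ Manifold.pathELength (𝓡 n) γ t 1 := by
    rw [IsRiemannianManifold.out (I := 𝓡 n) (γ t) y]
    exact Manifold.riemannianEDist_le_pathELength (hγ.mono (Icc_subset_Icc_left ht.1)) rfl h1' ht.2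
  have h2 : edist x (γ t) + edist (γ t) y < ENNReal.ofReal (dist x y + ε) := by
    refine lt_of_le_of_lt (add_le_add hL1 hL2) ?_
    rwa [Manifold.pathELength_add ht.1 ht.2]
  rw [edist_dist, edist_dist, ← ENNReal.ofReal_add dist_nonneg dist_nonneg,
    ENNReal.ofReal_lt_ofReal_iff (by positivity)] at h2
  simp only at hst
  linarith

variable (n M) in
theorem properSpace_of_complete [IsRiemannianManifold (𝓡 n) M] [CompleteSpace M] : ProperSpace M := by
  have : LocallyCompactSpace M := ChartedSpace.locallyCompactSpace (EuclideanSpace ℝ (Fin n)) M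
  exact properSpace_of_approximate_between fun x y s h0 h1 ε hε =>
    exists_approximate_between (n := n) x y h0 h1 hε

end HopfRinow

/-! ### Integration by parts and Green's formula -/

section Green

/-- Used throughout to integrate products in which one factor is regular only on an open set: the
other factor vanishes near the points where regularity is lost. -/
theorem continuous_mul_of_tsupport_subset {X : Type*} [TopologicalSpace X] {U : Set X}
    (hU : IsOpen U) {h ψ : X → ℝ} (hh : ContinuousOn h U) (hψ : Continuous ψ)
    (hs : tsupport ψ ⊆ U) : Continuous fun x => ψ x * h x := by
  refine continuous_iff_continuousAt.2 fun x => ?_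
  by_cases hx : x ∈ tsupport ψ
  · exact hψ.continuousAt.mul (hh.continuousAt (hU.mem_nhds (hs hx)))
  · refine (continuousAt_const (y := (0 : ℝ))).congr ?_
    filter_upwards [(isClosed_tsupport ψ).isOpen_compl.mem_nhds hx] with y hy
    rw [image_eq_zero_of_notMem_tsupport hy, zero_mul]

/-- Only finitely many supports meet `K`, by local finiteness. The sum is one in a neighbourhood of
each point of `K`, so that the gradients of the `χ i` also add up to zero there. -/
theorem exists_finite_partition [SigmaCompactSpace M] {K : Set M} (hK : IsCompact K)
    (V : M → Set M) (hVo : ∀ x, IsOpen (V x)) (hV : ∀ x, x ∈ V x) :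
    ∃ (t : Finset M) (χ : M → M → ℝ), (∀ i, ContMDiff (𝓡 n) 𝓘(ℝ, ℝ) ∞ (χ i)) ∧
      (∀ i x, 0 ≤ χ i x) ∧ (∀ i, tsupport (χ i) ⊆ V i) ∧
      ∀ x ∈ K, ∀ᶠ y in 𝓝 x, ∑ i ∈ t, χ i y = 1 := by
  obtain ⟨ρ, hρ⟩ := SmoothPartitionOfUnity.exists_isSubordinate (𝓡 n) isClosed_univ V hVo
    (fun x _ => mem_iUnion.2 ⟨x, hV x⟩)
  have hfin : {i | ((tsupport (ρ i)) ∩ K).Nonempty}.Finite :=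
    ρ.locallyFinite.closure.finite_nonempty_inter_compact hK
  refine ⟨hfin.toFinset, fun i => ρ i, fun i => (ρ i).contMDiff, fun i x => ρ.nonneg i x, hρ,
    fun x hx => ?_⟩
  filter_upwards [ρ.eventually_finsupport_subset x] with y hy
  refine ρ.sum_finsupport' y (mem_univ y) fun i hi => ?_
  rw [Set.Finite.mem_toFinset]
  exact ⟨x, (ρ.mem_fintsupport_iff x i).1 (hy hi), hx⟩

theorem integral_mul_partialDeriv {V : Set (EuclideanSpace ℝ (Fin n))} (hV : IsOpen V)
    {X g : EuclideanSpace ℝ (Fin n) → ℝ} (hX : ContDiffOn ℝ 1 X V) (hg : ContDiff ℝ 1 g)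
    (hgc : HasCompactSupport g) (hgs : tsupport g ⊆ V) (i : Fin n) :
    ∫ z, X z * partialDeriv i g z = - ∫ z, partialDeriv i X z * g z := by
  have hg' : Continuous (partialDeriv i g) :=
    (hg.continuous_fderiv one_ne_zero).clm_apply continuous_const
  have hX' : ContinuousOn (partialDeriv i X) V :=
    (hX.continuousOn_fderiv_of_isOpen hV le_rfl).clm_apply continuousOn_const
  have hsub : tsupport (partialDeriv i g) ⊆ tsupport g :=
    (tsupport_fderiv_apply_subset ℝ _).trans subset_rfl
  have hgc' : HasCompactSupport (partialDeriv i g) := hgc.fderiv_apply ℝ _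
  have h1 : Integrable (fun z => partialDeriv i X z * g z) := by
    simp_rw [mul_comm _ (g _)]
    exact (continuous_mul_of_tsupport_subset hV hX' hg.continuous hgs).integrable_of_hasCompactSupport
      hgc.mul_right
  have h2 : Integrable (fun z => X z * partialDeriv i g z) := by
    simp_rw [mul_comm (X _)]
    exact (continuous_mul_of_tsupport_subset hV hX.continuousOn hg'
      (hsub.trans hgs)).integrable_of_hasCompactSupport hgc'.mul_right
  have h3 : Integrable (fun z => X z * g z) := by
    simp_rw [mul_comm (X _)]
    exact (continuous_mul_of_tsupport_subset hV hX.continuousOn hg.continuous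
      hgs).integrable_of_hasCompactSupport hgc.mul_right
  exact integral_mul_fderiv_eq_neg_fderiv_mul_of_integrable h1 h2 h3
    (fun z hz => (hX.contDiffAt (hV.mem_nhds (hgs hz))).differentiableAt one_ne_zero)
    (fun z _ => hg.differentiable one_ne_zero z)

/-- A function supported in a chart domain, read in the chart and extended by zero. -/
def inChart (x₀ : M) (ψ : M → ℝ) : EuclideanSpace ℝ (Fin n) → ℝ :=
  (extChartAt (𝓡 n) x₀).target.indicator (ψ ∘ (extChartAt (𝓡 n) x₀).symm)

theorem inChart_of_mem (x₀ : M) (ψ : M → ℝ) {z : EuclideanSpace ℝ (Fin n)}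
    (hz : z ∈ (extChartAt (𝓡 n) x₀).target) :
    inChart x₀ ψ z = ψ ((extChartAt (𝓡 n) x₀).symm z) := Set.indicator_of_mem hz _

/-- The image of the support is compact and inside the open target, so extension by zero creates no
singularity at the boundary of the target. -/
theorem tsupport_inChart_subset (x₀ : M) {ψ : M → ℝ} (hc : HasCompactSupport ψ)
    (hs : tsupport ψ ⊆ (extChartAt (𝓡 n) x₀).source) :
    tsupport (inChart (n := n) x₀ ψ) ⊆ extChartAt (𝓡 n) x₀ '' tsupport ψ := by
  have hK : IsCompact (extChartAt (𝓡 n) x₀ '' tsupport ψ) :=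
    hc.isCompact.image_of_continuousOn ((continuousOn_extChartAt x₀).mono hs)
  refine closure_minimal (fun z hz => ?_) hK.isClosed
  have hzT : z ∈ (extChartAt (𝓡 n) x₀).target := by
    by_contra h
    exact hz (Set.indicator_of_notMem h _)
  rw [Function.mem_support, inChart_of_mem x₀ ψ hzT] at hz
  exact ⟨_, subset_tsupport _ hz, (extChartAt (𝓡 n) x₀).right_inv hzT⟩

theorem hasCompactSupport_inChart (x₀ : M) {ψ : M → ℝ} (hc : HasCompactSupport ψ)
    (hs : tsupport ψ ⊆ (extChartAt (𝓡 n) x₀).source) :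
    HasCompactSupport (inChart (n := n) x₀ ψ) :=
  (hc.isCompact.image_of_continuousOn ((continuousOn_extChartAt x₀).mono hs)).of_isClosed_subset
    (isClosed_tsupport _) (tsupport_inChart_subset x₀ hc hs)

theorem contDiff_inChart (x₀ : M) {ψ : M → ℝ} {k : ℕ∞} (hψ : ContMDiff (𝓡 n) 𝓘(ℝ, ℝ) k ψ)
    (hc : HasCompactSupport ψ) (hs : tsupport ψ ⊆ (extChartAt (𝓡 n) x₀).source) :
    ContDiff ℝ k (inChart (n := n) x₀ ψ) := by
  have hT := isOpen_target (n := n) x₀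
  refine contDiff_iff_contDiffAt.2 fun z => ?_
  by_cases hz : z ∈ (extChartAt (𝓡 n) x₀).target
  · have h1 : ContDiffOn ℝ k (ψ ∘ (extChartAt (𝓡 n) x₀).symm) (extChartAt (𝓡 n) x₀).target := by
      rw [← contMDiffOn_iff_contDiffOn]
      exact hψ.comp_contMDiffOn ((contMDiffOn_extChartAt_symm (n := ∞) x₀).of_le
        (by exact_mod_cast le_top))
    refine (h1.contDiffAt (hT.mem_nhds hz)).congr_of_eventuallyEq ?_
    filter_upwards [hT.mem_nhds hz] with y hy using inChart_of_mem x₀ ψ hy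
  · have hz' : z ∉ tsupport (inChart (n := n) x₀ ψ) := fun h => hz <| by
      obtain ⟨x, hx, rfl⟩ := tsupport_inChart_subset x₀ hc hs h
      exact (extChartAt (𝓡 n) x₀).map_source (hs hx)
    refine (contDiffAt_const (c := (0 : ℝ))).congr_of_eventuallyEq ?_
    exact notMem_tsupport_iff_eventuallyEq.1 hz'

theorem grad_eq_zero_of_notMem_tsupport {ψ : M → ℝ} {x : M} (hx : x ∉ tsupport ψ) :
    grad (n := n) ψ x = 0 := by
  have h : mfderiv (𝓡 n) 𝓘(ℝ, ℝ) ψ x = 0 := by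
    rw [(notMem_tsupport_iff_eventuallyEq.1 hx).mfderiv_eq]
    exact mfderiv_const
  rw [grad, h]
  exact map_zero _

variable [IsContMDiffRiemannianBundle (𝓡 n) ∞ (EuclideanSpace ℝ (Fin n))
      (fun x : M => TangentSpace (𝓡 n) x)]

theorem continuous_inner_grad_of_tsupport {U : Set M} (hU : IsOpen U) {u ψ : M → ℝ}
    (hu : ContMDiffOn (𝓡 n) 𝓘(ℝ, ℝ) 1 u U) (hψ : ContMDiff (𝓡 n) 𝓘(ℝ, ℝ) 1 ψ)
    (hs : tsupport ψ ⊆ U) :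
    Continuous fun x => inner ℝ (grad (n := n) u x) (grad (n := n) ψ x) := by
  refine continuous_iff_continuousAt.2 fun x => ?_
  by_cases hx : x ∈ tsupport ψ
  · exact (continuousOn_inner_grad hU hu hψ.contMDiffOn).continuousAt (hU.mem_nhds (hs hx))
  · refine (continuousAt_const (y := (0 : ℝ))).congr ?_
    filter_upwards [(isClosed_tsupport ψ).isOpen_compl.mem_nhds hx] with y hy
    rw [grad_eq_zero_of_notMem_tsupport hy, inner_zero_right]

theorem hasCompactSupport_inner_grad {u ψ : M → ℝ} (hc : HasCompactSupport ψ) :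
    HasCompactSupport fun x => (inner ℝ (grad (n := n) u x) (grad (n := n) ψ x) : ℝ) :=
  HasCompactSupport.intro hc.isCompact fun x hx => by
    rw [grad_eq_zero_of_notMem_tsupport hx, inner_zero_right]

/-- The component `∑ⱼ √g gⁱʲ ∂ⱼ f` of the density-weighted gradient. -/
def fluxInChart (x₀ : M) (f : M → ℝ) (i : Fin n) (z : EuclideanSpace ℝ (Fin n)) : ℝ :=
  ∑ j : Fin n, density x₀ z * (gram x₀ z)⁻¹ i j *
    partialDeriv j (f ∘ (extChartAt (𝓡 n) x₀).symm) z

theorem isOpen_target_inter_preimage (x₀ : M) {U : Set M} (hU : IsOpen U) :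
    IsOpen ((extChartAt (𝓡 n) x₀).target ∩ (extChartAt (𝓡 n) x₀).symm ⁻¹' U) :=
  (continuousOn_extChartAt_symm x₀).isOpen_inter_preimage (isOpen_target x₀) hU

theorem contDiffOn_fluxInChart (x₀ : M) {U : Set M} (hU : IsOpen U) {f : M → ℝ}
    (hf : ContMDiffOn (𝓡 n) 𝓘(ℝ, ℝ) 2 f U) (i : Fin n) :
    ContDiffOn ℝ 1 (fluxInChart x₀ f i)
      ((extChartAt (𝓡 n) x₀).target ∩ (extChartAt (𝓡 n) x₀).symm ⁻¹' U) := by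
  have hV := isOpen_target_inter_preimage (n := n) x₀ hU
  have h1 : ContDiffOn ℝ 2 (f ∘ (extChartAt (𝓡 n) x₀).symm)
      ((extChartAt (𝓡 n) x₀).target ∩ (extChartAt (𝓡 n) x₀).symm ⁻¹' U) := by
    rw [← contMDiffOn_iff_contDiffOn]
    exact hf.comp ((contMDiffOn_extChartAt_symm x₀).mono inter_subset_left) fun z hz => hz.2
  refine ContDiffOn.sum fun j _ => ContDiffOn.mul (ContDiffOn.mul ?_ ?_) ?_
  · exact ((contDiffOn_density x₀).of_le (by exact_mod_cast le_top)).mono inter_subset_left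
  · exact ((contDiffOn_gram_inv x₀ i j).of_le (by exact_mod_cast le_top)).mono inter_subset_left
  · exact (h1.fderiv_of_isOpen hV (by norm_num)).clm_apply contDiffOn_const

theorem continuousOn_laplacianInChart (x₀ : M) {U : Set M} (hU : IsOpen U) {f : M → ℝ}
    (hf : ContMDiffOn (𝓡 n) 𝓘(ℝ, ℝ) 2 f U) :
    ContinuousOn (laplacianInChart (n := n) x₀ f) (U ∩ (extChartAt (𝓡 n) x₀).source) := by
  have hV := isOpen_target_inter_preimage (n := n) x₀ hU
  have h1 : ContinuousOn (fun z => (density x₀ z)⁻¹ * ∑ i, partialDeriv i (fluxInChart x₀ f i) z)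
      ((extChartAt (𝓡 n) x₀).target ∩ (extChartAt (𝓡 n) x₀).symm ⁻¹' U) := by
    refine ContinuousOn.mul (ContinuousOn.inv₀ ((contDiffOn_density x₀).continuousOn.mono
      inter_subset_left) fun z hz => (density_pos x₀ hz.1).ne') ?_
    exact continuousOn_finsetSum _ fun i _ =>
      ((contDiffOn_fluxInChart x₀ hU hf i).continuousOn_fderiv_of_isOpen hV le_rfl).clm_apply
        continuousOn_const
  refine h1.comp ((continuousOn_extChartAt x₀).mono inter_subset_right) fun x hx => ?_
  refine ⟨(extChartAt (𝓡 n) x₀).map_source hx.2, ?_⟩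
  rw [mem_preimage, (extChartAt (𝓡 n) x₀).left_inv hx.2]
  exact hx.1

variable [MeasurableSpace M] [BorelSpace M]

/-- Green's formula for a function supported in a chart domain. -/
theorem integral_inner_grad_eq_neg_integral_laplacianInChart (x₀ : M) {U : Set M} (hU : IsOpen U)
    {f ψ : M → ℝ} (hf : ContMDiffOn (𝓡 n) 𝓘(ℝ, ℝ) 2 f U) (hψ : ContMDiff (𝓡 n) 𝓘(ℝ, ℝ) 1 ψ)
    (hc : HasCompactSupport ψ) (hs : tsupport ψ ⊆ U ∩ (extChartAt (𝓡 n) x₀).source) :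
    ∫ x, inner ℝ (grad (n := n) f x) (grad (n := n) ψ x) ∂(riemannianVolume n M) =
      - ∫ x, ψ x * laplacianInChart (n := n) x₀ f x ∂(riemannianVolume n M) := by
  set e := extChartAt (𝓡 n) x₀ with he
  have hT := isOpen_target (n := n) x₀
  have hSo := isOpen_extChartAt_source (I := 𝓡 n) x₀
  have hsU : tsupport ψ ⊆ U := hs.trans inter_subset_left
  have hsS : tsupport ψ ⊆ e.source := hs.trans inter_subset_right
  have hc1 : Continuous fun x => inner ℝ (grad (n := n) f x) (grad (n := n) ψ x) :=
    continuous_inner_grad_of_tsupport hU (hf.of_le one_le_two) hψ hsU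
  have hc2 : Continuous fun x => ψ x * laplacianInChart (n := n) x₀ f x :=
    continuous_mul_of_tsupport_subset (hU.inter hSo) (continuousOn_laplacianInChart x₀ hU hf)
      hψ.continuous hs
  have hnot : ∀ x, x ∉ e.source → x ∉ tsupport ψ := fun x hx h => hx (hsS h)
  have hI1 := setIntegral_eq_integral_of_forall_compl_eq_zero (s := e.source)
    (μ := riemannianVolume n M) (f := fun x => inner ℝ (grad (n := n) f x) (grad (n := n) ψ x))
    (fun x hx => by rw [grad_eq_zero_of_notMem_tsupport (hnot x hx), inner_zero_right])
  have hI2 := setIntegral_eq_integral_of_forall_compl_eq_zero (s := e.source)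
    (μ := riemannianVolume n M) (f := fun x => ψ x * laplacianInChart (n := n) x₀ f x)
    (fun x hx => by rw [image_eq_zero_of_notMem_tsupport (hnot x hx), zero_mul])
  rw [← hI1, ← hI2, he, integral_source x₀ hc1.measurable, integral_source x₀ hc2.measurable, ← he]
  set g := inChart (n := n) x₀ ψ with hg
  have hgd : ContDiff ℝ 1 g := contDiff_inChart (k := 1) x₀ hψ hc hsS
  have hgc : HasCompactSupport g := hasCompactSupport_inChart x₀ hc hsS
  set V := e.target ∩ e.symm ⁻¹' U with hV
  have hVo : IsOpen V := isOpen_target_inter_preimage x₀ hU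
  have hgs : tsupport g ⊆ V := (tsupport_inChart_subset x₀ hc hsS).trans <| by
    rintro _ ⟨x, hx, rfl⟩
    refine ⟨e.map_source (hsS hx), ?_⟩
    rw [mem_preimage, e.left_inv (hsS hx)]
    exact hsU hx
  have hflux : ∀ i, ContDiffOn ℝ 1 (fluxInChart x₀ f i) V := contDiffOn_fluxInChart x₀ hU hf
  -- In coordinates the left integrand is the flux of `f` paired with the Euclidean derivative of
  -- `ψ`.
  have hL : ∀ z ∈ e.target, density x₀ z * inner ℝ (grad (n := n) f (e.symm z))
      (grad (n := n) ψ (e.symm z)) = ∑ i, fluxInChart x₀ f i z * partialDeriv i g z := by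
    intro z hz
    by_cases hzV : z ∈ V
    · rw [real_inner_comm, inner_grad_grad_eq x₀ hz (hψ.mdifferentiableAt one_ne_zero)
        ((hf.contMDiffAt (hU.mem_nhds hzV.2)).mdifferentiableAt two_ne_zero), Finset.mul_sum]
      refine Finset.sum_congr rfl fun i _ => ?_
      have h1 : partialDeriv i g z = partialDeriv i (ψ ∘ e.symm) z := by
        have : g =ᶠ[𝓝 z] ψ ∘ e.symm := by
          filter_upwards [hT.mem_nhds hz] with y hy using inChart_of_mem x₀ ψ hy
        rw [partialDeriv, partialDeriv, this.fderiv_eq]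
      rw [h1, fluxInChart, Finset.mul_sum, Finset.sum_mul]
      exact Finset.sum_congr rfl fun j _ => by ring
    · have h1 : e.symm z ∉ tsupport ψ := fun h => hzV ⟨hz, hsU h⟩
      have h2 : z ∉ tsupport g := fun h => hzV (hgs h)
      rw [grad_eq_zero_of_notMem_tsupport h1, inner_zero_right, mul_zero]
      refine (Finset.sum_eq_zero fun i _ => ?_).symm
      rw [partialDeriv, (notMem_tsupport_iff_eventuallyEq.1 h2).fderiv_eq]
      simp
  -- The volume density cancels the factor `(det g)^(-1/2)` of the Laplacian and leaves the
  -- Euclidean divergence of the flux.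
  have hR : ∀ z ∈ e.target, density x₀ z * (ψ (e.symm z) *
      laplacianInChart (n := n) x₀ f (e.symm z)) =
      ∑ i, partialDeriv i (fluxInChart x₀ f i) z * g z := by
    intro z hz
    have h1 : laplacianInChart (n := n) x₀ f (e.symm z) =
        (density x₀ z)⁻¹ * ∑ i, partialDeriv i (fluxInChart x₀ f i) z := by
      rw [laplacianInChart, ← he, e.right_inv hz]
      rfl
    have h2 := (density_pos x₀ hz).ne'
    rw [hg, inChart_of_mem x₀ ψ hz, h1, ← Finset.sum_mul]
    field_simp
    exact mul_comm _ _
  rw [setIntegral_congr_fun hT.measurableSet hL, setIntegral_congr_fun hT.measurableSet hR]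
  have hgT : ∀ z, z ∉ e.target → z ∉ tsupport g := fun z hz h => hz (hgs h).1
  rw [setIntegral_eq_integral_of_forall_compl_eq_zero (fun z hz => Finset.sum_eq_zero fun i _ => by
      rw [partialDeriv, (notMem_tsupport_iff_eventuallyEq.1 (hgT z hz)).fderiv_eq]
      simp),
    setIntegral_eq_integral_of_forall_compl_eq_zero (fun z hz => Finset.sum_eq_zero fun i _ => by
      rw [image_eq_zero_of_notMem_tsupport (hgT z hz), mul_zero]),
    integral_finsetSum, integral_finsetSum, ← Finset.sum_neg_distrib]
  · exact Finset.sum_congr rfl fun i _ => integral_mul_partialDeriv hVo (hflux i) hgd hgc hgs i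
  · intro i _
    simp_rw [mul_comm _ (g _)]
    exact (continuous_mul_of_tsupport_subset hVo (((hflux i).continuousOn_fderiv_of_isOpen hVo
      le_rfl).clm_apply continuousOn_const) hgd.continuous hgs).integrable_of_hasCompactSupport
      hgc.mul_right
  · intro i _
    simp_rw [mul_comm _ (partialDeriv i g _)]
    exact (continuous_mul_of_tsupport_subset hVo (hflux i).continuousOn
      ((hgd.continuous_fderiv one_ne_zero).clm_apply continuous_const)
      ((tsupport_fderiv_apply_subset ℝ _).trans hgs)).integrable_of_hasCompactSupport
      (hgc.fderiv_apply ℝ _).mul_right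

end Green

/-! ### Calculus rules for the gradient -/

section GradCalculus

/-- The gradient is determined by its inner products; each rule below is the corresponding rule for
the derivative read through this. -/
theorem grad_eq_of_hasMFDerivAt {u : M → ℝ} {x : M} {X : TangentSpace (𝓡 n) x}
    {L : TangentSpace (𝓡 n) x →L[ℝ] ℝ} (hu : HasMFDerivAt (𝓡 n) 𝓘(ℝ, ℝ) u x L)
    (h : ∀ v, inner ℝ X v = L v) : grad (n := n) u x = X := by
  refine ext_inner_right ℝ fun v => ?_
  rw [inner_grad, hu.mfderiv, h]
  rfl

theorem grad_add {u w : M → ℝ} {x : M} (hu : MDifferentiableAt (𝓡 n) 𝓘(ℝ, ℝ) u x)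
    (hw : MDifferentiableAt (𝓡 n) 𝓘(ℝ, ℝ) w x) :
    grad (n := n) (u + w) x = grad (n := n) u x + grad (n := n) w x := by
  refine grad_eq_of_hasMFDerivAt (hu.hasMFDerivAt.add hw.hasMFDerivAt) fun v => ?_
  rw [inner_add_left, inner_grad, inner_grad]
  rfl

theorem grad_const_smul {u : M → ℝ} {x : M} (c : ℝ) (hu : MDifferentiableAt (𝓡 n) 𝓘(ℝ, ℝ) u x) :
    grad (n := n) (c • u) x = c • grad (n := n) u x := by
  refine grad_eq_of_hasMFDerivAt (hu.hasMFDerivAt.const_smul c) fun v => ?_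
  rw [real_inner_smul_left, inner_grad]
  rfl

theorem grad_sub {u w : M → ℝ} {x : M} (hu : MDifferentiableAt (𝓡 n) 𝓘(ℝ, ℝ) u x)
    (hw : MDifferentiableAt (𝓡 n) 𝓘(ℝ, ℝ) w x) :
    grad (n := n) (u - w) x = grad (n := n) u x - grad (n := n) w x := by
  refine grad_eq_of_hasMFDerivAt (hu.hasMFDerivAt.sub hw.hasMFDerivAt) fun v => ?_
  rw [inner_sub_left, inner_grad, inner_grad]
  rfl

theorem grad_mul {u w : M → ℝ} {x : M} (hu : MDifferentiableAt (𝓡 n) 𝓘(ℝ, ℝ) u x)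
    (hw : MDifferentiableAt (𝓡 n) 𝓘(ℝ, ℝ) w x) :
    grad (n := n) (u * w) x = u x • grad (n := n) w x + w x • grad (n := n) u x := by
  refine grad_eq_of_hasMFDerivAt (hu.hasMFDerivAt.mul hw.hasMFDerivAt) fun v => ?_
  rw [inner_add_left, real_inner_smul_left, real_inner_smul_left, inner_grad, inner_grad]
  rfl

theorem grad_comp {η : ℝ → ℝ} {u : M → ℝ} {x : M} {c : ℝ}
    (hη : HasDerivAt η c (u x)) (hu : MDifferentiableAt (𝓡 n) 𝓘(ℝ, ℝ) u x) :
    grad (n := n) (η ∘ u) x = c • grad (n := n) u x := by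
  refine grad_eq_of_hasMFDerivAt (hη.hasFDerivAt.hasMFDerivAt.comp x hu.hasMFDerivAt) fun v => ?_
  rw [real_inner_smul_left, inner_grad]
  exact mul_comm _ _

end GradCalculus

/-! ### Chart independence of the Laplacian and the weak inequality -/

section Subsolution

variable [IsContMDiffRiemannianBundle (𝓡 n) ∞ (EuclideanSpace ℝ (Fin n))
      (fun x : M => TangentSpace (𝓡 n) x)] [MeasurableSpace M] [BorelSpace M]
      [SigmaCompactSpace M]

/-- The Laplacian does not depend on the chart in which it is computed. -/
theorem laplacianInChart_eq_laplacian {U : Set M} (hU : IsOpen U) {f : M → ℝ}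
    (hf : ContMDiffOn (𝓡 n) 𝓘(ℝ, ℝ) 2 f U) (x₀ : M) {y : M} (hy : y ∈ U)
    (hy₀ : y ∈ (extChartAt (𝓡 n) x₀).source) :
    laplacianInChart (n := n) x₀ f y = laplacian n f y := by
  have hS₀ := isOpen_extChartAt_source (I := 𝓡 n) x₀
  have hS₁ := isOpen_extChartAt_source (I := 𝓡 n) y
  set W := U ∩ ((extChartAt (𝓡 n) x₀).source ∩ (extChartAt (𝓡 n) y).source) with hW
  have hWo : IsOpen W := hU.inter (hS₀.inter hS₁)
  have hyW : y ∈ W := ⟨hy, hy₀, mem_extChartAt_source y⟩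
  have hc₀ : ContinuousOn (laplacianInChart (n := n) x₀ f) W :=
    (continuousOn_laplacianInChart x₀ hU hf).mono fun z hz => ⟨hz.1, hz.2.1⟩
  have hc₁ : ContinuousOn (laplacianInChart (n := n) y f) W :=
    (continuousOn_laplacianInChart y hU hf).mono fun z hz => ⟨hz.1, hz.2.2⟩
  have hc := hc₀.sub hc₁
  -- Green's formula has the same left-hand side in both charts, so the difference of the two
  -- Laplacians is orthogonal to all test functions on `W` and vanishes almost everywhere.
  have hae := hWo.ae_eq_zero_of_integral_contMDiff_smul_eq_zero (𝓡 n)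
    (μ := riemannianVolume n M) (hc.locallyIntegrableOn hWo.measurableSet)
    (fun ψ hψ hψc hψs => by
      have hψ1 : ContMDiff (𝓡 n) 𝓘(ℝ, ℝ) 1 ψ := hψ.of_le (by exact_mod_cast le_top)
      have h₀ := integral_inner_grad_eq_neg_integral_laplacianInChart x₀ hU hf hψ1 hψc
        (hψs.trans fun z hz => ⟨hz.1, hz.2.1⟩)
      have h₁ := integral_inner_grad_eq_neg_integral_laplacianInChart y hU hf hψ1 hψc
        (hψs.trans fun z hz => ⟨hz.1, hz.2.2⟩)
      have hi₀ := (continuous_mul_of_tsupport_subset hWo hc₀ hψ.continuous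
        hψs).integrable_of_hasCompactSupport (μ := riemannianVolume n M) hψc.mul_right
      have hi₁ := (continuous_mul_of_tsupport_subset hWo hc₁ hψ.continuous
        hψs).integrable_of_hasCompactSupport (μ := riemannianVolume n M) hψc.mul_right
      simp only [smul_eq_mul, Pi.sub_apply, mul_sub]
      rw [integral_sub hi₀ hi₁]
      linarith)
  by_contra hne
  -- By continuity the difference would be nonzero on a nonempty open set, which has positive
  -- measure.
  have hopen : IsOpen (W ∩ (laplacianInChart (n := n) x₀ f - laplacianInChart (n := n) y f) ⁻¹'
      {0}ᶜ) := hc.isOpen_inter_preimage hWo isOpen_compl_singleton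
  refine (hopen.measure_pos (riemannianVolume n M) ⟨y, hyW, ?_⟩).ne' ?_
  · exact fun h => hne (sub_eq_zero.1 h)
  · refine measure_mono_null (fun z hz => ?_) hae
    simp only [mem_compl_iff, mem_ofPred_eq, Classical.not_imp]
    exact ⟨hz.1, hz.2⟩

/-- The weak form of `Δf ≥ -μf`. A partition of unity splits `ψ` into pieces `χ i * ψ` supported in
chart domains; these stay nonnegative, so Green's formula in each chart preserves the inequality. -/
theorem integral_inner_grad_le_of_subsolution {U : Set M} (hU : IsOpen U) {f ψ : M → ℝ}
    (hf : ContMDiffOn (𝓡 n) 𝓘(ℝ, ℝ) 2 f U) {μ : ℝ} (hsub : ∀ x ∈ U, -μ * f x ≤ laplacian n f x)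
    (hψ : ContMDiff (𝓡 n) 𝓘(ℝ, ℝ) 1 ψ) (hψc : HasCompactSupport ψ) (hψs : tsupport ψ ⊆ U)
    (hψ0 : ∀ x, 0 ≤ ψ x) :
    ∫ x, inner ℝ (grad (n := n) f x) (grad (n := n) ψ x) ∂(riemannianVolume n M) ≤
      μ * ∫ x, ψ x * f x ∂(riemannianVolume n M) := by
  obtain ⟨t, χ, hχ, hχ0, hχs, hχ1⟩ := exists_finite_partition (n := n) hψc.isCompact
    (fun x => (extChartAt (𝓡 n) x).source) (fun x => isOpen_extChartAt_source x)
    (fun x => mem_extChartAt_source x)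
  have hχ' : ∀ i, ContMDiff (𝓡 n) 𝓘(ℝ, ℝ) 1 (χ i) := fun i => (hχ i).of_le (by exact_mod_cast le_top)
  have hp : ∀ i, ContMDiff (𝓡 n) 𝓘(ℝ, ℝ) 1 (χ i * ψ) := fun i => (hχ' i).mul hψ
  have hpc : ∀ i, HasCompactSupport (χ i * ψ) := fun i => hψc.mul_left
  have hps : ∀ i, tsupport (χ i * ψ) ⊆ U := fun i =>
    (tsupport_mul_subset_right).trans hψs
  have hpart : ∀ i, ∫ x, inner ℝ (grad (n := n) f x) (grad (n := n) (χ i * ψ) x)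
      ∂(riemannianVolume n M) ≤ μ * ∫ x, (χ i * ψ) x * f x ∂(riemannianVolume n M) := by
    intro i
    have hsi : tsupport (χ i * ψ) ⊆ U ∩ (extChartAt (𝓡 n) i).source :=
      subset_inter (hps i) (tsupport_mul_subset_left.trans (hχs i))
    rw [integral_inner_grad_eq_neg_integral_laplacianInChart i hU hf (hp i) (hpc i) hsi,
      ← integral_neg, ← integral_const_mul]
    refine integral_mono ?_ ?_ fun x => ?_
    · exact ((continuous_mul_of_tsupport_subset (hU.inter (isOpen_extChartAt_source i))
        (continuousOn_laplacianInChart i hU hf) (hp i).continuous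
        hsi).integrable_of_hasCompactSupport (hpc i).mul_right).neg
    · exact ((continuous_mul_of_tsupport_subset hU hf.continuousOn (hp i).continuous
        (hps i)).integrable_of_hasCompactSupport (hpc i).mul_right).const_mul _
    · by_cases hx : x ∈ tsupport (χ i * ψ)
      · have h1 := hsub x (hsi hx).1
        rw [← laplacianInChart_eq_laplacian hU hf i (hsi hx).1 (hsi hx).2] at h1
        have h2 : 0 ≤ (χ i * ψ) x := mul_nonneg (hχ0 i x) (hψ0 x)
        have h3 := mul_le_mul_of_nonneg_left h1 h2
        simp only
        linarith
      · simp only [image_eq_zero_of_notMem_tsupport hx]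
        simp
  have hsum : ∀ s : Finset M, ∫ x, inner ℝ (grad (n := n) f x)
      (grad (n := n) (∑ i ∈ s, χ i * ψ) x) ∂(riemannianVolume n M) =
        ∑ i ∈ s, ∫ x, inner ℝ (grad (n := n) f x) (grad (n := n) (χ i * ψ) x)
          ∂(riemannianVolume n M) := by
    intro s
    rw [← integral_finsetSum]
    · refine integral_congr_ae (Eventually.of_forall fun x => ?_)
      have : grad (n := n) (∑ i ∈ s, χ i * ψ) x = ∑ i ∈ s, grad (n := n) (χ i * ψ) x := by
        classical
        induction s using Finset.induction_on with
        | empty =>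
          simp only [Finset.sum_empty]
          exact grad_eq_zero_of_notMem_tsupport (by simp [tsupport])
        | insert j s hj ih =>
          rw [Finset.sum_insert hj, Finset.sum_insert hj, grad_add, ih]
          · exact (hp j).mdifferentiableAt one_ne_zero
          · have h := ContMDiff.sum (t := s) fun i _ => hp i
            rw [show (fun x => ∑ i ∈ s, (χ i * ψ) x) = ∑ i ∈ s, χ i * ψ by ext; simp] at h
            exact h.mdifferentiableAt one_ne_zero
      simp only [this, inner_sum]
    · intro i _
      exact (continuous_inner_grad_of_tsupport hU (hf.of_le one_le_two) (hp i)
        (hps i)).integrable_of_hasCompactSupport (hasCompactSupport_inner_grad (hpc i))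
  have hdec : ψ = ∑ i ∈ t, χ i * ψ := by
    ext x
    simp only [Finset.sum_apply, Pi.mul_apply]
    rw [← Finset.sum_mul]
    by_cases hx : x ∈ tsupport ψ
    · rw [(hχ1 x hx).self_of_nhds, one_mul]
    · rw [image_eq_zero_of_notMem_tsupport hx, mul_zero]
  have hR : ∫ x, ψ x * f x ∂(riemannianVolume n M) =
      ∑ i ∈ t, ∫ x, (χ i * ψ) x * f x ∂(riemannianVolume n M) := by
    rw [← integral_finsetSum]
    · refine integral_congr_ae (Eventually.of_forall fun x => ?_)
      conv_lhs => rw [hdec]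
      simp only [Finset.sum_apply, Finset.sum_mul]
    · intro i _
      exact (continuous_mul_of_tsupport_subset hU hf.continuousOn (hp i).continuous
        (hps i)).integrable_of_hasCompactSupport (hpc i).mul_right
  rw [hR, Finset.mul_sum]
  conv_lhs => rw [hdec]
  rw [hsum]
  exact Finset.sum_le_sum fun i _ => hpart i

end Subsolution

/-! ### From the bottom of the spectrum to Rayleigh quotients -/

section Spectrum

/-- If `Q - t` is nonnegative and the associated operator is onto, then `Q - t` is coercive. -/
theorem exists_pos_coercive_of_surjective {V H : Type*} [AddCommGroup V] [Module ℝ V]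
    [NormedAddCommGroup H] [InnerProductSpace ℝ H] [CompleteSpace H] (ι : V →ₗ[ℝ] H)
    (Q : V →ₗ[ℝ] V →ₗ[ℝ] ℝ) (hsymm : ∀ x y, Q x y = Q y x) {t : ℝ} (ht : 0 ≤ t)
    (hle : ∀ x, t * ‖ι x‖ ^ 2 ≤ Q x x)
    (hsurj : ∀ v : H, ∃ (u : H) (φ : ℕ → V), Tendsto (fun k => ι (φ k)) atTop (𝓝 u) ∧
      Tendsto (fun k : ℕ × ℕ => Q (φ k.1 - φ k.2) (φ k.1 - φ k.2)) atTop (𝓝 0) ∧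
      ∀ ψ, Tendsto (fun k => Q (φ k) ψ) atTop (𝓝 (inner ℝ (t • u + v) (ι ψ)))) :
    ∃ c > 0, ∀ x, (t + c) * ‖ι x‖ ^ 2 ≤ Q x x := by
  -- The shifted form is positive semidefinite, hence satisfies the Cauchy–Schwarz inequality,
  -- obtained from a discriminant.
  set q : V → V → ℝ := fun x y => Q x y - t * inner ℝ (ι x) (ι y) with hq
  have hq0 : ∀ x, 0 ≤ q x x := fun x => by
    simp only [hq, real_inner_self_eq_norm_sq]
    linarith [hle x]
  have hqQ : ∀ x, q x x ≤ Q x x := fun x => by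
    simp only [hq, real_inner_self_eq_norm_sq]
    have := mul_nonneg ht (sq_nonneg ‖ι x‖)
    linarith
  have hQ0 : ∀ x, 0 ≤ Q x x := fun x => (hq0 x).trans (hqQ x)
  have hCS : ∀ x y, q x y ^ 2 ≤ q x x * q y y := by
    intro x y
    have h : ∀ s : ℝ, 0 ≤ q y y * (s * s) + 2 * q x y * s + q x x := by
      intro s
      have := hq0 (x + s • y)
      simp only [hq, map_add, map_smul, LinearMap.add_apply, LinearMap.smul_apply, inner_add_left,
        inner_add_right, real_inner_smul_left, real_inner_smul_right, smul_eq_mul, hsymm y x,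
        real_inner_comm (ι x) (ι y)] at this ⊢
      linarith
    have := discrim_le_zero h
    rw [discrim] at this
    linarith
  -- If `v` is the image of `u`, then `⟨v, ι x⟩` is the limit of `q (φ k) x`, which is bounded on
  -- the set `q x x ≤ 1` because `q (φ k) (φ k)` is bounded.
  have hbound : ∀ v : H, ∃ C : ℝ, ∀ i : {x : V // q x x ≤ 1}, ‖innerSL ℝ (ι i) v‖ ≤ C := by
    intro v
    obtain ⟨u, φ, hu, hφ, hψ⟩ := hsurj v
    obtain ⟨C, hC⟩ : ∃ C, ∀ᶠ k in atTop, q (φ k) (φ k) ≤ C := by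
      obtain ⟨N, hN⟩ := eventually_atTop.1 (hφ.eventually (gt_mem_nhds zero_lt_one))
      -- From `Q(φ k) ≤ 2 Q(φ k - φ N) + 2 Q(φ N)`, which is the nonnegativity of `Q` at `φ k - 2 φ
      -- N`.
      refine ⟨2 * 1 + 2 * Q (φ N.2) (φ N.2), ?_⟩
      filter_upwards [eventually_ge_atTop N.1] with k hk
      have h1 := hN (k, N.2) ⟨hk, le_rfl⟩
      have h2 := hQ0 (φ k - (2 : ℝ) • φ N.2)
      simp only [map_sub, map_smul, LinearMap.sub_apply, LinearMap.smul_apply, smul_eq_mul,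
        hsymm (φ N.2) (φ k)] at h1 h2
      linarith [hqQ (φ k)]
    refine ⟨√C, fun i => ?_⟩
    have hlim : Tendsto (fun k => q (φ k) i) atTop (𝓝 (inner ℝ v (ι i))) := by
      have h := (hψ i).sub ((hu.inner (tendsto_const_nhds (x := ι i))).const_mul t)
      rw [inner_add_left, real_inner_smul_left, add_sub_cancel_left] at h
      exact h
    rw [innerSL_apply_apply, real_inner_comm]
    refine le_of_tendsto hlim.norm ?_
    filter_upwards [hC] with k hk
    refine Real.le_sqrt_of_sq_le ?_
    rw [Real.norm_eq_abs, sq_abs]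
    have h1 := mul_le_mul_of_nonneg_left i.2 (hq0 (φ k))
    linarith [hCS (φ k) i]
  -- Pointwise boundedness of the functionals `⟨ι x, ·⟩` becomes a bound on their norms `‖ι x‖`,
  -- uniform over `q x x ≤ 1`.
  obtain ⟨C, hC⟩ := banach_steinhaus hbound
  have hC' : ∀ x, q x x ≤ 1 → ‖ι x‖ ≤ C := fun x hx => by
    have := hC ⟨x, hx⟩
    rwa [innerSL_apply_norm] at this
  have hCnn : 0 ≤ C := (norm_nonneg _).trans (hC' 0 (by simp [hq]))
  have hscale : ∀ (x : V) (s : ℝ), q (s • x) (s • x) = s ^ 2 * q x x := fun x s => by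
    simp only [hq, map_smul, LinearMap.smul_apply, real_inner_smul_left, real_inner_smul_right,
      smul_eq_mul]
    ring
  -- Scaling gives `‖ι x‖² ≤ C² q x x`; the added `1` keeps the denominator positive when `C = 0`.
  refine ⟨1 / (C ^ 2 + 1), by positivity, fun x => ?_⟩
  have hkey : ‖ι x‖ ^ 2 ≤ (C ^ 2 + 1) * q x x := by
    rcases (hq0 x).eq_or_lt with h0 | h0
    · have hz : ‖ι x‖ ≤ 0 := by
        by_contra hpos
        push Not at hpos
        have := hC' (((C + 1) / ‖ι x‖) • x) (by rw [hscale, ← h0]; simp)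
        rw [map_smul, norm_smul, Real.norm_of_nonneg (by positivity),
          div_mul_cancel₀ _ hpos.ne'] at this
        linarith
      have hz' : ‖ι x‖ = 0 := le_antisymm hz (norm_nonneg _)
      rw [hz', ← h0]
      simp
    · have := hC' ((√(q x x))⁻¹ • x) (by
        rw [hscale, inv_pow, Real.sq_sqrt h0.le, inv_mul_cancel₀ h0.ne'])
      rw [map_smul, norm_smul, Real.norm_of_nonneg (by positivity),
        inv_mul_le_iff₀ (Real.sqrt_pos.2 h0)] at this
      have h2 := pow_le_pow_left₀ (norm_nonneg _) this 2
      rw [mul_pow, Real.sq_sqrt h0.le] at h2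
      linarith
  have h3 : 1 / (C ^ 2 + 1) * ‖ι x‖ ^ 2 ≤ q x x := by
    rw [one_div, inv_mul_le_iff₀ (by positivity)]
    exact hkey
  simp only [hq, real_inner_self_eq_norm_sq] at h3
  linarith

variable (n) in
/-- The space of test functions in `U`. -/
def testFunctions (U : Set M) : Submodule ℝ (M → ℝ) where
  carrier := {φ | IsTestFunction n U φ}
  add_mem' {φ ψ} hφ hψ := ⟨hφ.smooth.add hψ.smooth, hφ.compact.add hψ.compact,
    (tsupport_add φ ψ).trans (union_subset hφ.support hψ.support)⟩
  zero_mem' := ⟨contMDiff_const, HasCompactSupport.zero, by simp [tsupport]⟩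
  smul_mem' c φ hφ := ⟨(contMDiff_const (c := c)).mul hφ.smooth,
    hφ.compact.smul_left (f := fun _ => c),
    (closure_mono (Function.support_const_smul_subset c φ)).trans hφ.support⟩

variable [IsContMDiffRiemannianBundle (𝓡 n) ∞ (EuclideanSpace ℝ (Fin n))
      (fun x : M => TangentSpace (𝓡 n) x)] [MeasurableSpace M] [BorelSpace M]

theorem IsTestFunction.memLp {U : Set M} {φ : M → ℝ} (hφ : IsTestFunction n U φ) :
    MemLp φ 2 ((riemannianVolume n M).restrict U) :=
  (hφ.smooth.continuous.memLp_of_hasCompactSupport hφ.compact).restrict U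

theorem IsTestFunction.mdifferentiableAt {U : Set M} {φ : M → ℝ} (hφ : IsTestFunction n U φ)
    (x : M) : MDifferentiableAt (𝓡 n) 𝓘(ℝ, ℝ) φ x := hφ.smooth.mdifferentiableAt (by simp)

theorem IsTestFunction.integrable_inner_grad {U : Set M} {φ ψ : M → ℝ}
    (hφ : IsTestFunction n U φ) (hψ : IsTestFunction n U ψ) :
    Integrable (fun x => (inner ℝ (grad (n := n) φ x) (grad (n := n) ψ x) : ℝ))
      ((riemannianVolume n M).restrict U) :=
  ((continuous_inner_grad_of_tsupport isOpen_univ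
    (hφ.smooth.of_le (by exact_mod_cast le_top)).contMDiffOn
    (hψ.smooth.of_le (by exact_mod_cast le_top)) (subset_univ _)).integrable_of_hasCompactSupport
    (hasCompactSupport_inner_grad hψ.compact)).restrict

theorem dirichletForm_comm (U : Set M) (φ ψ : M → ℝ) :
    dirichletForm n U φ ψ = dirichletForm n U ψ φ := by
  simp only [dirichletForm, real_inner_comm]

variable (n) in
/-- The Dirichlet form on the space of test functions. -/
def testForm (U : Set M) : testFunctions (M := M) n U →ₗ[ℝ] testFunctions (M := M) n U →ₗ[ℝ] ℝ :=
  LinearMap.mk₂ ℝ (fun φ ψ => dirichletForm n U φ ψ)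
    (fun φ φ' ψ => by
      rw [dirichletForm, dirichletForm, dirichletForm, ← integral_add
        (φ.2.integrable_inner_grad ψ.2) (φ'.2.integrable_inner_grad ψ.2)]
      refine integral_congr_ae (Eventually.of_forall fun x => ?_)
      simp only [Submodule.coe_add, grad_add (φ.2.mdifferentiableAt x) (φ'.2.mdifferentiableAt x),
        inner_add_left])
    (fun c φ ψ => by
      rw [dirichletForm, dirichletForm, smul_eq_mul, ← integral_const_mul]
      refine integral_congr_ae (Eventually.of_forall fun x => ?_)
      simp only [Submodule.coe_smul, grad_const_smul c (φ.2.mdifferentiableAt x),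
        real_inner_smul_left])
    (fun φ ψ ψ' => by
      rw [dirichletForm, dirichletForm, dirichletForm, ← integral_add
        (φ.2.integrable_inner_grad ψ.2) (φ.2.integrable_inner_grad ψ'.2)]
      refine integral_congr_ae (Eventually.of_forall fun x => ?_)
      simp only [Submodule.coe_add, grad_add (ψ.2.mdifferentiableAt x) (ψ'.2.mdifferentiableAt x),
        inner_add_right])
    (fun c φ ψ => by
      rw [dirichletForm, dirichletForm, smul_eq_mul, ← integral_const_mul]
      refine integral_congr_ae (Eventually.of_forall fun x => ?_)
      simp only [Submodule.coe_smul, grad_const_smul c (ψ.2.mdifferentiableAt x),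
        real_inner_smul_right])

variable (n) in
/-- The inclusion of the test functions in `U` into `L²(U)`. -/
def testToLp (U : Set M) :
    testFunctions (M := M) n U →ₗ[ℝ] Lp ℝ 2 ((riemannianVolume n M).restrict U) where
  toFun φ := φ.2.memLp.toLp φ
  map_add' _ _ := rfl
  map_smul' _ _ := rfl

theorem coeFn_testToLp {U : Set M} (φ : testFunctions (M := M) n U) :
    testToLp n U φ =ᵐ[(riemannianVolume n M).restrict U] (φ : M → ℝ) := φ.2.memLp.coeFn_toLp

theorem inner_testToLp {U : Set M} (w : Lp ℝ 2 ((riemannianVolume n M).restrict U))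
    (φ : testFunctions (M := M) n U) :
    inner ℝ w (testToLp n U φ) = ∫ x in U, w x * (φ : M → ℝ) x ∂(riemannianVolume n M) := by
  rw [L2.inner_def]
  refine integral_congr_ae ?_
  filter_upwards [coeFn_testToLp φ] with x hx
  rw [hx]
  exact mul_comm ((φ : M → ℝ) x) (w x)

theorem norm_testToLp_sq {U : Set M} (φ : testFunctions (M := M) n U) :
    ‖testToLp n U φ‖ ^ 2 = ∫ x in U, (φ : M → ℝ) x ^ 2 ∂(riemannianVolume n M) := by
  rw [← real_inner_self_eq_norm_sq, inner_testToLp]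
  refine integral_congr_ae ?_
  filter_upwards [coeFn_testToLp φ] with x hx
  rw [hx, sq]

theorem dirichletForm_self_nonneg (U : Set M) (φ : M → ℝ) : 0 ≤ dirichletForm n U φ φ :=
  integral_nonneg fun _ => real_inner_self_nonneg

/-- The Rayleigh quotients of test functions are bounded below by the bottom of the spectrum. -/
theorem mul_integral_sq_le_dirichletForm {U : Set M} {μ₁ : ℝ}
    (hμ₁ : μ₁ ∈ lowerBounds (dirichletSpectrum (M := M) n U)) {φ : M → ℝ}
    (hφ : IsTestFunction n U φ) :
    μ₁ * ∫ x in U, φ x ^ 2 ∂(riemannianVolume n M) ≤ dirichletForm n U φ φ := by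
  by_contra hlt
  push Not at hlt
  -- The nonnegative lower bounds of the Rayleigh quotients. A violating `φ` keeps them all below
  -- `μ₁`, and their supremum is again a lower bound.
  set A : Set ℝ := {t | 0 ≤ t ∧ ∀ ψ : testFunctions (M := M) n U,
    t * ‖testToLp n U ψ‖ ^ 2 ≤ testForm n U ψ ψ} with hA
  have hlt' : testForm n U ⟨φ, hφ⟩ ⟨φ, hφ⟩ < μ₁ * ‖testToLp n U ⟨φ, hφ⟩‖ ^ 2 := by
    rw [norm_testToLp_sq]
    exact hlt
  have hAlt : ∀ t ∈ A, t < μ₁ := fun t ht =>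
    lt_of_mul_lt_mul_right ((ht.2 ⟨φ, hφ⟩).trans_lt hlt') (sq_nonneg _)
  have h0 : (0 : ℝ) ∈ A := ⟨le_rfl, fun ψ => by
    rw [zero_mul]
    exact dirichletForm_self_nonneg U _⟩
  have hbdd : BddAbove A := ⟨μ₁, fun t ht => (hAlt t ht).le⟩
  have hmem : sSup A ∈ A := by
    refine ⟨le_csSup hbdd h0, fun ψ => ?_⟩
    have hcl : IsClosed {t : ℝ | t * ‖testToLp n U ψ‖ ^ 2 ≤ testForm n U ψ ψ} :=
      isClosed_le (by fun_prop) continuous_const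
    exact closure_minimal (fun t ht => ht.2 ψ) hcl (csSup_mem_closure ⟨0, h0⟩ hbdd)
  -- Being below `μ₁`, the supremum is not in the spectrum, so the operator shifted by it is onto;
  -- coercivity then produces a larger element of `A`.
  have hres : sSup A ∉ dirichletSpectrum (M := M) n U := fun h =>
    absurd (hμ₁ h) (not_le.2 (hAlt _ hmem))
  simp only [dirichletSpectrum, mem_ofPred_eq, not_not] at hres
  obtain ⟨c, hc, hcoer⟩ := exists_pos_coercive_of_surjective (testToLp (M := M) n U)
    (testForm n U) (fun x y => dirichletForm_comm U _ _) hmem.1 hmem.2 fun v => by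
      obtain ⟨u, ⟨φ, hφt, hφu, hφc, hφψ⟩, -⟩ := hres v
      refine ⟨u, fun k => ⟨φ k, hφt k⟩, ?_, hφc, fun ψ => ?_⟩
      · rw [Lp.tendsto_Lp_iff_tendsto_eLpNorm']
        refine hφu.congr fun k => eLpNorm_congr_ae ?_
        filter_upwards [coeFn_testToLp ⟨φ k, hφt k⟩] with x hx
        rw [Pi.sub_apply, hx]
      · rw [inner_testToLp]
        exact hφψ ψ ψ.2
  have : sSup A + c ∈ A := ⟨by linarith [hmem.1], hcoer⟩
  linarith [le_csSup hbdd this]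

end Spectrum

/-! ### Mollification in Euclidean space -/

section Mollification

open scoped Convolution in
/-- Mollification preserves a modulus of continuity that is homogeneous in the increment. -/
theorem exists_contDiff_approx_of_abs_sub_le {E : Type*} [NormedAddCommGroup E]
    [InnerProductSpace ℝ E] [FiniteDimensional ℝ E] [MeasurableSpace E] [BorelSpace E]
    {w : E → ℝ} {z₀ : E} {R : ℝ} (hR : 0 < R)
    (hw : ContinuousOn w (Metric.closedBall z₀ R)) {N : E → ℝ}
    (hN : ∀ (s : ℝ) h, N (s • h) = |s| * N h)
    (hwN : ∀ z ∈ Metric.closedBall z₀ R, ∀ z' ∈ Metric.closedBall z₀ R, |w z - w z'| ≤ N (z - z'))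
    {δ : ℝ} (hδ : 0 < δ) :
    ∃ v : E → ℝ, ContDiff ℝ ∞ v ∧ ∀ z ∈ Metric.ball z₀ (R / 2),
      |v z - w z| ≤ δ ∧ ∀ h, |fderiv ℝ v z h| ≤ N h := by
  have hK := isCompact_closedBall z₀ R
  obtain ⟨η, hη, hunif⟩ := Metric.uniformContinuousOn_iff.1
    (hK.uniformContinuousOn_of_continuous hw) δ hδ
  -- The bound by `η` makes the approximation `δ`-close; the bound by `R / 2` keeps translates of
  -- the half ball inside the ball where the hypothesis on `w` holds.
  set r := min η (R / 2) with hr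
  have hr0 : 0 < r := lt_min hη (by linarith)
  let φ : ContDiffBump (0 : E) := ⟨r / 2, r, by linarith, by linarith⟩
  have hφr : φ.rOut = r := rfl
  set g : E → ℝ := (Metric.closedBall z₀ R).indicator w with hg
  have hgi : Integrable g (volume : Measure E) :=
    (integrable_indicator_iff measurableSet_closedBall).2 (hw.integrableOn_compact hK)
  set v : E → ℝ := (φ.normed volume ⋆[ContinuousLinearMap.lsmul ℝ ℝ, volume] g) with hv
  have hvd : ContDiff ℝ ∞ v := φ.hasCompactSupport_normed.contDiff_convolution_left _
    φ.contDiff_normed hgi.locallyIntegrable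
  have hmem : ∀ z ∈ Metric.ball z₀ (R / 2), ∀ t ∈ Metric.ball (0 : E) r,
      z - t ∈ Metric.closedBall z₀ R := by
    intro z hz t ht
    rw [Metric.mem_ball, dist_eq_norm] at hz
    rw [mem_ball_zero_iff] at ht
    rw [Metric.mem_closedBall, dist_eq_norm]
    have h1 : z - t - z₀ = (z - z₀) - t := by abel
    rw [h1]
    have h2 := norm_sub_le (z - z₀) t
    have h3 : r ≤ R / 2 := min_le_right _ _
    linarith
  have hex : ConvolutionExists (φ.normed volume) g (ContinuousLinearMap.lsmul ℝ ℝ) volume :=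
    φ.hasCompactSupport_normed.convolutionExists_left _ φ.continuous_normed hgi.locallyIntegrable
  -- Translating both points by `t` does not change their difference, and the kernel has integral
  -- one, so averaging preserves the modulus `N`.
  have hlip : ∀ z ∈ Metric.ball z₀ (R / 2), ∀ z' ∈ Metric.ball z₀ (R / 2),
      |v z - v z'| ≤ N (z - z') := by
    intro z hz z' hz'
    have h1 : v z - v z' = ∫ t, φ.normed volume t * (g (z - t) - g (z' - t)) := by
      simp only [hv, convolution_def]
      rw [← integral_sub (hex z) (hex z')]
      refine integral_congr_ae (Eventually.of_forall fun t => ?_)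
      simp only [ContinuousLinearMap.lsmul_apply, smul_eq_mul]
      ring
    rw [h1, ← Real.norm_eq_abs]
    have h2 : ∀ t, ‖φ.normed volume t * (g (z - t) - g (z' - t))‖ ≤
        φ.normed volume t * N (z - z') := by
      intro t
      rw [norm_mul, Real.norm_of_nonneg (φ.nonneg_normed t)]
      by_cases ht : t ∈ Metric.ball (0 : E) r
      · refine mul_le_mul_of_nonneg_left ?_ (φ.nonneg_normed t)
        rw [hg, Set.indicator_of_mem (hmem z hz t ht), Set.indicator_of_mem (hmem z' hz' t ht)]
        refine (hwN _ (hmem z hz t ht) _ (hmem z' hz' t ht)).trans_eq ?_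
        rw [sub_sub_sub_cancel_right]
      · have h0 : φ.normed volume t = 0 := by
          rw [← Function.notMem_support, φ.support_normed_eq]
          exact ht
        rw [h0, zero_mul, zero_mul]
    refine (norm_integral_le_of_norm_le (φ.integrable_normed.mul_const _)
      (Eventually.of_forall h2)).trans_eq ?_
    rw [integral_mul_const, φ.integral_normed, one_mul]
  refine ⟨v, hvd, fun z hz => ⟨?_, fun h => ?_⟩⟩
  · have hzR : z ∈ Metric.closedBall z₀ R :=
      Metric.ball_subset_closedBall (Metric.ball_subset_ball (by linarith) hz)
    have h1 := φ.dist_normed_convolution_le (μ := (volume : Measure E)) (g := g) (x₀ := z) (ε := δ)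
      hgi.aestronglyMeasurable fun x hx => by
        have hxR : x ∈ Metric.closedBall z₀ R := by
          have := hmem z hz (z - x) (by rwa [mem_ball_zero_iff, ← dist_eq_norm, dist_comm])
          rwa [sub_sub_cancel] at this
        rw [hg, Set.indicator_of_mem hxR, Set.indicator_of_mem hzR]
        exact (hunif x hxR z hzR (lt_of_lt_of_le hx (min_le_left _ _))).le
    have h2 : g z = w z := Set.indicator_of_mem hzR _
    rw [h2, Real.dist_eq] at h1
    exact h1
  · have hd : HasDerivAt (fun s : ℝ => v (z + s • h)) (fderiv ℝ v z h) 0 := by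
      have h1 : HasFDerivAt v (fderiv ℝ v z) (z + (0 : ℝ) • h) := by
        rw [zero_smul, add_zero]
        exact (hvd.differentiable (by simp) z).hasFDerivAt
      have h2 : HasDerivAt (fun s : ℝ => z + s • h) h 0 := by
        simpa using ((hasDerivAt_id (0 : ℝ)).smul_const h).const_add z
      exact h1.comp_hasDerivAt 0 h2
    -- Nonnegativity of `N` is deduced: it dominates an absolute value on short increments, and
    -- homogeneity extends this to all.
    have hN0 : 0 ≤ N h := by
      have h1 := hwN z₀ (Metric.mem_closedBall_self hR.le) z₀ (Metric.mem_closedBall_self hR.le)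
      have h2 := hlip
      rcases eq_or_ne h 0 with rfl | hh
      · simpa using h1
      · have hpos : 0 < R / 4 / ‖h‖ := by positivity
        have h3 := hlip (z₀ + (R / 4 / ‖h‖) • h) (by
          rw [Metric.mem_ball, dist_self_add_left, norm_smul, Real.norm_of_nonneg hpos.le,
            div_mul_cancel₀ _ (norm_ne_zero_iff.2 hh)]
          linarith) z₀ (Metric.mem_ball_self (by linarith))
        rw [add_sub_cancel_left, hN, abs_of_pos hpos] at h3
        exact nonneg_of_mul_nonneg_right ((abs_nonneg _).trans h3) hpos
    have hev : ∀ᶠ s : ℝ in 𝓝 0, ‖v (z + s • h) - v (z + (0 : ℝ) • h)‖ ≤ N h * ‖s - 0‖ := by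
      have hc : ContinuousAt (fun s : ℝ => z + s • h) 0 := by fun_prop
      have : ∀ᶠ s : ℝ in 𝓝 0, z + s • h ∈ Metric.ball z₀ (R / 2) := by
        refine hc.preimage_mem_nhds (Metric.isOpen_ball.mem_nhds ?_)
        rwa [zero_smul, add_zero]
      filter_upwards [this] with s hs
      rw [zero_smul, add_zero, sub_zero]
      refine (hlip _ hs _ hz).trans_eq ?_
      rw [add_sub_cancel_left, hN, mul_comm]
      rfl
    exact hd.le_of_lip' hN0 hev

end Mollification

/-! ### The Riemannian norm in coordinates -/

section ChartNorm

variable [IsContMDiffRiemannianBundle (𝓡 n) ∞ (EuclideanSpace ℝ (Fin n))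
      (fun x : M => TangentSpace (𝓡 n) x)]

variable (n M) in
theorem isContinuousRiemannianBundle : IsContinuousRiemannianBundle (EuclideanSpace ℝ (Fin n))
    (fun x : M => TangentSpace (𝓡 n) x) := by
  obtain ⟨g, hg, h⟩ := IsContMDiffRiemannianBundle.exists_contMDiff (IB := 𝓡 n) (n := ∞)
    (F := EuclideanSpace ℝ (Fin n)) (E := fun x : M => TangentSpace (𝓡 n) x)
  exact ⟨g, hg.continuous, h⟩

theorem norm_tangent_congr {x y : M} (h : x = y) {v : TangentSpace (𝓡 n) x}
    {v' : TangentSpace (𝓡 n) y} (hv : @Eq (EuclideanSpace ℝ (Fin n)) v v') : ‖v‖ = ‖v'‖ := by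
  subst h
  obtain rfl : v = v' := hv
  rfl

/-- The Riemannian norm of the vector with coordinates `h` at the point with coordinates `z`. -/
def chartNorm (x₀ : M) (z h : EuclideanSpace ℝ (Fin n)) : ℝ :=
  ‖(mfderiv 𝓘(ℝ, EuclideanSpace ℝ (Fin n)) (𝓡 n) (extChartAt (𝓡 n) x₀).symm z h :
    TangentSpace (𝓡 n) ((extChartAt (𝓡 n) x₀).symm z))‖

theorem norm_symmL_eq_chartNorm (x₀ : M) {y : M} (hy : y ∈ (extChartAt (𝓡 n) x₀).source)
    (h : EuclideanSpace ℝ (Fin n)) :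
    ‖(trivializationAt (EuclideanSpace ℝ (Fin n)) (TangentSpace (𝓡 n)) x₀).symmL ℝ y h‖ =
      chartNorm x₀ (extChartAt (𝓡 n) x₀ y) h := by
  refine norm_tangent_congr ((extChartAt (𝓡 n) x₀).left_inv hy).symm ?_
  have h1 := TangentBundle.symmL_trivializationAt (I := 𝓡 n) (x₀ := x₀) (x := y)
    (by rwa [extChartAt_source] at hy)
  have h2 := congrArg (fun L : EuclideanSpace ℝ (Fin n) →L[ℝ] EuclideanSpace ℝ (Fin n) => L h) h1
  refine h2.trans ?_
  simp only [ModelWithCorners.range_eq_univ, mfderivWithin_univ]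
  rfl

/-- Continuity of the metric, uniform in the vector `h`. One direction makes a Lipschitz function
Lipschitz for the frozen norm at `x₀`; the other returns from the frozen norm to the norm at `y`. -/
theorem eventually_chartNorm_le (x₀ : M) {r : ℝ} (hr : 1 < r) :
    ∀ᶠ y in 𝓝 x₀, ∀ h, chartNorm x₀ (extChartAt (𝓡 n) x₀ y) h ≤
        r * chartNorm x₀ (extChartAt (𝓡 n) x₀ x₀) h ∧
      chartNorm x₀ (extChartAt (𝓡 n) x₀ x₀) h ≤
        r * chartNorm x₀ (extChartAt (𝓡 n) x₀ y) h := by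
  have := isContinuousRiemannianBundle n M
  filter_upwards [eventually_norm_symmL_trivializationAt_self_comp_lt (EuclideanSpace ℝ (Fin n))
      (fun x : M => TangentSpace (𝓡 n) x) x₀ hr,
    eventually_norm_symmL_trivializationAt_comp_self_lt (EuclideanSpace ℝ (Fin n))
      (fun x : M => TangentSpace (𝓡 n) x) x₀ hr, extChartAt_source_mem_nhds (I := 𝓡 n) x₀]
    with y hy1 hy2 hyS h
  have hx : x₀ ∈ (trivializationAt (EuclideanSpace ℝ (Fin n))
    (fun x : M => TangentSpace (𝓡 n) x) x₀).baseSet := FiberBundle.mem_baseSet_trivializationAt' x₀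
  have hy : y ∈ (trivializationAt (EuclideanSpace ℝ (Fin n))
    (fun x : M => TangentSpace (𝓡 n) x) x₀).baseSet := by
    rw [extChartAt_source] at hyS
    exact hyS
  constructor
  · have h1 := ContinuousLinearMap.le_of_opNorm_le _ hy2.le
      ((trivializationAt (EuclideanSpace ℝ (Fin n)) (TangentSpace (𝓡 n)) x₀).symmL ℝ x₀ h)
    rw [ContinuousLinearMap.comp_apply, Trivialization.continuousLinearMapAt_symmL _ hx,
      norm_symmL_eq_chartNorm x₀ hyS,
      norm_symmL_eq_chartNorm x₀ (mem_extChartAt_source x₀)] at h1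
    exact h1
  · have h1 := ContinuousLinearMap.le_of_opNorm_le _ hy1.le
      ((trivializationAt (EuclideanSpace ℝ (Fin n)) (TangentSpace (𝓡 n)) x₀).symmL ℝ y h)
    rw [ContinuousLinearMap.comp_apply, Trivialization.continuousLinearMapAt_symmL _ hy,
      norm_symmL_eq_chartNorm x₀ hyS,
      norm_symmL_eq_chartNorm x₀ (mem_extChartAt_source x₀)] at h1
    exact h1

/-- Converts errors measured in the Euclidean norm of the chart into Riemannian ones. -/
theorem exists_norm_le_mul_chartNorm (x₀ : M) :
    ∃ C > 0, ∀ᶠ y in 𝓝 x₀, ∀ h, ‖h‖ ≤ C * chartNorm x₀ (extChartAt (𝓡 n) x₀ y) h := by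
  have := isContinuousRiemannianBundle n M
  obtain ⟨C, hC, hev⟩ := eventually_norm_trivializationAt_lt (EuclideanSpace ℝ (Fin n))
      (fun x : M => TangentSpace (𝓡 n) x) x₀
  refine ⟨C, hC, ?_⟩
  filter_upwards [hev, extChartAt_source_mem_nhds (I := 𝓡 n) x₀] with y hy1 hyS h
  have hy : y ∈ (trivializationAt (EuclideanSpace ℝ (Fin n))
    (fun x : M => TangentSpace (𝓡 n) x) x₀).baseSet := by
    rw [extChartAt_source] at hyS
    exact hyS
  have h1 := ContinuousLinearMap.le_of_opNorm_le _ hy1.le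
      ((trivializationAt (EuclideanSpace ℝ (Fin n)) (TangentSpace (𝓡 n)) x₀).symmL ℝ y h)
  rw [Trivialization.continuousLinearMapAt_symmL _ hy, norm_symmL_eq_chartNorm x₀ hyS] at h1
  exact h1

end ChartNorm

/-! ### Local smooth approximation -/

section LocalApproximation

theorem chartNorm_smul (x₀ : M) (z : EuclideanSpace ℝ (Fin n)) (s : ℝ)
    (h : EuclideanSpace ℝ (Fin n)) : chartNorm x₀ z (s • h) = |s| * chartNorm x₀ z h := by
  have h1 : (mfderiv 𝓘(ℝ, EuclideanSpace ℝ (Fin n)) (𝓡 n) (extChartAt (𝓡 n) x₀).symm z (s • h) :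
      TangentSpace (𝓡 n) ((extChartAt (𝓡 n) x₀).symm z)) =
    s • (mfderiv 𝓘(ℝ, EuclideanSpace ℝ (Fin n)) (𝓡 n) (extChartAt (𝓡 n) x₀).symm z h :
      TangentSpace (𝓡 n) ((extChartAt (𝓡 n) x₀).symm z)) := map_smul _ _ _
  rw [chartNorm, chartNorm, h1, norm_smul, Real.norm_eq_abs]

theorem chartNorm_nonneg (x₀ : M) (z h : EuclideanSpace ℝ (Fin n)) : 0 ≤ chartNorm x₀ z h :=
  norm_nonneg _

theorem exists_closedBall_of_eventually (x₀ : M) {p : EuclideanSpace ℝ (Fin n) → Prop}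
    (hp : ∀ᶠ y in 𝓝 x₀, p (extChartAt (𝓡 n) x₀ y)) :
    ∃ R > 0, Metric.closedBall (extChartAt (𝓡 n) x₀ x₀) R ⊆ (extChartAt (𝓡 n) x₀).target ∧
      ∀ z ∈ Metric.closedBall (extChartAt (𝓡 n) x₀ x₀) R, p z := by
  have h1 : ∀ᶠ z in 𝓝 (extChartAt (𝓡 n) x₀ x₀), z ∈ (extChartAt (𝓡 n) x₀).target :=
    (isOpen_target x₀).mem_nhds (mem_extChartAt_target x₀)
  have h2 : Tendsto (extChartAt (𝓡 n) x₀).symm (𝓝 (extChartAt (𝓡 n) x₀ x₀)) (𝓝 x₀) := by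
    have := continuousAt_extChartAt_symm (I := 𝓡 n) x₀
    rwa [ContinuousAt, extChartAt_to_inv] at this
  have h3 : ∀ᶠ z in 𝓝 (extChartAt (𝓡 n) x₀ x₀), z ∈ (extChartAt (𝓡 n) x₀).target ∧ p z := by
    filter_upwards [h1, h2.eventually hp] with z hz hpz
    rw [(extChartAt (𝓡 n) x₀).right_inv hz] at hpz
    exact ⟨hz, hpz⟩
  obtain ⟨R, hR, hsub⟩ := Metric.nhds_basis_closedBall.mem_iff.1 h3
  exact ⟨R, hR, fun z hz => (hsub hz).1, fun z hz => (hsub hz).2⟩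

theorem mdifferentiableAt_symm (x₀ : M) {z : EuclideanSpace ℝ (Fin n)}
    (hz : z ∈ (extChartAt (𝓡 n) x₀).target) :
    MDifferentiableAt 𝓘(ℝ, EuclideanSpace ℝ (Fin n)) (𝓡 n) (extChartAt (𝓡 n) x₀).symm z := by
  have := mdifferentiableWithinAt_extChartAt_symm (I := 𝓡 n) hz
  simpa [mdifferentiableWithinAt_univ] using this

/-- Apply the bound to the coordinate vector representing the gradient itself: `‖∇u‖² ≤ c ‖∇u‖`. -/
theorem norm_grad_le_of_chartNorm (x₀ : M) {z : EuclideanSpace ℝ (Fin n)}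
    (hz : z ∈ (extChartAt (𝓡 n) x₀).target) {u : M → ℝ}
    (hu : MDifferentiableAt (𝓡 n) 𝓘(ℝ, ℝ) u ((extChartAt (𝓡 n) x₀).symm z)) {c : ℝ} (hc : 0 ≤ c)
    (h : ∀ h, |fderiv ℝ (u ∘ (extChartAt (𝓡 n) x₀).symm) z h| ≤ c * chartNorm x₀ z h) :
    ‖grad (n := n) u ((extChartAt (𝓡 n) x₀).symm z)‖ ≤ c := by
  set e := extChartAt (𝓡 n) x₀ with he
  obtain ⟨v, hv⟩ := (isInvertible_mfderiv_symm x₀ hz).surjective (grad (n := n) u (e.symm z))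
  have h1 := mdifferentiableAt_symm x₀ hz
  have h2 := congrArg (fun L : EuclideanSpace ℝ (Fin n) →L[ℝ] ℝ => L v) (mfderiv_comp z hu h1)
  have h3 : fderiv ℝ (u ∘ e.symm) z v = mfderiv (𝓡 n) 𝓘(ℝ, ℝ) u (e.symm z)
      (mfderiv 𝓘(ℝ, EuclideanSpace ℝ (Fin n)) (𝓡 n) e.symm z v) := by
    rw [← mfderiv_eq_fderiv]
    exact h2
  have h4 : fderiv ℝ (u ∘ e.symm) z v = ‖grad (n := n) u (e.symm z)‖ ^ 2 := by
    rw [h3, ← real_inner_self_eq_norm_sq, inner_grad]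
    exact congrArg _ hv
  have h5 : chartNorm x₀ z v = ‖grad (n := n) u (e.symm z)‖ := congrArg norm hv
  have h6 := h v
  rw [h4, h5, abs_of_nonneg (sq_nonneg _)] at h6
  by_contra hlt
  push Not at hlt
  nlinarith

section

variable [IsContMDiffRiemannianBundle (𝓡 n) ∞ (EuclideanSpace ℝ (Fin n))
      (fun x : M => TangentSpace (𝓡 n) x)]

/-- The distance is at most the length of the image of the straight coordinate segment. -/
theorem dist_symm_le_mul_chartNorm [IsRiemannianManifold (𝓡 n) M] (x₀ : M) {R r : ℝ} (hr : 0 ≤ r)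
    (hT : Metric.closedBall (extChartAt (𝓡 n) x₀ x₀) R ⊆ (extChartAt (𝓡 n) x₀).target)
    (hN : ∀ z ∈ Metric.closedBall (extChartAt (𝓡 n) x₀ x₀) R, ∀ h,
      chartNorm x₀ z h ≤ r * chartNorm x₀ (extChartAt (𝓡 n) x₀ x₀) h)
    {z z' : EuclideanSpace ℝ (Fin n)} (hz : z ∈ Metric.closedBall (extChartAt (𝓡 n) x₀ x₀) R)
    (hz' : z' ∈ Metric.closedBall (extChartAt (𝓡 n) x₀ x₀) R) :
    dist ((extChartAt (𝓡 n) x₀).symm z) ((extChartAt (𝓡 n) x₀).symm z') ≤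
      r * chartNorm x₀ (extChartAt (𝓡 n) x₀ x₀) (z - z') := by
  set e := extChartAt (𝓡 n) x₀ with he
  set η : ℝ → EuclideanSpace ℝ (Fin n) := fun t => z' + t • (z - z') with hη
  have hηd : ∀ t, HasDerivAt η (z - z') t := fun t => by
    have := ((hasDerivAt_id t).smul_const (z - z')).const_add z'
    rwa [one_smul] at this
  have hηmem : ∀ t ∈ Icc (0 : ℝ) 1, η t ∈ Metric.closedBall (e x₀) R := by
    intro t ht
    have := (convex_closedBall (e x₀) R).add_smul_sub_mem hz' hz ht
    exact this
  have hηs : ContMDiffOn 𝓘(ℝ, ℝ) 𝓘(ℝ, EuclideanSpace ℝ (Fin n)) 1 η (Icc 0 1) := by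
    rw [contMDiffOn_iff_contDiffOn]
    exact ContDiff.contDiffOn (by fun_prop)
  have hγs : ContMDiffOn 𝓘(ℝ, ℝ) (𝓡 n) 1 (e.symm ∘ η) (Icc 0 1) :=
    (contMDiffOn_extChartAt_symm (n := 1) x₀).comp hηs fun t ht => hT (hηmem t ht)
  have h1 : edist (e.symm z') (e.symm z) ≤ Manifold.pathELength (𝓡 n) (e.symm ∘ η) 0 1 := by
    rw [IsRiemannianManifold.out (I := 𝓡 n)]
    exact Manifold.riemannianEDist_le_pathELength hγs (by simp [hη]) (by simp [hη]) zero_le_one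
  have h2 : Manifold.pathELength (𝓡 n) (e.symm ∘ η) 0 1 ≤
      ENNReal.ofReal (r * chartNorm x₀ (e x₀) (z - z')) := by
    rw [Manifold.pathELength_eq_lintegral_mfderiv_Icc]
    have hle : ∀ t ∈ Icc (0 : ℝ) 1, ‖mfderiv 𝓘(ℝ, ℝ) (𝓡 n) (e.symm ∘ η) t 1‖ₑ ≤
        ENNReal.ofReal (r * chartNorm x₀ (e x₀) (z - z')) := by
      intro t ht
      have hd1 := mdifferentiableAt_symm x₀ (hT (hηmem t ht))
      have hd2 := hd1.hasMFDerivAt.comp t (hηd t).hasFDerivAt.hasMFDerivAt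
      have hd3 : mfderiv 𝓘(ℝ, ℝ) (𝓡 n) (e.symm ∘ η) t 1 =
          mfderiv 𝓘(ℝ, EuclideanSpace ℝ (Fin n)) (𝓡 n) e.symm (η t) (z - z') := by
        rw [hd2.mfderiv]
        refine congrArg (mfderiv 𝓘(ℝ, EuclideanSpace ℝ (Fin n)) (𝓡 n) e.symm (η t)) ?_
        exact one_smul ℝ (z - z')
      have hd4 : ‖mfderiv 𝓘(ℝ, ℝ) (𝓡 n) (e.symm ∘ η) t 1‖ = chartNorm x₀ (η t) (z - z') :=
        congrArg norm hd3
      rw [← ofReal_norm, hd4]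
      exact ENNReal.ofReal_le_ofReal (hN _ (hηmem t ht) _)
    refine (setLIntegral_mono' measurableSet_Icc hle).trans ?_
    rw [setLIntegral_const]
    simp
  have h3 := h1.trans h2
  rw [edist_dist, ENNReal.ofReal_le_ofReal_iff (mul_nonneg hr (chartNorm_nonneg _ _ _)),
    dist_comm] at h3
  exact h3

theorem contMDiffOn_comp_extChartAt (x₀ : M) {v : EuclideanSpace ℝ (Fin n) → ℝ}
    (hv : ContDiff ℝ ∞ v) : ContMDiffOn (𝓡 n) 𝓘(ℝ, ℝ) ∞ (v ∘ extChartAt (𝓡 n) x₀)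
      (extChartAt (𝓡 n) x₀).source := by
  rw [extChartAt_source]
  exact hv.contMDiff.comp_contMDiffOn contMDiffOn_extChartAt

theorem isOpen_chartBall (x₀ : M) (R : ℝ) : IsOpen ((extChartAt (𝓡 n) x₀).source ∩
    extChartAt (𝓡 n) x₀ ⁻¹' Metric.ball (extChartAt (𝓡 n) x₀ x₀) R) :=
  (continuousOn_extChartAt x₀).isOpen_inter_preimage (isOpen_extChartAt_source x₀)
    Metric.isOpen_ball

/-- A function with Lipschitz constant one has, near each point, smooth approximations whose
gradient has norm at most `c`, for any given `c > 1`. -/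
theorem exists_local_approx_of_lipschitz [IsRiemannianManifold (𝓡 n) M] {u : M → ℝ}
    (hu : ∀ x y, |u x - u y| ≤ dist x y) {c : ℝ} (hc : 1 < c) (x₀ : M) :
    ∃ V : Set M, IsOpen V ∧ x₀ ∈ V ∧ ∀ δ > 0, ∃ v : M → ℝ, ContMDiffOn (𝓡 n) 𝓘(ℝ, ℝ) ∞ v V ∧
      ∀ y ∈ V, |v y - u y| ≤ δ ∧ ‖grad (n := n) v y‖ ≤ c := by
  set e := extChartAt (𝓡 n) x₀ with he
  -- The factor `√c` is lost twice: in freezing the norm at `x₀`, and in returning to the norm at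
  -- `y`.
  have hr : 1 < √c := by
    rw [Real.lt_sqrt zero_le_one]
    linarith
  have hr0 : 0 ≤ √c := Real.sqrt_nonneg c
  obtain ⟨R, hR, hT, hN⟩ := exists_closedBall_of_eventually x₀
    (p := fun z => ∀ h, chartNorm x₀ z h ≤ √c * chartNorm x₀ (e x₀) h ∧
      chartNorm x₀ (e x₀) h ≤ √c * chartNorm x₀ z h) (eventually_chartNorm_le x₀ hr)
  refine ⟨e.source ∩ e ⁻¹' Metric.ball (e x₀) (R / 2), isOpen_chartBall x₀ _,
    ⟨mem_extChartAt_source x₀, Metric.mem_ball_self (by linarith)⟩, fun δ hδ => ?_⟩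
  have hlip : ∀ z ∈ Metric.closedBall (e x₀) R, ∀ z' ∈ Metric.closedBall (e x₀) R,
      |(u ∘ e.symm) z - (u ∘ e.symm) z'| ≤ √c * chartNorm x₀ (e x₀) (z - z') :=
    fun z hz z' hz' => (hu _ _).trans
      (dist_symm_le_mul_chartNorm x₀ hr0 hT (fun z hz h => (hN z hz h).1) hz hz')
  have huc : Continuous u := by
    refine (LipschitzWith.of_dist_le_mul (K := 1) fun x y => ?_).continuous
    rw [Real.dist_eq, NNReal.coe_one, one_mul]
    exact hu x y
  have hwc : ContinuousOn (u ∘ e.symm) (Metric.closedBall (e x₀) R) :=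
    huc.comp_continuousOn ((continuousOn_extChartAt_symm x₀).mono hT)
  obtain ⟨v, hv, hvu⟩ := exists_contDiff_approx_of_abs_sub_le hR hwc
    (N := fun h => √c * chartNorm x₀ (e x₀) h)
    (fun s h => by simp only [chartNorm_smul]; ring) hlip hδ
  refine ⟨v ∘ e, (contMDiffOn_comp_extChartAt x₀ hv).mono inter_subset_left, fun y hy => ?_⟩
  obtain ⟨h1, h2⟩ := hvu (e y) hy.2
  have hyT : e y ∈ e.target := e.map_source hy.1
  have hsymm : e.symm (e y) = y := e.left_inv hy.1
  refine ⟨by rwa [Function.comp_apply, hsymm] at h1, ?_⟩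
  have hd : MDifferentiableAt (𝓡 n) 𝓘(ℝ, ℝ) (v ∘ e) (e.symm (e y)) := by
    rw [hsymm]
    exact ((contMDiffOn_comp_extChartAt x₀ hv).contMDiffAt
      ((isOpen_extChartAt_source x₀).mem_nhds hy.1)).mdifferentiableAt (by simp)
  have h3 := norm_grad_le_of_chartNorm x₀ hyT hd (c := c) (by linarith) fun h => by
    have h4 : fderiv ℝ ((v ∘ e) ∘ e.symm) (e y) = fderiv ℝ v (e y) := by
      refine Filter.EventuallyEq.fderiv_eq ?_
      filter_upwards [(isOpen_target (n := n) x₀).mem_nhds hyT] with z hz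
      simp only [Function.comp_apply]
      rw [e.right_inv hz]
    rw [← he, h4]
    refine (h2 h).trans ?_
    have h5 := (hN (e y) (Metric.ball_subset_closedBall
      (Metric.ball_subset_ball (by linarith) hy.2)) h).2
    calc √c * chartNorm x₀ (e x₀) h ≤ √c * (√c * chartNorm x₀ (e y) h) :=
          mul_le_mul_of_nonneg_left h5 hr0
      _ = c * chartNorm x₀ (e y) h := by
          rw [← mul_assoc, Real.mul_self_sqrt (by linarith)]
  rwa [← he, hsymm] at h3

/-- A continuously differentiable function has, near each point, smooth approximations whose
gradient is close to its gradient. -/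
theorem exists_local_approx_of_contMDiff {u : M → ℝ} (hu : ContMDiff (𝓡 n) 𝓘(ℝ, ℝ) 1 u) {c : ℝ}
    (hc : 0 < c) (x₀ : M) :
    ∃ V : Set M, IsOpen V ∧ x₀ ∈ V ∧ ∀ δ > 0, ∃ v : M → ℝ, ContMDiffOn (𝓡 n) 𝓘(ℝ, ℝ) ∞ v V ∧
      ∀ y ∈ V, |v y - u y| ≤ δ ∧ ‖grad (n := n) v y - grad (n := n) u y‖ ≤ c := by
  set e := extChartAt (𝓡 n) x₀ with he
  obtain ⟨C, hC, hCev⟩ := exists_norm_le_mul_chartNorm (n := n) x₀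
  set w : EuclideanSpace ℝ (Fin n) → ℝ := u ∘ e.symm with hw
  have hT' := isOpen_target (n := n) x₀
  have hwd : ContDiffOn ℝ 1 w e.target := by
    rw [← contMDiffOn_iff_contDiffOn]
    exact hu.comp_contMDiffOn (contMDiffOn_extChartAt_symm x₀)
  have hx₀T : e x₀ ∈ e.target := mem_extChartAt_target x₀
  set L := fderiv ℝ w (e x₀) with hL
  -- Two errors of size `b ‖h‖` occur, one from mollifying `w - L` and one from the variation of the
  -- derivative of `w`; together they give `2 b C = c`.
  set b := c / (2 * C) with hb
  have hb0 : 0 < b := by positivity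
  have hstrict : HasStrictFDerivAt w L (e x₀) :=
    (hwd.contDiffAt (hT'.mem_nhds hx₀T)).hasStrictFDerivAt one_ne_zero
  obtain ⟨s, hs, hlips⟩ := hstrict.approximates_deriv_on_nhds (c := ⟨b, hb0.le⟩) (Or.inr hb0)
  have hcont : ∀ᶠ z in 𝓝 (e x₀), ‖fderiv ℝ w z - L‖ < b := by
    have h1 : ContinuousAt (fun z => fderiv ℝ w z) (e x₀) :=
      (hwd.continuousOn_fderiv_of_isOpen hT' le_rfl).continuousAt (hT'.mem_nhds hx₀T)
    have h2 := h1.eventually (Metric.ball_mem_nhds _ hb0)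
    filter_upwards [h2] with z hz
    rwa [dist_eq_norm] at hz
  obtain ⟨R, hR, hT, hN⟩ := exists_closedBall_of_eventually x₀
    (p := fun z => (∀ h, ‖h‖ ≤ C * chartNorm x₀ z h) ∧ z ∈ s ∧ ‖fderiv ℝ w z - L‖ < b)
    (hCev.and (((continuousAt_extChartAt x₀).eventually hs).and
      ((continuousAt_extChartAt x₀).eventually hcont)))
  refine ⟨e.source ∩ e ⁻¹' Metric.ball (e x₀) (R / 2), isOpen_chartBall x₀ _,
    ⟨mem_extChartAt_source x₀, Metric.mem_ball_self (by linarith)⟩, fun δ hδ => ?_⟩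
  -- Only `w - L` is mollified: strict differentiability makes it `b`-Lipschitz near the centre, and
  -- the linear map `L`, already smooth, is added back.
  have hwc : ContinuousOn (fun z => w z - L z) (Metric.closedBall (e x₀) R) :=
    (hwd.continuousOn.mono hT).sub L.continuous.continuousOn
  obtain ⟨v, hv, hvu⟩ := exists_contDiff_approx_of_abs_sub_le hR hwc
    (N := fun h => b * ‖h‖) (fun s h => by rw [norm_smul, Real.norm_eq_abs]; ring)
    (fun z hz z' hz' => by
      have h1 := hlips z (hN z hz).2.1 z' (hN z' hz').2.1
      rw [map_sub, Real.norm_eq_abs] at h1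
      rw [show w z - L z - (w z' - L z') = w z - w z' - (L z - L z') by ring]
      exact h1) hδ
  have hvL : ContDiff ℝ ∞ (fun z => v z + L z) := hv.add L.contDiff
  refine ⟨(fun z => v z + L z) ∘ e, (contMDiffOn_comp_extChartAt x₀ hvL).mono inter_subset_left,
    fun y hy => ?_⟩
  obtain ⟨h1, h2⟩ := hvu (e y) hy.2
  have hyT : e y ∈ e.target := e.map_source hy.1
  have hsymm : e.symm (e y) = y := e.left_inv hy.1
  constructor
  · rw [show v (e y) - (w (e y) - L (e y)) = v (e y) + L (e y) - w (e y) by ring, hw,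
      Function.comp_apply, hsymm] at h1
    exact h1
  have hd : MDifferentiableAt (𝓡 n) 𝓘(ℝ, ℝ) ((fun z => v z + L z) ∘ e) y :=
    ((contMDiffOn_comp_extChartAt x₀ hvL).contMDiffAt
      ((isOpen_extChartAt_source x₀).mem_nhds hy.1)).mdifferentiableAt (by simp)
  have hdu : MDifferentiableAt (𝓡 n) 𝓘(ℝ, ℝ) u y := hu.mdifferentiableAt one_ne_zero
  have h3 := norm_grad_le_of_chartNorm x₀ hyT (u := (fun z => v z + L z) ∘ e - u)
    (by rw [← he, hsymm]; exact hd.sub hdu) hc.le fun h => by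
    have h4 : fderiv ℝ (((fun z => v z + L z) ∘ e - u) ∘ e.symm) (e y) =
        fderiv ℝ v (e y) + L - fderiv ℝ w (e y) := by
      have h5 : ((fun z => v z + L z) ∘ e - u) ∘ e.symm =ᶠ[𝓝 (e y)]
          (fun z => v z + L z) - w := by
        filter_upwards [hT'.mem_nhds hyT] with z hz
        simp only [Function.comp_apply, Pi.sub_apply, hw]
        rw [e.right_inv hz]
      rw [h5.fderiv_eq]
      exact (((hv.differentiable (by simp) (e y)).hasFDerivAt.add L.hasFDerivAt).sub
        ((hwd.contDiffAt (hT'.mem_nhds hyT)).differentiableAt one_ne_zero).hasFDerivAt).fderiv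
    obtain ⟨h6, -, h7⟩ := hN (e y) (Metric.ball_subset_closedBall
      (Metric.ball_subset_ball (by linarith) hy.2))
    rw [← he, h4]
    have h8 : |(fderiv ℝ w (e y) - L) h| ≤ b * ‖h‖ := by
      rw [← Real.norm_eq_abs]
      exact ContinuousLinearMap.le_of_opNorm_le _ h7.le h
    have h9 : (fderiv ℝ v (e y) + L - fderiv ℝ w (e y)) h =
        fderiv ℝ v (e y) h - (fderiv ℝ w (e y) - L) h := by
      simp only [sub_apply, add_apply]
      ring
    rw [h9]
    calc |fderiv ℝ v (e y) h - (fderiv ℝ w (e y) - L) h|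
        ≤ |fderiv ℝ v (e y) h| + |(fderiv ℝ w (e y) - L) h| := abs_sub _ _
      _ ≤ b * ‖h‖ + b * ‖h‖ := add_le_add (h2 h) h8
      _ = 2 * b * ‖h‖ := by ring
      _ ≤ 2 * b * (C * chartNorm x₀ (e y) h) := mul_le_mul_of_nonneg_left (h6 h) (by positivity)
      _ = c * chartNorm x₀ (e y) h := by
          rw [hb]
          field_simp
  rw [← he, hsymm, grad_sub hd hdu] at h3
  exact h3

end

end LocalApproximation

/-! ### Gluing local approximations -/

theorem grad_finsetSum {ι : Type*} (t : Finset ι) {u : ι → M → ℝ} {x : M}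
    (hu : ∀ i ∈ t, MDifferentiableAt (𝓡 n) 𝓘(ℝ, ℝ) (u i) x) :
    grad (n := n) (fun y => ∑ i ∈ t, u i y) x = ∑ i ∈ t, grad (n := n) (u i) x := by
  classical
  have h : MDifferentiableAt (𝓡 n) 𝓘(ℝ, ℝ) (fun y => ∑ i ∈ t, u i y) x ∧
      grad (n := n) (fun y => ∑ i ∈ t, u i y) x = ∑ i ∈ t, grad (n := n) (u i) x := by
    induction t using Finset.induction_on with
    | empty =>
      simp only [Finset.sum_empty]
      exact ⟨mdifferentiableAt_const, grad_eq_zero_of_notMem_tsupport (by simp [tsupport])⟩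
    | insert i t hi ih =>
      obtain ⟨h1, h2⟩ := ih fun j hj => hu j (Finset.mem_insert_of_mem hj)
      have h3 := hu i (Finset.mem_insert_self i t)
      have h4 : (fun y => ∑ j ∈ insert i t, u j y) = u i + fun y => ∑ j ∈ t, u j y := by
        funext y
        rw [Finset.sum_insert hi]
        rfl
      rw [h4, Finset.sum_insert hi, grad_add h3 h1, h2]
      exact ⟨h3.add h1, rfl⟩
  exact h.2

theorem grad_congr {u w : M → ℝ} {x : M} (h : u =ᶠ[𝓝 x] w) :
    grad (n := n) u x = grad (n := n) w x := by
  rw [grad, grad, h.mfderiv_eq]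

theorem grad_const (c : ℝ) (x : M) : grad (n := n) (fun _ : M => c) x = 0 := by
  have h : mfderiv (𝓡 n) 𝓘(ℝ, ℝ) (fun _ : M => c) x = 0 := mfderiv_const
  rw [grad, h]
  exact map_zero _

/-- The product rule for a function defined on a neighbourhood of the support of a cutoff. -/
theorem mdifferentiableAt_and_grad_mul_of_tsupport {V : Set M} (hV : IsOpen V) {χ v : M → ℝ}
    (hχ : ContMDiff (𝓡 n) 𝓘(ℝ, ℝ) 1 χ) (hs : tsupport χ ⊆ V)
    (hv : ContMDiffOn (𝓡 n) 𝓘(ℝ, ℝ) 1 v V) (x : M) :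
    MDifferentiableAt (𝓡 n) 𝓘(ℝ, ℝ) (χ * v) x ∧
      grad (n := n) (χ * v) x = χ x • grad (n := n) v x + v x • grad (n := n) χ x := by
  by_cases hx : x ∈ tsupport χ
  · have h1 := hχ.mdifferentiableAt (x := x) one_ne_zero
    have h2 := (hv.contMDiffAt (hV.mem_nhds (hs hx))).mdifferentiableAt one_ne_zero
    exact ⟨h1.mul h2, grad_mul h1 h2⟩
  · have h1 : χ * v =ᶠ[𝓝 x] fun _ => (0 : ℝ) := by
      filter_upwards [notMem_tsupport_iff_eventuallyEq.1 hx] with y hy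
      rw [Pi.mul_apply, hy, Pi.zero_apply, zero_mul]
    refine ⟨mdifferentiableAt_const.congr_of_eventuallyEq h1, ?_⟩
    rw [grad_congr h1, grad_const, grad_eq_zero_of_notMem_tsupport hx, image_eq_zero_of_notMem_tsupport hx,
      zero_smul, smul_zero, add_zero]

theorem contMDiff_mul_of_tsupport {V : Set M} (hV : IsOpen V) {k : ℕ∞} {χ v : M → ℝ}
    (hχ : ContMDiff (𝓡 n) 𝓘(ℝ, ℝ) k χ) (hs : tsupport χ ⊆ V)
    (hv : ContMDiffOn (𝓡 n) 𝓘(ℝ, ℝ) k v V) : ContMDiff (𝓡 n) 𝓘(ℝ, ℝ) k (χ * v) := by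
  intro x
  by_cases hx : x ∈ tsupport χ
  · exact (hχ x).mul (hv.contMDiffAt (hV.mem_nhds (hs hx)))
  · refine (contMDiff_const (c := (0 : ℝ)) x).congr_of_eventuallyEq ?_
    filter_upwards [notMem_tsupport_iff_eventuallyEq.1 hx] with y hy
    rw [Pi.mul_apply, hy, Pi.zero_apply, zero_mul]

/-- Local approximations with small errors can be glued to a smooth function. -/
theorem exists_contMDiff_approx_of_local [SigmaCompactSpace M]
    [IsContMDiffRiemannianBundle (𝓡 n) ∞ (EuclideanSpace ℝ (Fin n))
      (fun x : M => TangentSpace (𝓡 n) x)]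
    {K : Set M} (hK : IsCompact K)
    {u : M → ℝ} (Y : ∀ x : M, TangentSpace (𝓡 n) x) {c : ℝ} (V : M → Set M)
    (hVo : ∀ i, IsOpen (V i)) (hV : ∀ i, i ∈ V i) (S : Set M)
    (hloc : ∀ i, ∀ δ > 0, ∃ v : M → ℝ, ContMDiffOn (𝓡 n) 𝓘(ℝ, ℝ) ∞ v (V i) ∧ (i ∉ S → v = 0) ∧
      ∀ x ∈ V i, |v x - u x| ≤ δ ∧ ‖grad (n := n) v x - Y x‖ ≤ c) {δ : ℝ} (hδ : 0 < δ) :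
    ∃ w : M → ℝ, ContMDiff (𝓡 n) 𝓘(ℝ, ℝ) ∞ w ∧ Function.support w ⊆ ⋃ i ∈ S, V i ∧
      ∀ x ∈ K, |w x - u x| ≤ δ ∧ ‖grad (n := n) w x - Y x‖ ≤ c + δ := by
  obtain ⟨t, χ, hχ, hχ0, hχs, hχ1⟩ := exists_finite_partition (n := n) hK V hVo hV
  have hχ' : ∀ i, ContMDiff (𝓡 n) 𝓘(ℝ, ℝ) 1 (χ i) :=
    fun i => (hχ i).of_le (by exact_mod_cast le_top)
  have hg : Continuous fun x => ∑ i ∈ t, ‖grad (n := n) (χ i) x‖ := by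
    refine continuous_finsetSum t fun i _ => ?_
    have h1 := (continuous_inner_grad_of_tsupport isOpen_univ (hχ' i).contMDiffOn (hχ' i)
      (subset_univ _)).sqrt
    refine h1.congr fun x => ?_
    rw [real_inner_self_eq_norm_sq, Real.sqrt_sq (norm_nonneg _)]
  obtain ⟨B, hB⟩ := hK.exists_bound_of_continuousOn hg.continuousOn
  have hB' : ∀ x ∈ K, ∑ i ∈ t, ‖grad (n := n) (χ i) x‖ ≤ |B| := fun x hx =>
    (le_abs_self _).trans ((hB x hx).trans (le_abs_self _))
  -- The gluing error `∑ (v i - u) ∇χ i` has norm at most `ε |B| ≤ δ`.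
  set ε := δ / (|B| + 1) with hε
  have hε0 : 0 < ε := by positivity
  have hεδ : ε ≤ δ := div_le_self hδ.le (by linarith [abs_nonneg B])
  choose v hv hv0 hvu using fun i => hloc i ε hε0
  have hprod := fun i x => mdifferentiableAt_and_grad_mul_of_tsupport (hVo i) (hχ' i) (hχs i)
    ((hv i).of_le (by exact_mod_cast le_top)) x
  refine ⟨fun x => ∑ i ∈ t, (χ i * v i) x, ?_, ?_, fun x hx => ?_⟩
  · exact contMDiff_finsetSum fun i _ => contMDiff_mul_of_tsupport (hVo i) (hχ i) (hχs i) (hv i)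
  · intro x hx
    obtain ⟨i, -, hi⟩ := Finset.exists_ne_zero_of_sum_ne_zero hx
    have hi1 : χ i x ≠ 0 := left_ne_zero_of_mul hi
    have hi2 : v i x ≠ 0 := right_ne_zero_of_mul hi
    refine mem_iUnion₂.2 ⟨i, ?_, hχs i (subset_tsupport _ hi1)⟩
    by_contra hiS
    exact hi2 (by rw [hv0 i hiS]; rfl)
  have hsum : ∑ i ∈ t, χ i x = 1 := (hχ1 x hx).self_of_nhds
  have hgsum : ∑ i ∈ t, grad (n := n) (χ i) x = 0 := by
    rw [← grad_finsetSum t fun i _ => (hχ' i).mdifferentiableAt one_ne_zero,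
      grad_congr (hχ1 x hx), grad_const]
  constructor
  · have h1 : ∑ i ∈ t, (χ i * v i) x - u x = ∑ i ∈ t, χ i x * (v i x - u x) := by
      simp only [mul_sub, Finset.sum_sub_distrib, ← Finset.sum_mul, hsum, one_mul, Pi.mul_apply]
    rw [h1]
    calc |∑ i ∈ t, χ i x * (v i x - u x)| ≤ ∑ i ∈ t, |χ i x * (v i x - u x)| :=
          Finset.abs_sum_le_sum_abs _ _
      _ ≤ ∑ i ∈ t, χ i x * ε := by
          refine Finset.sum_le_sum fun i _ => ?_
          by_cases hxi : x ∈ tsupport (χ i)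
          · rw [abs_mul, abs_of_nonneg (hχ0 i x)]
            exact mul_le_mul_of_nonneg_left (hvu i x (hχs i hxi)).1 (hχ0 i x)
          · rw [image_eq_zero_of_notMem_tsupport hxi]
            simp
      _ = ε := by rw [← Finset.sum_mul, hsum, one_mul]
      _ ≤ δ := hεδ
  -- Since `∑ χ i = 1` and `∑ ∇χ i = 0`, both `Y` and `u` can be distributed over the patches.
  · have h1 : grad (n := n) (fun x => ∑ i ∈ t, (χ i * v i) x) x - Y x =
        ∑ i ∈ t, (χ i x • (grad (n := n) (v i) x - Y x) + (v i x - u x) • grad (n := n) (χ i) x) := by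
      rw [grad_finsetSum t fun i _ => (hprod i x).1]
      simp only [smul_sub, sub_smul, Finset.sum_add_distrib, Finset.sum_sub_distrib,
        ← Finset.sum_smul, ← Finset.smul_sum, hsum, hgsum, one_smul, smul_zero, sub_zero]
      rw [Finset.sum_congr rfl fun i _ => (hprod i x).2, Finset.sum_add_distrib]
      abel
    rw [h1]
    refine (norm_sum_le _ _).trans ?_
    calc ∑ i ∈ t, ‖χ i x • (grad (n := n) (v i) x - Y x) + (v i x - u x) • grad (n := n) (χ i) x‖
        ≤ ∑ i ∈ t, (χ i x * c + ε * ‖grad (n := n) (χ i) x‖) := by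
          refine Finset.sum_le_sum fun i _ => ?_
          by_cases hxi : x ∈ tsupport (χ i)
          · obtain ⟨h2, h3⟩ := hvu i x (hχs i hxi)
            refine (norm_add_le _ _).trans (add_le_add ?_ ?_)
            · rw [norm_smul, Real.norm_of_nonneg (hχ0 i x)]
              exact mul_le_mul_of_nonneg_left h3 (hχ0 i x)
            · rw [norm_smul, Real.norm_eq_abs]
              exact mul_le_mul_of_nonneg_right h2 (norm_nonneg _)
          · rw [image_eq_zero_of_notMem_tsupport hxi, grad_eq_zero_of_notMem_tsupport hxi]
            simp
      _ = c + ε * ∑ i ∈ t, ‖grad (n := n) (χ i) x‖ := by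
          rw [Finset.sum_add_distrib, ← Finset.sum_mul, hsum, one_mul, Finset.mul_sum]
      _ ≤ c + ε * |B| := by gcongr; exact hB' x hx
      _ ≤ c + δ := by
          have : ε * (|B| + 1) = δ := div_mul_cancel₀ _ (by positivity)
          linarith

/-- On a compact set, a `1`-Lipschitz function is a uniform limit of smooth functions whose
gradients are bounded by numbers close to `1`. -/
theorem exists_contMDiff_approx_of_lipschitz [SigmaCompactSpace M]
    [IsContMDiffRiemannianBundle (𝓡 n) ∞ (EuclideanSpace ℝ (Fin n))
      (fun x : M => TangentSpace (𝓡 n) x)] [IsRiemannianManifold (𝓡 n) M]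
    {K : Set M} (hK : IsCompact K) {u : M → ℝ} (hu : ∀ x y, |u x - u y| ≤ dist x y)
    {ε : ℝ} (hε : 0 < ε) :
    ∃ w : M → ℝ, ContMDiff (𝓡 n) 𝓘(ℝ, ℝ) ∞ w ∧
      ∀ x ∈ K, |w x - u x| ≤ ε ∧ ‖grad (n := n) w x‖ ≤ 1 + ε := by
  choose V hVo hV hloc using fun x₀ : M =>
    exists_local_approx_of_lipschitz (n := n) hu (c := 1 + ε / 2) (by linarith) x₀
  obtain ⟨w, hw, -, h⟩ := exists_contMDiff_approx_of_local (n := n) hK (u := u) (fun x => 0)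
    (c := 1 + ε / 2) V hVo hV univ (fun i δ hδ => by
      obtain ⟨v, hv, h⟩ := hloc i δ hδ
      refine ⟨v, hv, fun h => absurd (mem_univ i) h, fun x hx => ⟨(h x hx).1, ?_⟩⟩
      rw [sub_zero]
      exact (h x hx).2) (half_pos hε)
  refine ⟨w, hw, fun x hx => ⟨(h x hx).1.trans (by linarith), ?_⟩⟩
  have h2 := (h x hx).2
  rw [sub_zero] at h2
  linarith

/-- A compactly supported `C¹` function is a limit of test functions in the `C¹` topology. -/
theorem exists_testFunction_approx [SigmaCompactSpace M]
    [IsContMDiffRiemannianBundle (𝓡 n) ∞ (EuclideanSpace ℝ (Fin n))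
      (fun x : M => TangentSpace (𝓡 n) x)] {U : Set M} (hU : IsOpen U)
    {u : M → ℝ} (hu : ContMDiff (𝓡 n) 𝓘(ℝ, ℝ) 1 u) (hc : HasCompactSupport u)
    (hs : tsupport u ⊆ U) :
    ∃ K, IsCompact K ∧ K ⊆ U ∧ tsupport u ⊆ K ∧ ∀ ε > 0, ∃ φ : M → ℝ, IsTestFunction n U φ ∧
      tsupport φ ⊆ K ∧
      ∀ x ∈ K, |φ x - u x| ≤ ε ∧ ‖grad (n := n) φ x - grad (n := n) u x‖ ≤ ε := by
  have : LocallyCompactSpace M := Manifold.locallyCompact_of_finiteDimensional (𝓡 n)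
  obtain ⟨K, hK, hK1, hK2⟩ := exists_compact_between hc.isCompact hU hs
  refine ⟨K, hK, hK2, hK1.trans interior_subset, fun ε hε => ?_⟩
  choose W hWo hW hWloc using fun x₀ : M =>
    exists_local_approx_of_contMDiff (n := n) hu (half_pos hε) x₀
  classical
  -- Patches centred in the support of `u` stay inside `K`; the others avoid the support, and there
  -- the approximation is zero. Hence the glued function is supported in `K`.
  set V : M → Set M := fun i => if i ∈ tsupport u then W i ∩ interior K else (tsupport u)ᶜ with hVdef
  have hV1 : ∀ i, i ∈ tsupport u → V i = W i ∩ interior K := fun i hi => if_pos hi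
  have hV2 : ∀ i, i ∉ tsupport u → V i = (tsupport u)ᶜ := fun i hi => if_neg hi
  obtain ⟨w, hw, hws, h⟩ := exists_contMDiff_approx_of_local (n := n) hK (u := u)
    (fun x => grad (n := n) u x) (c := ε / 2) V
    (fun i => by
      by_cases hi : i ∈ tsupport u
      · rw [hV1 i hi]
        exact (hWo i).inter isOpen_interior
      · rw [hV2 i hi]
        exact (isClosed_tsupport u).isOpen_compl)
    (fun i => by
      by_cases hi : i ∈ tsupport u
      · rw [hV1 i hi]
        exact ⟨hW i, hK1 hi⟩
      · rw [hV2 i hi]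
        exact hi) (tsupport u) (fun i δ hδ => by
      by_cases hi : i ∈ tsupport u
      · obtain ⟨v, hv, h⟩ := hWloc i δ hδ
        rw [hV1 i hi]
        exact ⟨v, hv.mono inter_subset_left, fun h => absurd hi h, fun x hx => h x hx.1⟩
      · rw [hV2 i hi]
        refine ⟨0, contMDiffOn_const, fun _ => rfl, fun x hx => ?_⟩
        have h0 : grad (n := n) (0 : M → ℝ) x = 0 := grad_const 0 x
        rw [image_eq_zero_of_notMem_tsupport hx, grad_eq_zero_of_notMem_tsupport hx, h0]
        simpa using ⟨le_of_lt hδ, (half_pos hε).le⟩) (half_pos hε)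
  have hws' : tsupport w ⊆ K := by
    refine closure_minimal (hws.trans (iUnion₂_subset fun i hi => ?_)) hK.isClosed
    rw [hV1 i hi]
    exact inter_subset_right.trans interior_subset
  exact ⟨w, ⟨hw, hK.of_isClosed_subset (isClosed_tsupport w) hws', hws'.trans hK2⟩, hws',
    fun x hx => ⟨(h x hx).1.trans (by linarith), (h x hx).2.trans (by linarith)⟩⟩

/-! ### Poincaré and Caccioppoli inequalities on the end -/

section Poincare

variable [SigmaCompactSpace M] [IsContMDiffRiemannianBundle (𝓡 n) ∞ (EuclideanSpace ℝ (Fin n))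
      (fun x : M => TangentSpace (𝓡 n) x)] [MeasurableSpace M] [BorelSpace M]

theorem continuous_norm_grad_sq {u : M → ℝ} (hu : ContMDiff (𝓡 n) 𝓘(ℝ, ℝ) 1 u) :
    Continuous fun x => ‖grad (n := n) u x‖ ^ 2 := by
  refine (continuous_inner_grad_of_tsupport isOpen_univ hu.contMDiffOn hu
    (subset_univ _)).congr fun x => ?_
  rw [real_inner_self_eq_norm_sq]

/-- The Rayleigh quotient inequality for compactly supported `C¹` functions. -/
theorem mul_integral_sq_le_integral_norm_grad_sq {U : Set M} (hU : IsOpen U) {μ₁ : ℝ}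
    (hμ₁ : μ₁ ∈ lowerBounds (dirichletSpectrum (M := M) n U)) {u : M → ℝ}
    (hu : ContMDiff (𝓡 n) 𝓘(ℝ, ℝ) 1 u) (hc : HasCompactSupport u) (hs : tsupport u ⊆ U) :
    μ₁ * ∫ x in U, u x ^ 2 ∂(riemannianVolume n M) ≤
      ∫ x in U, ‖grad (n := n) u x‖ ^ 2 ∂(riemannianVolume n M) := by
  obtain ⟨K, hK, hKU, huK, happ⟩ := exists_testFunction_approx hU hu hc hs
  choose φ hφ hφK hφu using fun k : ℕ => happ (1 / ((k : ℝ) + 1)) (by positivity)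
  have hε : Tendsto (fun k : ℕ => 1 / ((k : ℝ) + 1)) atTop (𝓝 0) :=
    tendsto_one_div_add_atTop_nhds_zero_nat
  have hε1 : ∀ k : ℕ, 1 / ((k : ℝ) + 1) ≤ 1 := fun k => by
    rw [div_le_one (by positivity)]
    linarith [Nat.cast_nonneg (α := ℝ) k]
  obtain ⟨B, hB⟩ := hK.exists_bound_of_continuousOn hu.continuous.continuousOn
  obtain ⟨C, hC⟩ := hK.exists_bound_of_continuousOn
    (continuous_norm_grad_sq (n := n) hu).sqrt.continuousOn
  have hC' : ∀ x ∈ K, ‖grad (n := n) u x‖ ≤ C := fun x hx => by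
    have := hC x hx
    rwa [Real.sqrt_sq (norm_nonneg _), norm_norm] at this
  have hdom : ∀ D : ℝ, Integrable (K.indicator fun _ => D)
      ((riemannianVolume n M).restrict U) := fun D =>
    ((integrable_indicator_iff hK.measurableSet).2
      (integrableOn_const hK.measure_lt_top.ne)).restrict
  have hφ1 : ∀ k, ContMDiff (𝓡 n) 𝓘(ℝ, ℝ) 1 (φ k) := fun k =>
    (hφ k).smooth.of_le (by exact_mod_cast le_top)
  -- All supports lie in the compact set `K`, where values and gradients are uniformly bounded, so
  -- dominated convergence applies here and to the gradients.
  have h1 : Tendsto (fun k => ∫ x in U, φ k x ^ 2 ∂(riemannianVolume n M)) atTop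
      (𝓝 (∫ x in U, u x ^ 2 ∂(riemannianVolume n M))) := by
    refine tendsto_integral_of_dominated_convergence (K.indicator fun _ => (B + 1) ^ 2)
      (fun k => ((hφ k).smooth.continuous.pow 2).aestronglyMeasurable) (hdom _)
      (fun k => ae_of_all _ fun x => ?_) (ae_of_all _ fun x => ?_)
    · by_cases hx : x ∈ K
      · rw [indicator_of_mem hx, norm_pow]
        refine pow_le_pow_left₀ (norm_nonneg _) ?_ 2
        have h2 := (hφu k x hx).1.trans (hε1 k)
        have h3 := norm_le_norm_add_norm_sub' (φ k x) (u x)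
        rw [Real.norm_eq_abs (φ k x - u x)] at h3
        linarith [hB x hx]
      · rw [indicator_of_notMem hx, image_eq_zero_of_notMem_tsupport fun h => hx (hφK k h)]
        simp
    · by_cases hx : x ∈ K
      · refine Tendsto.pow ?_ 2
        rw [tendsto_iff_norm_sub_tendsto_zero]
        exact squeeze_zero (fun k => norm_nonneg _) (fun k => (hφu k x hx).1) hε
      · have h2 : ∀ k, φ k x = 0 := fun k =>
          image_eq_zero_of_notMem_tsupport fun h => hx (hφK k h)
        rw [image_eq_zero_of_notMem_tsupport fun h => hx (huK h)]
        simp only [h2]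
        exact tendsto_const_nhds
  have h2 : Tendsto (fun k => ∫ x in U, ‖grad (n := n) (φ k) x‖ ^ 2 ∂(riemannianVolume n M)) atTop
      (𝓝 (∫ x in U, ‖grad (n := n) u x‖ ^ 2 ∂(riemannianVolume n M))) := by
    refine tendsto_integral_of_dominated_convergence (K.indicator fun _ => (C + 1) ^ 2)
      (fun k => (continuous_norm_grad_sq (hφ1 k)).aestronglyMeasurable) (hdom _)
      (fun k => ae_of_all _ fun x => ?_) (ae_of_all _ fun x => ?_)
    · by_cases hx : x ∈ K
      · rw [indicator_of_mem hx, norm_pow, norm_norm]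
        refine pow_le_pow_left₀ (norm_nonneg _) ?_ 2
        have h2 := (hφu k x hx).2.trans (hε1 k)
        have h3 := norm_le_norm_add_norm_sub' (grad (n := n) (φ k) x) (grad (n := n) u x)
        linarith [hC' x hx]
      · rw [indicator_of_notMem hx, grad_eq_zero_of_notMem_tsupport fun h => hx (hφK k h)]
        simp
    · by_cases hx : x ∈ K
      · refine Tendsto.pow ?_ 2
        rw [tendsto_iff_norm_sub_tendsto_zero]
        refine squeeze_zero (fun k => norm_nonneg _) (fun k => ?_) hε
        exact (abs_norm_sub_norm_le _ _).trans (hφu k x hx).2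
      · have h2 : ∀ k, grad (n := n) (φ k) x = 0 := fun k =>
          grad_eq_zero_of_notMem_tsupport fun h => hx (hφK k h)
        rw [grad_eq_zero_of_notMem_tsupport fun h => hx (huK h)]
        simp only [h2]
        exact tendsto_const_nhds
  refine le_of_tendsto_of_tendsto' (h1.const_mul μ₁) h2 fun k => ?_
  refine (mul_integral_sq_le_dirichletForm hμ₁ (hφ k)).trans (le_of_eq ?_)
  simp only [dirichletForm, real_inner_self_eq_norm_sq]

/-- The Caccioppoli inequality for a subsolution, with a `C¹` cutoff function. -/
theorem mul_integral_sq_le_of_subsolution {U : Set M} (hU : IsOpen U) {μ₁ μ : ℝ}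
    (hμ₁ : μ₁ ∈ lowerBounds (dirichletSpectrum (M := M) n U)) {f : M → ℝ}
    (hf : ContMDiffOn (𝓡 n) 𝓘(ℝ, ℝ) 2 f U) (hf0 : ∀ x ∈ U, 0 ≤ f x)
    (hsub : ∀ x ∈ U, -μ * f x ≤ laplacian n f x) {φ : M → ℝ}
    (hφ : ContMDiff (𝓡 n) 𝓘(ℝ, ℝ) 1 φ) (hc : HasCompactSupport φ) (hs : tsupport φ ⊆ U) :
    (μ₁ - μ) * ∫ x in U, (φ x * f x) ^ 2 ∂(riemannianVolume n M) ≤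
      ∫ x in U, ‖grad (n := n) φ x‖ ^ 2 * f x ^ 2 ∂(riemannianVolume n M) := by
  have hf1 : ContMDiffOn (𝓡 n) 𝓘(ℝ, ℝ) 1 f U := hf.of_le one_le_two
  have hu : ContMDiff (𝓡 n) 𝓘(ℝ, ℝ) 1 (φ * f) :=
    contMDiff_mul_of_tsupport hU (k := 1) hφ hs hf1
  have hψ : ContMDiff (𝓡 n) 𝓘(ℝ, ℝ) 1 (φ * (φ * f)) := hφ.mul hu
  have hus : tsupport (φ * f) ⊆ U := (tsupport_mul_subset_left).trans hs
  have hψs : tsupport (φ * (φ * f)) ⊆ U := (tsupport_mul_subset_left).trans hs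
  have huc : HasCompactSupport (φ * f) := hc.mul_right
  have hψc : HasCompactSupport (φ * (φ * f)) := hc.mul_right
  have hR := mul_integral_sq_le_integral_norm_grad_sq hU hμ₁ hu huc hus
  -- The test function is `φ² f`, nonnegative because `f` is, with no sign condition on `φ`.
  have hG := integral_inner_grad_le_of_subsolution hU hf hsub hψ hψc hψs fun x => by
    by_cases hx : x ∈ U
    · have := hf0 x hx
      have h2 : (φ * (φ * f)) x = φ x ^ 2 * f x := by simp only [Pi.mul_apply]; ring
      rw [h2]
      positivity
    · rw [image_eq_zero_of_notMem_tsupport fun h => hx (hψs h)]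
  -- The cross terms `2 φ f ⟨∇φ, ∇f⟩` occur on both sides.
  have hpt : ∀ x, ‖grad (n := n) (φ * f) x‖ ^ 2 =
      inner ℝ (grad (n := n) f x) (grad (n := n) (φ * (φ * f)) x) +
        ‖grad (n := n) φ x‖ ^ 2 * f x ^ 2 := fun x => by
    have h1 := (mdifferentiableAt_and_grad_mul_of_tsupport hU hφ hs hf1 x).2
    have h2 := grad_mul (hφ.mdifferentiableAt (x := x) one_ne_zero)
      (hu.mdifferentiableAt (x := x) one_ne_zero)
    rw [h2, h1, ← real_inner_self_eq_norm_sq, ← real_inner_self_eq_norm_sq]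
    simp only [inner_add_left, inner_add_right, real_inner_smul_left, real_inner_smul_right,
      Pi.mul_apply, smul_add]
    rw [real_inner_comm (grad (n := n) f x) (grad (n := n) φ x)]
    ring
  have hi1 : Integrable (fun x => ‖grad (n := n) (φ * f) x‖ ^ 2) (riemannianVolume n M) := by
    refine (continuous_norm_grad_sq hu).integrable_of_hasCompactSupport ?_
    refine HasCompactSupport.intro huc.isCompact fun x hx => ?_
    rw [grad_eq_zero_of_notMem_tsupport hx]
    simp
  have hi2 : Integrable (fun x => (inner ℝ (grad (n := n) f x) (grad (n := n) (φ * (φ * f)) x) : ℝ))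
      (riemannianVolume n M) :=
    (continuous_inner_grad_of_tsupport hU hf1 hψ hψs).integrable_of_hasCompactSupport
      (hasCompactSupport_inner_grad hψc)
  have hi3 : Integrable (fun x => ‖grad (n := n) φ x‖ ^ 2 * f x ^ 2) (riemannianVolume n M) := by
    refine (hi1.sub hi2).congr (ae_of_all _ fun x => ?_)
    simp only [Pi.sub_apply, hpt x]
    ring
  have e1 : ∫ x in U, ‖grad (n := n) (φ * f) x‖ ^ 2 ∂(riemannianVolume n M) =
      ∫ x in U, inner ℝ (grad (n := n) f x) (grad (n := n) (φ * (φ * f)) x)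
        ∂(riemannianVolume n M) +
      ∫ x in U, ‖grad (n := n) φ x‖ ^ 2 * f x ^ 2 ∂(riemannianVolume n M) := by
    rw [← integral_add hi2.restrict hi3.restrict]
    exact integral_congr_ae (ae_of_all _ hpt)
  have e2 : ∫ x in U, inner ℝ (grad (n := n) f x) (grad (n := n) (φ * (φ * f)) x)
        ∂(riemannianVolume n M) =
      ∫ x, inner ℝ (grad (n := n) f x) (grad (n := n) (φ * (φ * f)) x)
        ∂(riemannianVolume n M) := by
    refine setIntegral_eq_integral_of_forall_compl_eq_zero fun x hx => ?_
    rw [grad_eq_zero_of_notMem_tsupport fun h => hx (hψs h), inner_zero_right]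
  have e3 : ∫ x, (φ * (φ * f)) x * f x ∂(riemannianVolume n M) =
      ∫ x in U, (φ * f) x ^ 2 ∂(riemannianVolume n M) := by
    rw [← setIntegral_eq_integral_of_forall_compl_eq_zero (s := U) fun x hx => by
      rw [image_eq_zero_of_notMem_tsupport fun h => hx (hψs h), zero_mul]]
    refine integral_congr_ae (ae_of_all _ fun x => ?_)
    simp only [Pi.mul_apply]
    ring
  rw [e3] at hG
  rw [e1, e2] at hR
  simp only [Pi.mul_apply] at hR hG
  linarith

/-- The Caccioppoli inequality with a cutoff function of the distance to a point. -/
theorem mul_setIntegral_annulus_le [IsRiemannianManifold (𝓡 n) M] {U : Set M} (hU : IsOpen U)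
    {μ₁ μ : ℝ} (hμ₁ : μ₁ ∈ lowerBounds (dirichletSpectrum (M := M) n U)) {f : M → ℝ}
    (hf : ContMDiffOn (𝓡 n) 𝓘(ℝ, ℝ) 2 f U) (hf0 : ∀ x ∈ U, 0 ≤ f x)
    (hsub : ∀ x ∈ U, -μ * f x ≤ laplacian n f x) {p : M} {R₀ : ℝ}
    (hcomp : ∀ s t, R₀ < s → IsCompact (annulus U p s t)) {η : ℝ → ℝ} (hη : ContDiff ℝ 1 η)
    {s t : ℝ} (hs : R₀ < s) (hsupp : Function.support η ⊆ Icc s t) :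
    (μ₁ - μ) * ∫ x in annulus U p s t, η (dist x p) ^ 2 * f x ^ 2 ∂(riemannianVolume n M) ≤
      ∫ x in annulus U p s t, deriv η (dist x p) ^ 2 * f x ^ 2 ∂(riemannianVolume n M) := by
  -- The annulus is enlarged by half the gap to `R₀`, so that `K` is still compact.
  set d := (s - R₀) / 2 with hd
  have hd0 : 0 < d := by rw [hd]; linarith
  set K := annulus U p (s - d) (t + d) with hKdef
  have hK : IsCompact K := hcomp _ _ (by rw [hd]; linarith)
  have hKU : K ⊆ U := inter_subset_left
  have hη0 : ∀ y, y ∉ Icc s t → η y = 0 := fun y hy => by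
    by_contra h
    exact hy (hsupp h)
  have hη'0 : ∀ y, y ∉ Icc s t → deriv η y = 0 := fun y hy => by
    have h1 : η =ᶠ[𝓝 y] fun _ => (0 : ℝ) := by
      filter_upwards [isClosed_Icc.isOpen_compl.mem_nhds hy] with z hz using hη0 z hz
    rw [h1.deriv_eq, deriv_const]
  have hη'c : Continuous (deriv η) := hη.continuous_deriv le_rfl
  have hηd : ∀ y, HasDerivAt η (deriv η y) y := fun y =>
    ((hη.differentiable one_ne_zero) y).hasDerivAt
  have hr1 : ∀ x y : M, |dist x p - dist y p| ≤ dist x y := fun x y => abs_dist_sub_le x y p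
  have hε : ∀ k : ℕ, 0 < d / 2 / ((k : ℝ) + 1) := fun k => by positivity
  have hεd : ∀ k : ℕ, d / 2 / ((k : ℝ) + 1) < d := fun k => by
    have : d / 2 / ((k : ℝ) + 1) ≤ d / 2 :=
      div_le_self (by linarith) (by linarith [Nat.cast_nonneg (α := ℝ) k])
    linarith
  have hεlim : Tendsto (fun k : ℕ => d / 2 / ((k : ℝ) + 1)) atTop (𝓝 0) := by
    have := (tendsto_one_div_add_atTop_nhds_zero_nat (𝕜 := ℝ)).const_mul (d / 2)
    rw [mul_zero] at this
    refine this.congr fun k => ?_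
    ring
  choose w hw hwK using fun k : ℕ =>
    exists_contMDiff_approx_of_lipschitz (n := n) hK hr1 (hε k)
  have hrc : Continuous fun x : M => dist x p := continuous_id.dist continuous_const
  -- The error of `w k` is below `d`, so the support of the truncation is in the interior of `K`;
  -- cutting off with the indicator therefore preserves `C¹` regularity.
  set φ : ℕ → M → ℝ := fun k => K.indicator (η ∘ w k) with hφdef
  have hw1 : ∀ k, ContMDiff (𝓡 n) 𝓘(ℝ, ℝ) 1 (w k) := fun k =>
    (hw k).of_le (by exact_mod_cast le_top)
  have hηw : ∀ k, ContMDiff (𝓡 n) 𝓘(ℝ, ℝ) 1 (η ∘ w k) := fun k =>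
    hη.contMDiff.comp (hw1 k)
  have hφsupp : ∀ k, tsupport (φ k) ⊆
      annulus U p (s - d / 2 / ((k : ℝ) + 1)) (t + d / 2 / ((k : ℝ) + 1)) := fun k => by
    refine closure_minimal (fun x hx => ?_) (hcomp _ _ (by linarith [hεd k])).isClosed
    have hxK : x ∈ K := by
      by_contra h
      exact hx (indicator_of_notMem h _)
    have h1 : η (w k x) ≠ 0 := by
      have : K.indicator (η ∘ w k) x ≠ 0 := hx
      rwa [indicator_of_mem hxK] at this
    have h2 := hsupp h1
    have h3 := abs_le.1 (hwK k x hxK).1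
    exact ⟨hKU hxK, by linarith [h2.1], by linarith [h2.2]⟩
  have hφO : ∀ k, ∀ x ∈ tsupport (φ k), K ∈ 𝓝 x := fun k x hx => by
    obtain ⟨h1, h2, h3⟩ := hφsupp k hx
    have h4 : {y | s - d < dist y p ∧ dist y p < t + d} ∈ 𝓝 x :=
      ((isOpen_lt continuous_const hrc).inter (isOpen_lt hrc continuous_const)).mem_nhds
        ⟨show s - d < dist x p by linarith [hεd k], show dist x p < t + d by linarith [hεd k]⟩
    filter_upwards [hU.mem_nhds h1, h4] with y hy1 hy2 using ⟨hy1, hy2.1.le, hy2.2.le⟩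
  have hφK : ∀ k, tsupport (φ k) ⊆ K := fun k x hx => mem_of_mem_nhds (hφO k x hx)
  have hφeq : ∀ k, ∀ x ∈ tsupport (φ k), φ k =ᶠ[𝓝 x] η ∘ w k := fun k x hx => by
    filter_upwards [hφO k x hx] with y hy using indicator_of_mem hy _
  have hφ1 : ∀ k, ContMDiff (𝓡 n) 𝓘(ℝ, ℝ) 1 (φ k) := fun k x => by
    by_cases hx : x ∈ tsupport (φ k)
    · exact (hηw k x).congr_of_eventuallyEq (hφeq k x hx)
    · exact (contMDiff_const (c := (0 : ℝ)) x).congr_of_eventuallyEq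
        (notMem_tsupport_iff_eventuallyEq.1 hx)
  have hφc : ∀ k, HasCompactSupport (φ k) := fun k =>
    hK.of_isClosed_subset (isClosed_tsupport _) (hφK k)
  have hgrad : ∀ k, ∀ x ∈ K, ‖grad (n := n) (φ k) x‖ ^ 2 ≤
      (1 + d / 2 / ((k : ℝ) + 1)) ^ 2 * deriv η (w k x) ^ 2 := fun k x hx => by
    by_cases hx' : x ∈ tsupport (φ k)
    · rw [grad_congr (hφeq k x hx'), grad_comp (hηd (w k x))
        ((hw1 k).mdifferentiableAt one_ne_zero), norm_smul, mul_pow, Real.norm_eq_abs, sq_abs,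
        mul_comm]
      exact mul_le_mul_of_nonneg_right
        (pow_le_pow_left₀ (norm_nonneg _) (hwK k x hx).2 2) (sq_nonneg _)
    · rw [grad_eq_zero_of_notMem_tsupport hx', norm_zero]
      have : 0 ≤ (1 + d / 2 / ((k : ℝ) + 1)) ^ 2 * deriv η (w k x) ^ 2 :=
        mul_nonneg (sq_nonneg _) (sq_nonneg _)
      simpa using this
  have hfc : ContinuousOn f K := hf.continuousOn.mono hKU
  have hKi : ∀ {g : M → ℝ}, ContinuousOn g K → IntegrableOn g K (riemannianVolume n M) :=
    fun hg => hg.integrableOn_compact hK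
  have hstep : ∀ k, (μ₁ - μ) * ∫ x in K, η (w k x) ^ 2 * f x ^ 2 ∂(riemannianVolume n M) ≤
      (1 + d / 2 / ((k : ℝ) + 1)) ^ 2 *
        ∫ x in K, deriv η (w k x) ^ 2 * f x ^ 2 ∂(riemannianVolume n M) := fun k => by
    have h1 := mul_integral_sq_le_of_subsolution hU hμ₁ hf hf0 hsub (hφ1 k) (hφc k)
      ((hφK k).trans hKU)
    have e1 : ∫ x in U, (φ k x * f x) ^ 2 ∂(riemannianVolume n M) =
        ∫ x in K, η (w k x) ^ 2 * f x ^ 2 ∂(riemannianVolume n M) := by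
      rw [setIntegral_eq_of_subset_of_forall_sdiff_eq_zero hU.measurableSet hKU fun x hx => by
        rw [image_eq_zero_of_notMem_tsupport fun h => hx.2 (hφK k h)]
        simp]
      refine setIntegral_congr_fun hK.measurableSet fun x hx => ?_
      simp only [hφdef, indicator_of_mem hx, Function.comp_apply]
      ring
    have e2 : ∫ x in U, ‖grad (n := n) (φ k) x‖ ^ 2 * f x ^ 2 ∂(riemannianVolume n M) =
        ∫ x in K, ‖grad (n := n) (φ k) x‖ ^ 2 * f x ^ 2 ∂(riemannianVolume n M) :=
      setIntegral_eq_of_subset_of_forall_sdiff_eq_zero hU.measurableSet hKU fun x hx => by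
        rw [grad_eq_zero_of_notMem_tsupport fun h => hx.2 (hφK k h)]
        simp
    rw [e1, e2] at h1
    refine h1.trans ?_
    rw [← integral_const_mul]
    refine setIntegral_mono_on
      (hKi ((continuous_norm_grad_sq (hφ1 k)).continuousOn.mul (hfc.pow 2)))
      (hKi ((((hη'c.comp (hw1 k).continuous).continuousOn.pow 2).mul (hfc.pow 2)).const_smul
        ((1 + d / 2 / ((k : ℝ) + 1)) ^ 2))) hK.measurableSet fun x hx => ?_
    rw [← mul_assoc]
    exact mul_le_mul_of_nonneg_right (hgrad k x hx) (sq_nonneg _)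
  -- Used for both `η` and its derivative: `w k` tends to the distance on `K`, and the limiting
  -- integrand vanishes off the original annulus.
  have hlim : ∀ {g : ℝ → ℝ}, Continuous g → (∀ y, y ∉ Icc s t → g y = 0) →
      Tendsto (fun k => ∫ x in K, g (w k x) ^ 2 * f x ^ 2 ∂(riemannianVolume n M)) atTop
        (𝓝 (∫ x in annulus U p s t, g (dist x p) ^ 2 * f x ^ 2 ∂(riemannianVolume n M))) := by
    intro g hg hg0
    have hsubK : annulus U p s t ⊆ K := fun x hx =>
      ⟨hx.1, by linarith [hx.2.1], by linarith [hx.2.2]⟩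
    rw [← setIntegral_eq_of_subset_of_forall_sdiff_eq_zero hK.measurableSet hsubK fun x hx => by
      rw [hg0 _ fun h => hx.2 ⟨hx.1.1, h⟩]
      simp]
    obtain ⟨B, hB⟩ := (isCompact_Icc (a := s) (b := t)).exists_bound_of_continuousOn hg.continuousOn
    have hB' : ∀ y, g y ^ 2 ≤ B ^ 2 := fun y => by
      by_cases hy : y ∈ Icc s t
      · rw [← sq_abs]
        exact pow_le_pow_left₀ (abs_nonneg _) (hB y hy) 2
      · rw [hg0 y hy]
        simpa using sq_nonneg B
    refine tendsto_integral_of_dominated_convergence (fun x => B ^ 2 * f x ^ 2) (fun k => ?_)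
      (hKi ((hfc.pow 2).const_smul (B ^ 2))) (fun k => ae_of_all _ fun x => ?_) ?_
    · exact (hKi (((hg.comp (hw1 k).continuous).continuousOn.pow 2).mul
        (hfc.pow 2))).aestronglyMeasurable
    · rw [Real.norm_of_nonneg (by positivity)]
      exact mul_le_mul_of_nonneg_right (hB' _) (sq_nonneg _)
    · refine (ae_restrict_iff' hK.measurableSet).2 (ae_of_all _ fun x hx => ?_)
      have h1 : Tendsto (fun k => w k x) atTop (𝓝 (dist x p)) := by
        rw [tendsto_iff_norm_sub_tendsto_zero]
        exact squeeze_zero (fun k => norm_nonneg _) (fun k => (hwK k x hx).1) hεlim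
      exact (((hg.tendsto _).comp h1).pow 2).mul_const _
  have hl1 := (hlim hη.continuous hη0).const_mul (μ₁ - μ)
  have hl2 := ((hεlim.const_add 1).pow 2).mul (hlim hη'c hη'0)
  rw [add_zero, one_pow, one_mul] at hl2
  exact le_of_tendsto_of_tendsto' hl1 hl2 hstep

end Poincare

/-! ### The one-dimensional cutoff argument -/

theorem exists_hasDerivAt_ramp (s₁ : ℝ) {c : ℝ} (hc : 1 < c) :
    ∃ s₀ > s₁, ∃ ψ ψ' : ℝ → ℝ, Continuous ψ' ∧ (∀ s, HasDerivAt ψ (ψ' s) s) ∧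
      (∀ s, 0 ≤ ψ s) ∧ (∀ s, ψ s ≤ 1) ∧ (∀ s, 0 ≤ ψ' s) ∧ (∀ s, ψ' s ≤ c) ∧
      (∀ s ≤ s₀, ψ s = 0 ∧ ψ' s = 0) ∧ ∀ s, s₁ + 1 ≤ s → ψ s = 1 ∧ ψ' s = 0 := by
  -- The derivative is a normalised trapezoid: `δ` for the strict gap after `s₁`, `δ` to rise, `δ`
  -- to fall. The plateau has length `1 - 3δ = 1 / c`, so dividing by the integral gives slope at
  -- most `c`. The gap keeps the support away from the radius where annuli may fail to be compact.
  set δ := (1 - 1 / c) / 3 with hδ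
  have hc0 : 0 < c := by linarith
  have hδ0 : 0 < δ := by
    have : 1 / c < 1 := by rw [div_lt_one hc0]; exact hc
    rw [hδ]; linarith
  have hδ1 : δ < 1 / 3 := by
    have : 0 < 1 / c := by positivity
    rw [hδ]; linarith
  set T : ℝ → ℝ := fun s => min 1 (max 0 ((s - s₁ - δ) / δ)) * min 1 (max 0 ((s₁ + 1 - s) / δ))
    with hT
  have hTc : Continuous T := by fun_prop
  have hm0 : ∀ x : ℝ, 0 ≤ min 1 (max 0 x) := fun x => le_min zero_le_one (le_max_left _ _)
  have hm1 : ∀ x : ℝ, min 1 (max 0 x) ≤ 1 := fun x => min_le_left _ _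
  have hT0 : ∀ s, 0 ≤ T s := fun s => mul_nonneg (hm0 _) (hm0 _)
  have hT1 : ∀ s, T s ≤ 1 := fun s => mul_le_one₀ (hm1 _) (hm0 _) (hm1 _)
  have hTl : ∀ s ≤ s₁ + δ, T s = 0 := fun s hs => by
    have : (s - s₁ - δ) / δ ≤ 0 := div_nonpos_of_nonpos_of_nonneg (by linarith) hδ0.le
    simp [hT, max_eq_left this]
  have hTr : ∀ s, s₁ + 1 ≤ s → T s = 0 := fun s hs => by
    have : (s₁ + 1 - s) / δ ≤ 0 := div_nonpos_of_nonpos_of_nonneg (by linarith) hδ0.le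
    simp [hT, max_eq_left this]
  have hTm : ∀ s ∈ Icc (s₁ + 2 * δ) (s₁ + 1 - δ), T s = 1 := fun s hs => by
    have h1 : 1 ≤ (s - s₁ - δ) / δ := by rw [one_le_div hδ0]; linarith [hs.1]
    have h2 : 1 ≤ (s₁ + 1 - s) / δ := by rw [one_le_div hδ0]; linarith [hs.2]
    simp only [hT]
    rw [min_eq_left (h1.trans (le_max_right _ _)), min_eq_left (h2.trans (le_max_right _ _)),
      one_mul]
  have hTi : ∀ x y, IntervalIntegrable T volume x y := fun x y => hTc.intervalIntegrable x y
  set I := ∫ s in s₁..(s₁ + 1), T s with hI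
  have hIge : 1 / c ≤ I := by
    have h1 : I = (∫ s in s₁..(s₁ + 2 * δ), T s) +
        ((∫ s in (s₁ + 2 * δ)..(s₁ + 1 - δ), T s) + ∫ s in (s₁ + 1 - δ)..(s₁ + 1), T s) := by
      rw [intervalIntegral.integral_add_adjacent_intervals (hTi _ _) (hTi _ _),
        intervalIntegral.integral_add_adjacent_intervals (hTi _ _) (hTi _ _)]
    have h2 : 0 ≤ ∫ s in s₁..(s₁ + 2 * δ), T s :=
      intervalIntegral.integral_nonneg (by linarith) fun s _ => hT0 s
    have h3 : 0 ≤ ∫ s in (s₁ + 1 - δ)..(s₁ + 1), T s :=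
      intervalIntegral.integral_nonneg (by linarith) fun s _ => hT0 s
    have h4 : ∫ s in (s₁ + 2 * δ)..(s₁ + 1 - δ), T s = 1 / c := by
      rw [intervalIntegral.integral_congr (g := fun _ => (1 : ℝ)) (fun s hs => hTm s (by
        rwa [uIcc_of_le (by linarith)] at hs))]
      simp only [intervalIntegral.integral_const, smul_eq_mul, hδ]
      ring
    linarith
  have hI0 : 0 < I := lt_of_lt_of_le (by positivity) hIge
  have hIc : I⁻¹ ≤ c := by
    rw [inv_le_comm₀ hI0 hc0, ← one_div]
    exact hIge
  have hend : ∀ s, s₁ + 1 ≤ s → ∫ x in s₁..s, T x = I := fun s hs => by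
    rw [← intervalIntegral.integral_add_adjacent_intervals (hTi s₁ (s₁ + 1)) (hTi _ s),
      intervalIntegral.integral_congr (a := s₁ + 1) (b := s) (g := fun _ => (0 : ℝ)) (fun x hx =>
        hTr x (by rw [uIcc_of_le hs] at hx; exact hx.1))]
    simp [hI]
  have hstart : ∀ s ≤ s₁ + δ, ∫ x in s₁..s, T x = 0 := fun s hs => by
    rw [intervalIntegral.integral_congr (g := fun _ => (0 : ℝ)) (fun x hx =>
        hTl x (hx.2.trans (max_le (by linarith) hs)))]
    simp
  have hmono : ∀ x y, x ≤ y → ∫ s in s₁..x, T s ≤ ∫ s in s₁..y, T s := fun x y hxy => by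
    rw [← intervalIntegral.integral_add_adjacent_intervals (hTi s₁ x) (hTi x y)]
    linarith [intervalIntegral.integral_nonneg (μ := volume) hxy fun s (_ : s ∈ Icc x y) => hT0 s]
  refine ⟨s₁ + δ, by linarith, fun s => I⁻¹ * ∫ x in s₁..s, T x, fun s => I⁻¹ * T s,
    continuous_const.mul hTc, fun s => ?_, fun s => ?_, fun s => ?_, fun s => ?_, fun s => ?_,
    fun s hs => ?_, fun s hs => ?_⟩
  · exact (intervalIntegral.integral_hasDerivAt_right (hTi _ _)
      (hTc.stronglyMeasurableAtFilter _ _) hTc.continuousAt).const_mul _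
  · refine mul_nonneg (inv_nonneg.2 hI0.le) ?_
    rcases le_total s (s₁ + δ) with h | h
    · rw [hstart s h]
    · exact (hstart _ le_rfl).symm.le.trans (hmono _ _ h)
  · rw [inv_mul_le_one₀ hI0]
    rcases le_total (s₁ + 1) s with h | h
    · rw [hend s h]
    · exact hmono _ _ h
  · exact mul_nonneg (inv_nonneg.2 hI0.le) (hT0 s)
  · calc I⁻¹ * T s ≤ I⁻¹ * 1 := mul_le_mul_of_nonneg_left (hT1 s) (inv_nonneg.2 hI0.le)
      _ ≤ c := by rwa [mul_one]
  · simp only [hstart s hs, hTl s hs, mul_zero, and_self]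
  · simp only [hend s hs, hTr s hs, mul_zero, inv_mul_cancel₀ hI0.ne', and_self]

/-- A `C¹` function with slopes in `[-1, 1]` that is constant on `[ρ, ρ + 1]` and has almost the
slopes `1` and `-1` before and after. -/
theorem exists_hasDerivAt_weight (ρ : ℝ) {δ : ℝ} (hδ : 0 < δ) :
    ∃ h h' : ℝ → ℝ, Continuous h' ∧ (∀ s, HasDerivAt h (h' s) s) ∧ (∀ s, |h' s| ≤ 1) ∧
      (∀ s ∈ Icc ρ (ρ + 1), h s = 0 ∧ h' s = 0) ∧ (∀ s ≤ ρ, h s ≤ s - ρ + δ) ∧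
      ∀ s, ρ + 1 ≤ s → h s ≤ ρ + 1 + δ - s := by
  -- A continuous step of width `δ`. Its primitive is zero for `x ≤ 0` and loses at most `δ`
  -- compared with `x` for `x ≥ 0`; this is the `δ` in the bounds for `h`.
  set k : ℝ → ℝ := fun x => min 1 (max 0 (x / δ)) with hk
  have hk0 : ∀ x, 0 ≤ k x := fun x => le_min zero_le_one (le_max_left _ _)
  have hk1 : ∀ x, k x ≤ 1 := fun x => min_le_left _ _
  have hkn : ∀ x ≤ 0, k x = 0 := fun x hx => by
    simp [hk, max_eq_left (div_nonpos_of_nonpos_of_nonneg hx hδ.le)]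
  have hkp : ∀ x, δ ≤ x → k x = 1 := fun x hx =>
    min_eq_left (((one_le_div hδ).2 hx).trans (le_max_right _ _))
  have hkc : Continuous k := by fun_prop
  have hkl : ∀ x, 0 ≤ x → x - δ ≤ ∫ y in (0 : ℝ)..x, k y := fun x hx => by
    rcases le_total x δ with h | h
    · linarith [intervalIntegral.integral_nonneg (μ := volume) hx fun s (_ : s ∈ Icc 0 x) => hk0 s]
    · rw [← intervalIntegral.integral_add_adjacent_intervals (hkc.intervalIntegrable 0 δ)
        (hkc.intervalIntegrable δ x), intervalIntegral.integral_congr (a := δ) (b := x)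
        (g := fun _ => (1 : ℝ)) (fun y hy => hkp y (by rw [uIcc_of_le h] at hy; exact hy.1))]
      have := intervalIntegral.integral_nonneg (μ := volume) hδ.le fun s (_ : s ∈ Icc 0 δ) => hk0 s
      simp only [intervalIntegral.integral_const, smul_eq_mul, mul_one]
      linarith
  have hkz : ∀ x ≤ 0, ∫ y in (0 : ℝ)..x, k y = 0 := fun x hx => by
    rw [intervalIntegral.integral_congr (g := fun _ => (0 : ℝ)) (fun y hy =>
      hkn y (hy.2.trans (max_le le_rfl hx)))]
    simp
  have hkd : ∀ x, HasDerivAt (fun x => ∫ y in (0 : ℝ)..x, k y) (k x) x := fun x =>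
    intervalIntegral.integral_hasDerivAt_right (hkc.intervalIntegrable _ _)
      (hkc.stronglyMeasurableAtFilter _ _) hkc.continuousAt
  refine ⟨fun s => -(∫ y in (0 : ℝ)..(ρ - s), k y) - ∫ y in (0 : ℝ)..(s - (ρ + 1)), k y,
    fun s => k (ρ - s) - k (s - (ρ + 1)), by fun_prop, fun s => ?_, fun s => ?_, fun s hs => ?_,
    fun s hs => ?_, fun s hs => ?_⟩
  · have h1 := (hkd (ρ - s)).comp s ((hasDerivAt_id s).const_sub ρ)
    have h2 := (hkd (s - (ρ + 1))).comp s ((hasDerivAt_id s).sub_const (ρ + 1))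
    exact (h1.neg.sub h2).congr_deriv (by ring)
  · rw [abs_le]
    constructor
    · linarith [hk0 (ρ - s), hk1 (s - (ρ + 1))]
    · linarith [hk1 (ρ - s), hk0 (s - (ρ + 1))]
  · have h1 : ρ - s ≤ 0 := by linarith [hs.1]
    have h2 : s - (ρ + 1) ≤ 0 := by linarith [hs.2]
    simp [hkz _ h1, hkz _ h2, hkn _ h1, hkn _ h2]
  · have h2 := hkl (ρ - s) (by linarith)
    have h3 := hkz (s - (ρ + 1)) (by linarith)
    linarith
  · have h2 := hkl (s - (ρ + 1)) (by linarith)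
    have h3 := hkz (ρ - s) (by linarith)
    linarith

/-- The cutoff argument for a measure on the line satisfying a Poincaré inequality with constant
`a²`: the estimate for a fixed outer cutoff. -/
theorem sq_mul_measureReal_le {ν : Measure ℝ} {R₀ a : ℝ} (ha : 0 < a)
    (hfin : ∀ s, R₀ < s → ∀ t, ν (Icc s t) < ⊤)
    (hH : ∀ η : ℝ → ℝ, ContDiff ℝ 1 η → ∀ s t, R₀ < s → Function.support η ⊆ Icc s t →
      a ^ 2 * ∫ x in Icc s t, η x ^ 2 ∂ν ≤ ∫ x in Icc s t, deriv η x ^ 2 ∂ν)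
    {ρ : ℝ} (hρ : R₀ + 1 < ρ) {δ : ℝ} (hδ : 0 < δ) :
    ∃ s₀ > R₀, ∀ T, ρ + 1 < T → a ^ 2 * ν.real (Icc ρ (ρ + 1)) ≤
      ((1 + δ) ^ 2 + 2 * a * (1 + δ)) * Real.exp (2 * a * (δ - ρ)) *
          ∫ s in Icc s₀ (R₀ + 1), Real.exp (2 * a * s) ∂ν +
        (a + 2) ^ 2 * Real.exp (2 * a * (ρ + 1 + δ)) *
          ∫ s in Icc T (T + 1), Real.exp (-2 * a * s) ∂ν := by
  obtain ⟨s₀, hs₀, ψ, ψ', hψ'c, hψd, hψ0, hψ1, hψ'0, hψ'1, hψl, hψr⟩ :=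
    exists_hasDerivAt_ramp R₀ (c := 1 + δ) (by linarith)
  obtain ⟨h, h', hh'c, hhd, hh1, hhm, hhl, hhr⟩ := exists_hasDerivAt_weight ρ hδ
  refine ⟨s₀, hs₀, fun T hT => ?_⟩
  -- Any bound on the outer slope would do, since the outer term tends to zero; `2` is taken for
  -- definiteness.
  obtain ⟨-, -, τ, τ', hτ'c, hτd, hτ0, hτ1, hτ'0, hτ'1, hτl, hτr⟩ :
      ∃ s₀ > T, ∃ ψ ψ' : ℝ → ℝ, Continuous ψ' ∧ (∀ s, HasDerivAt ψ (ψ' s) s) ∧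
      (∀ s, 0 ≤ ψ s) ∧ (∀ s, ψ s ≤ 1) ∧ (∀ s, 0 ≤ ψ' s) ∧ (∀ s, ψ' s ≤ 2) ∧
      (∀ s ≤ T, ψ s = 0 ∧ ψ' s = 0) ∧ ∀ s, T + 1 ≤ s → ψ s = 1 ∧ ψ' s = 0 := by
    obtain ⟨s, hs, τ, τ', h1, h2, h3, h4, h5, h6, h7, h8⟩ :=
      exists_hasDerivAt_ramp T (c := 2) (by norm_num)
    exact ⟨s, hs, τ, τ', h1, h2, h3, h4, h5, h6, fun x hx => h7 x (hx.trans (le_of_lt hs)), h8⟩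
  have hs₀' : s₀ < R₀ + 1 := by
    by_contra hcon
    push Not at hcon
    have h1 := (hψr s₀ hcon).1
    rw [(hψl s₀ le_rfl).1] at h1
    exact zero_ne_one h1
  set η : ℝ → ℝ := fun s => ψ s * Real.exp (a * h s) * (1 - τ s) with hη
  set η' : ℝ → ℝ := fun s => (ψ' s * (1 - τ s) + a * h' s * ψ s * (1 - τ s) - ψ s * τ' s) *
    Real.exp (a * h s) with hη'
  have hψc : Continuous ψ := continuous_iff_continuousAt.2 fun s => (hψd s).continuousAt
  have hhc : Continuous h := continuous_iff_continuousAt.2 fun s => (hhd s).continuousAt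
  have hτc : Continuous τ := continuous_iff_continuousAt.2 fun s => (hτd s).continuousAt
  have hηc : Continuous η := by fun_prop
  have hη'c : Continuous η' := by fun_prop
  have hηd : ∀ s, HasDerivAt η (η' s) s := fun s => by
    have h1 := ((hψd s).mul ((hhd s).const_mul a).exp).mul ((hτd s).const_sub 1)
    refine h1.congr_deriv ?_
    simp only [hη', Pi.mul_apply]
    ring
  have hηderiv : deriv η = η' := funext fun s => (hηd s).deriv
  have hη1 : ContDiff ℝ 1 η := contDiff_one_iff_deriv.2
    ⟨fun s => (hηd s).differentiableAt, by rwa [hηderiv]⟩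
  have hsupp : Function.support η ⊆ Icc s₀ (T + 1) := fun s hs => by
    by_contra hcon
    refine hs ?_
    rw [mem_Icc, not_and_or, not_le, not_le] at hcon
    rcases hcon with h1 | h1
    · simp [hη, (hψl s h1.le).1]
    · simp [hη, (hτr s h1.le).1]
  have hmain := hH η hη1 s₀ (T + 1) hs₀ hsupp
  rw [hηderiv] at hmain
  set A := ((1 + δ) ^ 2 + 2 * a * (1 + δ)) * Real.exp (2 * a * (δ - ρ)) with hA
  set D := (a + 2) ^ 2 * Real.exp (2 * a * (ρ + 1 + δ)) with hD
  have hE : ∀ s, Real.exp (a * h s) ^ 2 = Real.exp (2 * a * h s) := fun s => by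
    rw [sq, ← Real.exp_add]
    ring_nf
  -- Integrating this pointwise inequality and adding the Poincaré inequality for `η` cancels the
  -- integrals of `η'²` and `a² η²`.
  have hpt : ∀ s ∈ Icc s₀ (T + 1), (Icc ρ (ρ + 1)).indicator (fun _ => a ^ 2) s + η' s ^ 2 ≤
      a ^ 2 * η s ^ 2 + (Icc s₀ (R₀ + 1)).indicator (fun s => A * Real.exp (2 * a * s)) s +
        (Icc T (T + 1)).indicator (fun s => D * Real.exp (-2 * a * s)) s := by
    intro s hs
    have hi1 : 0 ≤ (Icc s₀ (R₀ + 1)).indicator (fun s => A * Real.exp (2 * a * s)) s :=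
      indicator_nonneg (fun _ _ => by positivity) s
    have hi2 : 0 ≤ (Icc T (T + 1)).indicator (fun s => D * Real.exp (-2 * a * s)) s :=
      indicator_nonneg (fun _ _ => by positivity) s
    have hh2 : h' s ^ 2 ≤ 1 := by
      rw [← sq_abs]
      exact pow_le_one₀ (abs_nonneg _) (hh1 s)
    have hE0 : 0 ≤ Real.exp (a * h s) ^ 2 := by positivity
    rcases le_or_gt s (R₀ + 1) with hs1 | hs1
    · rw [indicator_of_notMem (fun hm => by linarith [hm.1])]
      rw [indicator_of_mem (show s ∈ Icc s₀ (R₀ + 1) from ⟨hs.1, hs1⟩)]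
      obtain ⟨ht1, ht2⟩ := hτl s (by linarith)
      simp only [hη, hη', ht1, ht2]
      have h3 : Real.exp (a * h s) ^ 2 ≤ Real.exp (2 * a * (δ - ρ)) * Real.exp (2 * a * s) := by
        rw [hE, ← Real.exp_add]
        refine Real.exp_le_exp.2 ?_
        have := hhl s (by linarith)
        nlinarith
      -- Expand the square: `ψ'² ≤ (1 + δ)²`, the cross term is at most `2a(1 + δ)`, and the last
      -- term is at most `a² ψ²`, which is absorbed by `η`.
      have h4 : (ψ' s + a * h' s * ψ s) ^ 2 ≤ a ^ 2 * ψ s ^ 2 + ((1 + δ) ^ 2 + 2 * a * (1 + δ)) := by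
        have h5 : ψ' s ^ 2 ≤ (1 + δ) ^ 2 := pow_le_pow_left₀ (hψ'0 s) (hψ'1 s) 2
        have h6 : ψ' s * (h' s * ψ s) ≤ 1 + δ := by
          have h7 : h' s * ψ s ≤ 1 :=
            (mul_le_mul_of_nonneg_right ((le_abs_self _).trans (hh1 s)) (hψ0 s)).trans
              (by rw [one_mul]; exact hψ1 s)
          exact (mul_le_mul_of_nonneg_left h7 (hψ'0 s)).trans (by rw [mul_one]; exact hψ'1 s)
        have h8 : a ^ 2 * ψ s ^ 2 * h' s ^ 2 ≤ a ^ 2 * ψ s ^ 2 * 1 :=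
          mul_le_mul_of_nonneg_left hh2 (by positivity)
        nlinarith
      have h5 : 0 ≤ (1 + δ) ^ 2 + 2 * a * (1 + δ) := by positivity
      have h6 := mul_le_mul_of_nonneg_right h4 hE0
      have h7 := mul_le_mul_of_nonneg_left h3 h5
      rw [hA]
      nlinarith
    obtain ⟨hp1, hp2⟩ := hψr s hs1.le
    rcases le_or_gt s T with hs2 | hs2
    · obtain ⟨ht1, ht2⟩ := hτl s hs2
      by_cases hm : s ∈ Icc ρ (ρ + 1)
      · obtain ⟨h1, h2⟩ := hhm s hm
        rw [indicator_of_mem hm]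
        simp only [hη, hη', hp1, hp2, ht1, ht2, h1, h2]
        simp only [mul_zero, Real.exp_zero]
        linarith
      · rw [indicator_of_notMem hm]
        simp only [hη, hη', hp1, hp2, ht1, ht2]
        have h8 := mul_le_mul_of_nonneg_left hh2
          (show 0 ≤ a ^ 2 * Real.exp (a * h s) ^ 2 by positivity)
        nlinarith
    · rw [indicator_of_notMem (fun hm => by linarith [hm.2])]
      rw [indicator_of_mem (show s ∈ Icc T (T + 1) from ⟨hs2.le, hs.2⟩)]
      simp only [hη', hp1, hp2]
      have h3 : Real.exp (a * h s) ^ 2 ≤ Real.exp (2 * a * (ρ + 1 + δ)) * Real.exp (-2 * a * s) := by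
        rw [hE, ← Real.exp_add]
        refine Real.exp_le_exp.2 ?_
        have := hhr s (by linarith)
        nlinarith
      have h4 : (a * h' s * (1 - τ s) - τ' s) ^ 2 ≤ (a + 2) ^ 2 := by
        rw [sq_le_sq, abs_of_pos (show 0 < a + 2 by linarith)]
        have h5 : |h' s * (1 - τ s)| ≤ 1 := by
          rw [abs_mul, abs_of_nonneg (show 0 ≤ 1 - τ s by linarith [hτ1 s])]
          exact mul_le_one₀ (hh1 s) (by linarith [hτ1 s]) (by linarith [hτ0 s])
        have h6 := abs_le.1 h5
        rw [abs_le]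
        constructor <;> nlinarith [hτ'0 s, hτ'1 s]
      have h6 := mul_le_mul h4 h3 hE0 (by positivity)
      have h7 : 0 ≤ a ^ 2 * η s ^ 2 := by positivity
      calc 0 + ((0 * (1 - τ s) + a * h' s * 1 * (1 - τ s) - 1 * τ' s) * Real.exp (a * h s)) ^ 2
          = (a * h' s * (1 - τ s) - τ' s) ^ 2 * Real.exp (a * h s) ^ 2 := by ring
        _ ≤ _ := h6
        _ = D * Real.exp (-2 * a * s) := by rw [hD]; ring
        _ ≤ _ := by linarith
  have hJ : ∀ {g : ℝ → ℝ}, Continuous g → ∀ {t}, IntegrableOn g (Icc s₀ t) ν := fun {g} hg t => by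
    have hf := hfin s₀ hs₀ t
    obtain ⟨C, hC⟩ := isCompact_Icc.exists_bound_of_continuousOn (s := Icc s₀ t) hg.continuousOn
    exact IntegrableOn.of_bound hf hg.aestronglyMeasurable C
      ((ae_restrict_iff' measurableSet_Icc).2 (ae_of_all _ hC))
  have hsub1 : Icc ρ (ρ + 1) ⊆ Icc s₀ (T + 1) := Icc_subset_Icc (by linarith) (by linarith)
  have hsub2 : Icc s₀ (R₀ + 1) ⊆ Icc s₀ (T + 1) := Icc_subset_Icc le_rfl (by linarith)
  have hsub3 : Icc T (T + 1) ⊆ Icc s₀ (T + 1) := Icc_subset_Icc (by linarith) le_rfl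
  have hi1 := (hJ (continuous_const (y := a ^ 2)) (t := T + 1)).indicator
    (measurableSet_Icc (a := ρ) (b := ρ + 1))
  have hi2 := (hJ (show Continuous fun s => A * Real.exp (2 * a * s) by fun_prop)
    (t := T + 1)).indicator (measurableSet_Icc (a := s₀) (b := R₀ + 1))
  have hi3 := (hJ (show Continuous fun s => D * Real.exp (-2 * a * s) by fun_prop)
    (t := T + 1)).indicator (measurableSet_Icc (a := T) (b := T + 1))
  have hi4 := (hJ (hηc.pow 2) (t := T + 1)).const_mul (a ^ 2)
  have hi5 := hJ (hη'c.pow 2) (t := T + 1)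
  have hint := setIntegral_mono_on (hi1.add hi5) ((hi4.add hi2).add hi3) measurableSet_Icc hpt
  have e1 := integral_add hi1 hi5
  have e2 := integral_add (hi4.add hi2) hi3
  have e3 := integral_add hi4 hi2
  simp only [Pi.add_apply, Pi.pow_apply] at hint e1 e2 e3
  rw [e1, e2, e3, setIntegral_indicator measurableSet_Icc, setIntegral_indicator measurableSet_Icc,
    setIntegral_indicator measurableSet_Icc, inter_eq_right.2 hsub1, inter_eq_right.2 hsub2,
    inter_eq_right.2 hsub3, setIntegral_const, integral_const_mul, integral_const_mul,
    integral_const_mul, smul_eq_mul] at hint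
  linarith

/-- Exponential decay of a measure on the line that satisfies a Poincaré inequality with constant
`a²` and that grows slower than `e^{2as}` along a sequence. -/
theorem measure_le_of_tendsto_zero {ν : Measure ℝ} {R₀ a : ℝ} (ha : 0 < a)
    (hfin : ∀ s, R₀ < s → ∀ t, ν (Icc s t) < ⊤)
    (hH : ∀ η : ℝ → ℝ, ContDiff ℝ 1 η → ∀ s t, R₀ < s → Function.support η ⊆ Icc s t →
      a ^ 2 * ∫ x in Icc s t, η x ^ 2 ∂ν ≤ ∫ x in Icc s t, deriv η x ^ 2 ∂ν)
    {R : ℕ → ℝ} (hR : Tendsto R atTop atTop)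
    (hdecay : Tendsto (fun j => ∫⁻ s in Icc (R j) (R j + 1),
      ENNReal.ofReal (Real.exp (-2 * a * s)) ∂ν) atTop (𝓝 0))
    {ρ : ℝ} (hρ : R₀ + 1 < ρ) :
    ν (Icc ρ (ρ + 1)) ≤ ENNReal.ofReal ((2 * a + 1) / a ^ 2 * Real.exp (-2 * a * ρ)) *
      ∫⁻ s in Icc R₀ (R₀ + 1), ENNReal.ofReal (Real.exp (2 * a * s)) ∂ν := by
  have hcoef : 0 < (2 * a + 1) / a ^ 2 * Real.exp (-2 * a * ρ) := by positivity
  set I := ∫⁻ s in Icc R₀ (R₀ + 1), ENNReal.ofReal (Real.exp (2 * a * s)) ∂ν with hI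
  rcases eq_or_ne I ⊤ with hItop | hItop
  · rw [hItop, ENNReal.mul_top (ENNReal.ofReal_pos.2 hcoef).ne']
    exact le_top
  have hbound : ∀ δ > 0, a ^ 2 * ν.real (Icc ρ (ρ + 1)) ≤
      ((1 + δ) ^ 2 + 2 * a * (1 + δ)) * Real.exp (2 * a * (δ - ρ)) * I.toReal := by
    intro δ hδ
    obtain ⟨s₀, hs₀, h⟩ := sq_mul_measureReal_le ha hfin hH hρ hδ
    -- The point `s₀` depends on `δ`, so the integral is enlarged to start at `R₀` before `δ` tends
    -- to zero.
    have hI' : ∫ s in Icc s₀ (R₀ + 1), Real.exp (2 * a * s) ∂ν ≤ I.toReal := by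
      rw [integral_eq_lintegral_of_nonneg_ae (ae_of_all _ fun s => (Real.exp_pos _).le)
        (by fun_prop)]
      exact ENNReal.toReal_mono hItop (lintegral_mono_set (Icc_subset_Icc_left (le_of_lt hs₀)))
    have hlim : Tendsto (fun j => ∫ s in Icc (R j) (R j + 1), Real.exp (-2 * a * s) ∂ν) atTop
        (𝓝 0) := by
      have h1 := (ENNReal.tendsto_toReal ENNReal.zero_ne_top).comp hdecay
      refine h1.congr fun j => ?_
      rw [integral_eq_lintegral_of_nonneg_ae (ae_of_all _ fun s => (Real.exp_pos _).le)
        (by fun_prop)]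
      rfl
    have hlim' := (hlim.const_mul ((a + 2) ^ 2 * Real.exp (2 * a * (ρ + 1 + δ)))).const_add
      (((1 + δ) ^ 2 + 2 * a * (1 + δ)) * Real.exp (2 * a * (δ - ρ)) *
          ∫ s in Icc s₀ (R₀ + 1), Real.exp (2 * a * s) ∂ν)
    rw [mul_zero, add_zero] at hlim'
    -- The outer cutoff is moved to infinity along `T = R j` while `δ` is fixed; `δ → 0` is taken
    -- afterwards.
    refine (ge_of_tendsto hlim' ?_).trans (mul_le_mul_of_nonneg_left hI' (by positivity))
    filter_upwards [hR.eventually_gt_atTop (ρ + 1)] with j hj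
    exact h (R j) hj
  have hlim : Tendsto (fun δ : ℝ => ((1 + δ) ^ 2 + 2 * a * (1 + δ)) *
      Real.exp (2 * a * (δ - ρ)) * I.toReal) (𝓝[>] 0)
      (𝓝 (((1 + 0) ^ 2 + 2 * a * (1 + 0)) * Real.exp (2 * a * (0 - ρ)) * I.toReal)) :=
    ((by fun_prop : Continuous fun δ : ℝ => ((1 + δ) ^ 2 + 2 * a * (1 + δ)) *
      Real.exp (2 * a * (δ - ρ)) * I.toReal).tendsto 0).mono_left nhdsWithin_le_nhds
  have hfinal := ge_of_tendsto hlim (eventually_nhdsWithin_of_forall hbound)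
  rw [← ENNReal.ofReal_toReal (hfin ρ (by linarith) (ρ + 1)).ne, ← ENNReal.ofReal_toReal hItop,
    ← ENNReal.ofReal_mul hcoef.le]
  refine ENNReal.ofReal_le_ofReal ?_
  have h1 : ((1 + 0) ^ 2 + 2 * a * (1 + 0)) * Real.exp (2 * a * (0 - ρ)) * I.toReal =
      a ^ 2 * ((2 * a + 1) / a ^ 2 * Real.exp (-2 * a * ρ) * I.toReal) := by
    have h2 : 2 * a * (0 - ρ) = -2 * a * ρ := by ring
    rw [h2]
    field_simp
    ring
  rw [h1] at hfinal
  exact le_of_mul_le_mul_left hfinal (by positivity)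

/-! ### Topology of ends -/

section Ends

/-- A connected component of an open set is closed in it. -/
theorem closure_connectedComponentIn_inter_subset {X : Type*} [TopologicalSpace X]
    [LocallyConnectedSpace X] {U : Set X} (hU : IsOpen U) (x : X) :
    closure (connectedComponentIn U x) ∩ U ⊆ connectedComponentIn U x := by
  rintro y ⟨hy, hyU⟩
  obtain ⟨z, hz1, hz2⟩ := mem_closure_iff.1 hy _ (hU.connectedComponentIn (x := y))
    (mem_connectedComponentIn hyU)
  rw [connectedComponentIn_eq hz2, ← connectedComponentIn_eq hz1]
  exact mem_connectedComponentIn hyU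

theorem IsEnd.isOpen {X : Type*} [TopologicalSpace X] [LocallyConnectedSpace X] {K P : Set X}
    (hK : IsClosed K) (hP : IsEnd K P) : IsOpen P := by
  obtain ⟨⟨x, -, rfl⟩, -⟩ := hP
  exact hK.isOpen_compl.connectedComponentIn

/-- The end is relatively closed in the complement of the ball. For `s > R₀` the annulus stays away
from the ball, so replacing the end by its closure adds no points. -/
theorem IsEnd.isCompact_annulus {X : Type*} [MetricSpace X] [ProperSpace X]
    [LocallyConnectedSpace X] {p : X} {R₀ : ℝ} {P : Set X} (hP : IsEnd (Metric.closedBall p R₀) P)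
    {s : ℝ} (t : ℝ) (hs : R₀ < s) : IsCompact (annulus P p s t) := by
  obtain ⟨⟨x, -, rfl⟩, -⟩ := hP
  have hrc : Continuous fun x : X => dist x p := continuous_id.dist continuous_const
  have heq : annulus (connectedComponentIn (Metric.closedBall p R₀)ᶜ x) p s t =
      closure (connectedComponentIn (Metric.closedBall p R₀)ᶜ x) ∩
        {y | s ≤ dist y p ∧ dist y p ≤ t} := by
    refine Subset.antisymm (inter_subset_inter_left _ subset_closure) fun y hy => ⟨?_, hy.2⟩
    refine closure_connectedComponentIn_inter_subset Metric.isClosed_closedBall.isOpen_compl x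
      ⟨hy.1, fun h => ?_⟩
    linarith [Metric.mem_closedBall.1 h, hy.2.1]
  rw [heq]
  refine (isCompact_closedBall p t).of_isClosed_subset (isClosed_closure.inter
    ((isClosed_le continuous_const hrc).inter (isClosed_le hrc continuous_const)))
    fun y hy => hy.2.2

end Ends

/-! ### Reduction to a measure on the line -/

section RadialMeasure

variable [MeasurableSpace M] [BorelSpace M]

variable (n) in
/-- The distribution of the distance to `p` under the measure `f² dvol` on `P`. -/
def radialMeasure (P : Set M) (p : M) (f : M → ℝ) : Measure ℝ :=
  (((riemannianVolume n M).restrict P).withDensity fun x => ENNReal.ofReal (f x ^ 2)).map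
    fun x => dist x p

theorem setLIntegral_radialMeasure {P : Set M} (hP : IsOpen P) (p : M) {f : M → ℝ}
    (hf : ContinuousOn f P) {g : ℝ → ℝ} (hg : Continuous g) (hg0 : ∀ y, 0 ≤ g y) (s t : ℝ) :
    ∫⁻ y in Icc s t, ENNReal.ofReal (g y) ∂(radialMeasure n P p f) =
      ∫⁻ x in annulus P p s t, ENNReal.ofReal (g (dist x p) * f x ^ 2)
        ∂(riemannianVolume n M) := by
  have hrc : Continuous fun x : M => dist x p := continuous_id.dist continuous_const
  have hm : MeasurableSet ((fun x : M => dist x p) ⁻¹' Icc s t) := hrc.measurable measurableSet_Icc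
  have ha : annulus P p s t = (fun x : M => dist x p) ⁻¹' Icc s t ∩ P := inter_comm _ _
  have hfm : AEMeasurable (fun x => ENNReal.ofReal (f x ^ 2))
      (((riemannianVolume n M).restrict P).restrict ((fun x : M => dist x p) ⁻¹' Icc s t)) :=
    ((hf.pow 2).aemeasurable hP.measurableSet).ennreal_ofReal.restrict
  rw [radialMeasure, setLIntegral_map measurableSet_Icc hg.measurable.ennreal_ofReal hrc.measurable,
    restrict_withDensity hm, lintegral_withDensity_eq_lintegral_mul₀ hfm
      (g := fun x => ENNReal.ofReal (g (dist x p)))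
      (hg.measurable.ennreal_ofReal.comp hrc.measurable).aemeasurable,
    Measure.restrict_restrict hm, ← ha]
  refine lintegral_congr fun x => ?_
  rw [ENNReal.ofReal_mul (hg0 _), mul_comm]
  rfl

/-- Both integrands are nonnegative, so the identity follows from the one for `∫⁻` without any
integrability. -/
theorem setIntegral_radialMeasure {P : Set M} (hP : IsOpen P) (p : M) {f : M → ℝ}
    (hf : ContinuousOn f P) {g : ℝ → ℝ} (hg : Continuous g) (hg0 : ∀ y, 0 ≤ g y) (s t : ℝ) :
    ∫ y in Icc s t, g y ∂(radialMeasure n P p f) =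
      ∫ x in annulus P p s t, g (dist x p) * f x ^ 2 ∂(riemannianVolume n M) := by
  have hrc : Continuous fun x : M => dist x p := continuous_id.dist continuous_const
  have hm : MeasurableSet {x : M | s ≤ dist x p ∧ dist x p ≤ t} := hrc.measurable measurableSet_Icc
  have h1 : ContinuousOn (fun x => g (dist x p) * f x ^ 2) (annulus P p s t) :=
    (hg.comp hrc).continuousOn.mul ((hf.mono inter_subset_left).pow 2)
  rw [integral_eq_lintegral_of_nonneg_ae (ae_of_all _ hg0) hg.aestronglyMeasurable,
    integral_eq_lintegral_of_nonneg_ae (ae_of_all _ fun x => mul_nonneg (hg0 _) (sq_nonneg _))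
      (h1.aemeasurable (hP.measurableSet.inter hm)).aestronglyMeasurable,
    setLIntegral_radialMeasure hP p hf hg hg0]

end RadialMeasure

end LiWang

end

/-! ### The decay estimate -/

theorem mainTheorem7 {n : ℕ} {M : Type*} [MetricSpace M] [CompleteSpace M]
    [ChartedSpace (EuclideanSpace ℝ (Fin n)) M] [IsManifold (𝓡 n) ∞ M]
    [RiemannianBundle (fun x : M => TangentSpace (𝓡 n) x)]
    [IsContMDiffRiemannianBundle (𝓡 n) ∞ (EuclideanSpace ℝ (Fin n))
      (fun x : M => TangentSpace (𝓡 n) x)]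
    [IsRiemannianManifold (𝓡 n) M] [MeasurableSpace M] [BorelSpace M]
    (p : M) (R₀ : ℝ) (hR₀ : 0 < R₀)
    (P : Set M) (hP : LiWang.IsEnd (Metric.closedBall p R₀) P)
    (μ₁ : ℝ) (hμ₁ : IsGLB (LiWang.dirichletSpectrum n P) μ₁)
    (μ : ℝ) (hμ : μ < μ₁) (a : ℝ) (ha : a = Real.sqrt (μ₁ - μ))
    (f : M → ℝ) (hf : ContMDiffOn (𝓡 n) 𝓘(ℝ, ℝ) 2 f P) (hf_nonneg : ∀ x ∈ P, 0 ≤ f x)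
    (hf_sub : ∀ x ∈ P, -μ * f x ≤ LiWang.laplacian n f x)
    (hdecay : ∃ R : ℕ → ℝ, Tendsto R atTop atTop ∧
      Tendsto (fun j => ∫⁻ x in LiWang.annulus P p (R j) (R j + 1),
        ENNReal.ofReal (Real.exp (-2 * a * dist x p) * f x ^ 2) ∂(LiWang.riemannianVolume n M))
        atTop (𝓝 0)) :
    ∀ ρ : ℝ, R₀ + 1 < ρ →
      ∫⁻ x in LiWang.annulus P p ρ (ρ + 1), ENNReal.ofReal (f x ^ 2)
          ∂(LiWang.riemannianVolume n M) ≤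
        ENNReal.ofReal ((2 * a + 1) / a ^ 2 * Real.exp (-2 * a * ρ)) *
          ∫⁻ x in LiWang.annulus P p R₀ (R₀ + 1),
            ENNReal.ofReal (Real.exp (2 * a * dist x p) * f x ^ 2)
            ∂(LiWang.riemannianVolume n M) := by
  -- Properness gives compact annuli and the σ-compactness needed for partitions of unity; local
  -- connectedness makes the end open.
  have := LiWang.properSpace_of_complete n M
  have : LocallyConnectedSpace M :=
    ChartedSpace.locallyConnectedSpace (EuclideanSpace ℝ (Fin n)) M
  have ha2 : a ^ 2 = μ₁ - μ := by rw [ha, Real.sq_sqrt (by linarith)]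
  have ha0 : 0 < a := by rw [ha]; exact Real.sqrt_pos.2 (by linarith)
  have hPo : IsOpen P := hP.isOpen Metric.isClosed_closedBall
  have hfc : ContinuousOn f P := hf.continuousOn
  have hmass : ∀ s t, LiWang.radialMeasure n P p f (Icc s t) =
      ∫⁻ x in LiWang.annulus P p s t, ENNReal.ofReal (f x ^ 2) ∂(LiWang.riemannianVolume n M) := by
    intro s t
    have h := LiWang.setLIntegral_radialMeasure (n := n) hPo p hfc
      (continuous_const (y := (1 : ℝ))) (fun _ => zero_le_one) s t
    simpa using h
  obtain ⟨R, hR, hRlim⟩ := hdecay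
  intro ρ hρ
  rw [← hmass, ← LiWang.setLIntegral_radialMeasure (n := n) hPo p hfc
    (g := fun y => Real.exp (2 * a * y)) (by fun_prop) fun y => (Real.exp_pos _).le]
  -- Finiteness on compact radial intervals beyond `R₀` comes from compact annuli, and the Poincaré
  -- inequality for the radial measure from the Caccioppoli inequality with a radial cutoff.
  refine LiWang.measure_le_of_tendsto_zero ha0 (fun s hs t => ?_) (fun η hη s t hs hsupp => ?_)
    hR ?_ hρ
  · rw [hmass]
    exact (((hfc.mono inter_subset_left).pow 2).integrableOn_compact
      (hP.isCompact_annulus t hs)).lintegral_lt_top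
  · rw [LiWang.setIntegral_radialMeasure hPo p hfc (g := fun y => η y ^ 2) (hη.continuous.pow 2) fun y => sq_nonneg _,
      LiWang.setIntegral_radialMeasure hPo p hfc (g := fun y => deriv η y ^ 2)
        ((hη.continuous_deriv le_rfl).pow 2) fun y => sq_nonneg _, ha2]
    exact LiWang.mul_setIntegral_annulus_le hPo hμ₁.1 hf hf_nonneg hf_sub
      (fun s t hs => hP.isCompact_annulus t hs) hη hs hsupp
  · refine hRlim.congr fun j => ?_
    rw [LiWang.setLIntegral_radialMeasure hPo p hfc (g := fun y => Real.exp (-2 * a * y))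
      (by fun_prop) fun y => (Real.exp_pos _).le]
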